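/- Time is measured on a deterministic pointer machine (WHILE programs over binary trees, in which reading a variable, forming a cons cell, taking a head or a tail, and testing for $\mathrm{nil}$ each take one time unit). **Theorem.** There are a program and an absolute constant $c$ such that the following holds for every finite field $\mathbb{F}_q$ and every $n\ge 0$. The input consists of $n$; the field $\mathbb{F}_q$, given by its addition and multiplication tables with respect to an arbitrary numbering of its elements; a list of $\ell$ matrices in $\mathrm{GL}(n,q)$, generating a subgroup $H$; and two alternating matrices $A,B\in\Lambda(n,q)$, that is, $u^{\mathrm t}Au=u^{\mathrm t}Bu=0$ for all $u\in\mathbb{F}_q^n$. Numbers and field elements are written in unary. The program computes the set $$H_{A\to B}=\{g\in H:\ g^{\mathrm t}Ag=B\}:$$ it reports that the set is empty, or it outputs a matrix $g_0\in\mathrm{GL}(n,q)$ and a list $S$ of matrices in $\mathrm{GL}(n,q)$ such that $H_{A\to B}=\langle S\rangle\,g_0$. It halts within at most $$q^{\frac14 n^2+c(n+1)}+\ell\cdot q^{c(n+1)}$$ time units. In particular the running time is $q^{\frac14 n^2+O(n)}$ for $n\ge1$ whenever $\ell\le q^{\frac14 n^2+O(n)}$, with absolute implied constants if the constant in the bound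 on $\ell$ is absolute. -/

import Mathlib

/-! ### A deterministic machine model with a step count

The model is the textbook WHILE language over binary trees (cons cells).  A store holds one tree in
each of countably many variables, of which a program can mention only finitely many.  The
elementary operations are: read a variable, form `nil`, form a cons cell, take the head or the tail
of a cell, and test whether a tree is `nil`; each of them takes one time unit.  Trees are handled
by pointers, so a random access machine carries out every elementary operation in a bounded number
of operations. In particular there is no unit-cost arithmetic and no unit-cost comparison of
trees. -/

namespace WhileLang

/-- The data values: binary trees with unlabelled leaves. -/
inductive Data : Type
  | nil : Data
  | cons : Data → Data → Data

namespace Data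

/-- The head of a cons cell (and `nil` for `nil`). -/
def hd : Data → Data
  | nil => nil
  | cons a _ => a

/-- The tail of a cons cell (and `nil` for `nil`). -/
def tl : Data → Data
  | nil => nil
  | cons _ b => b

/-- A list of trees as a `nil`-terminated chain of cons cells. -/
def ofList : List Data → Data
  | [] => nil
  | a :: l => cons a (ofList l)

/-- A natural number in unary: a chain of `k` cons cells with heads `nil`. -/
def ofNat (k : ℕ) : Data := ofList (List.replicate k nil)

end Data

/-- A store assigns a tree to every variable. -/
abbrev Store : Type := ℕ → Data

/-- Expressions. -/
inductive Expr : Type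
  | var : ℕ → Expr
  | nil : Expr
  | cons : Expr → Expr → Expr
  | hd : Expr → Expr
  | tl : Expr → Expr

namespace Expr

/-- The value of an expression in a store. -/
def eval (σ : Store) : Expr → Data
  | var i => σ i
  | nil => Data.nil
  | cons a b => Data.cons (a.eval σ) (b.eval σ)
  | hd a => (a.eval σ).hd
  | tl a => (a.eval σ).tl

/-- The time for evaluating an expression: the number of its elementary operations. -/
def cost : Expr → ℕ
  | var _ => 1
  | nil => 1
  | cons a b => a.cost + b.cost + 1
  | hd a => a.cost + 1
  | tl a => a.cost + 1

end Expr

/-- Programs: assignments, sequencing, conditionals and loops.  The condition of a conditional or of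
a loop counts as false when its value is `nil`, and as true otherwise; `loop a P` is "while `a` do `P`". -/
inductive Cmd : Type
  | assign : ℕ → Expr → Cmd
  | seq : Cmd → Cmd → Cmd
  | ite : Expr → Cmd → Cmd → Cmd
  | loop : Expr → Cmd → Cmd

/-- `Runs P σ t τ`: started in the store `σ`, the program `P` halts after exactly `t` time units, and
the store is then `τ`. -/
inductive Runs : Cmd → Store → ℕ → Store → Prop
  | assign (σ : Store) (i : ℕ) (a : Expr) :
      Runs (Cmd.assign i a) σ (a.cost + 1) (Function.update σ i (a.eval σ))
  | seq {P Q : Cmd} {σ τ υ : Store} {s t : ℕ} :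
      Runs P σ s τ → Runs Q τ t υ → Runs (Cmd.seq P Q) σ (s + t) υ
  | ite_true {a : Expr} {P Q : Cmd} {σ τ : Store} {t : ℕ} :
      a.eval σ ≠ Data.nil → Runs P σ t τ → Runs (Cmd.ite a P Q) σ (a.cost + 1 + t) τ
  | ite_false {a : Expr} {P Q : Cmd} {σ τ : Store} {t : ℕ} :
      a.eval σ = Data.nil → Runs Q σ t τ → Runs (Cmd.ite a P Q) σ (a.cost + 1 + t) τ
  | loop_true {a : Expr} {P : Cmd} {σ τ υ : Store} {s t : ℕ} :
      a.eval σ ≠ Data.nil → Runs P σ s τ → Runs (Cmd.loop a P) τ t υ →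
        Runs (Cmd.loop a P) σ (a.cost + 1 + s + t) υ
  | loop_false {a : Expr} {P : Cmd} {σ : Store} :
      a.eval σ = Data.nil → Runs (Cmd.loop a P) σ (a.cost + 1) σ

/-- The initial store: the input is in variable `0`, and all other variables hold `nil`. -/
def initStore (x : Data) : Store := fun i => if i = 0 then x else Data.nil

/-- On input `x`, the program `P` halts after exactly `t` time units with output `y`, which it leaves
in variable `0`. -/
def Computes (P : Cmd) (x : Data) (t : ℕ) (y : Data) : Prop :=
  ∃ τ : Store, Runs P (initStore x) t τ ∧ τ 0 = y

end WhileLang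

/-! ### The alternating matrix transporter problem -/

namespace AltTransporter

open WhileLang

/-- A square matrix `A` is alternating if `uᵗ A u = 0` for every vector `u`. -/
def IsAlternating {F : Type} [Field F] {n : ℕ} (A : Matrix (Fin n) (Fin n) F) : Prop :=
  ∀ u : Fin n → F, dotProduct u (A.mulVec u) = 0

/-- The subgroup generated by the members of a list. -/
def generated {F : Type} [Field F] {n : ℕ} (S : List (Matrix.GeneralLinearGroup (Fin n) F)) :
    Subgroup (Matrix.GeneralLinearGroup (Fin n) F) :=
  Subgroup.closure {g | g ∈ S}

/-- The set of all `g ∈ H` with `gᵗ A g = B`. -/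
def transporter {F : Type} [Field F] {n : ℕ}
    (H : Subgroup (Matrix.GeneralLinearGroup (Fin n) F)) (A B : Matrix (Fin n) (Fin n) F) :
    Set (Matrix.GeneralLinearGroup (Fin n) F) :=
  {g | g ∈ H ∧
    (g : Matrix (Fin n) (Fin n) F).transpose * A * (g : Matrix (Fin n) (Fin n) F) = B}

/-- A description of a subset of `GL(n, F)` that is empty or a right coset of a subgroup: `none`
describes the empty set, and `some (g, S)` describes the coset `⟨S⟩ g`. -/
abbrev CosetDescription (F : Type) [Field F] (n : ℕ) : Type :=
  Option (Matrix.GeneralLinearGroup (Fin n) F × List (Matrix.GeneralLinearGroup (Fin n) F))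

/-- The set that a description describes. -/
def CosetDescription.toSet {F : Type} [Field F] {n : ℕ} :
    CosetDescription F n → Set (Matrix.GeneralLinearGroup (Fin n) F)
  | none => ∅
  | some (g, S) => {x | ∃ k ∈ generated S, x = k * g}

/-! Encodings as trees.  The elements of the finite field are named `0, …, q - 1` by an arbitrary
numbering `e`, and the field is presented by its addition and multiplication tables with respect to
that numbering. -/

/-- A field element is encoded by its number, in unary. -/
def encodeElem {F : Type} [Fintype F] (e : F ≃ Fin (Fintype.card F)) (x : F) : Data :=
  Data.ofNat (e x : ℕ)

/-- The table of a binary operation: the list of its rows, each the list of its entries. -/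
def encodeTable {F : Type} [Fintype F] (e : F ≃ Fin (Fintype.card F)) (op : F → F → F) : Data :=
  Data.ofList (List.ofFn fun a : Fin (Fintype.card F) =>
    Data.ofList (List.ofFn fun b : Fin (Fintype.card F) =>
      encodeElem e (op (e.symm a) (e.symm b))))

/-- A matrix is encoded as the list of its rows, each the list of its entries. -/
def encodeMatrix {F : Type} [Fintype F] {n : ℕ} (e : F ≃ Fin (Fintype.card F))
    (M : Matrix (Fin n) (Fin n) F) : Data :=
  Data.ofList (List.ofFn fun i : Fin n =>
    Data.ofList (List.ofFn fun j : Fin n => encodeElem e (M i j)))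

/-- A list of invertible matrices. -/
def encodeGLList {F : Type} [Field F] [Fintype F] {n : ℕ} (e : F ≃ Fin (Fintype.card F))
    (S : List (Matrix.GeneralLinearGroup (Fin n) F)) : Data :=
  Data.ofList (S.map fun g => encodeMatrix e (g : Matrix (Fin n) (Fin n) F))

/-- An instance of the problem: the dimension `n` in unary, the addition and the multiplication
table of the field, the list of generators, and the matrices `A` and `B`. -/
def encodeInput {F : Type} [Field F] [Fintype F] {n : ℕ} (e : F ≃ Fin (Fintype.card F))
    (S : List (Matrix.GeneralLinearGroup (Fin n) F)) (A B : Matrix (Fin n) (Fin n) F) : Data :=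
  Data.ofList [Data.ofNat n, encodeTable e (fun x y => x + y), encodeTable e (fun x y => x * y),
    encodeGLList e S, encodeMatrix e A, encodeMatrix e B]

/-- An output: `nil` for the empty set, and the pair of a coset representative and a list of
generators for a coset. -/
def encodeOutput {F : Type} [Field F] [Fintype F] {n : ℕ} (e : F ≃ Fin (Fintype.card F)) :
    CosetDescription F n → Data
  | none => Data.nil
  | some (g, S) => Data.cons (encodeMatrix e (g : Matrix (Fin n) (Fin n) F)) (encodeGLList e S)

end AltTransporter

/-! Let V_K be the span of the first K basis vectors. Let P_K be the set of g in H for which gᵗAg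
and B agree on V_K, and G_K the group of all s in H that preserve V_K and the restriction of B to
it. Then P_K G_K = P_K, and two elements x, y of P_K with xV_K = yV_K satisfy x⁻¹y ∈ G_K. So P_K is
a union of cosets hG_K, one for each subspace hV_K that occurs, and F^n has at most q^(n + n²/4)
subspaces (`card_submodule_le`). The algorithm carries generators of G_K and one representative of
each coset from K to K + 1. It starts with P_0 = G_0 = H; at the end P_n is empty or equals hG_n =
(hG_nh⁻¹)h.

For the passage from K to K + 1, let e be the new basis vector. The elements of G_K that fix e and
the row vectors (Be)ᵗ and eᵗB lie in G_{K+1} (`fixForm_inf_le`), and they form a subgroup of index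
at most q^(3n). Sifting along a chain of stabilizers gives a table T of q^O(n) elements that
generates G_K, such that every element of G_K is rc with r in T and c generated by the table entries
in that subgroup (`Sift.IsChain.table_spec`). Since c lies in G_{K+1}, the products hr that pass the
form test on V_{K+1} represent all of P_{K+1}, and those with the same image of V_{K+1} are merged.
The small entries of T together with the quotients x₀⁻¹y of surviving products that preserve V_{K+1}
generate G_{K+1} (`Invariant.step`).

For the time bound, tables have q^O(n) entries and sifting one element costs q^O(n). Merging uses a
trie, because pairwise comparison would square the number of subspaces. A step returns a number of
generators that does not depend on the number it received (`cosetStep_length`), so ℓ enters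
linearly.

The program is not written out by hand: `CompIn f w` says that one program computes f in time
q^O(n+1) · (w + 1), and this notion is closed under composition, pairing, branching and folds.
`CompIn.result` follows from the functional description of the algorithm, and `time_le` puts its
bound into the stated form. -/

/-! ### Running programs in place

Variable `0` holds the argument and the result, variable `1` a stack that is restored, variable `2`
is scratch, and variable `3` holds a read-only context. -/

namespace WhileLang

/-- `P` turns `x` into `y` in variable `0` within `t` time units when the context is `ctx`. -/
def Exec (ctx : Data) (P : Cmd) (x : Data) (t : ℕ) (y : Data) : Prop :=
  ∀ σ : Store, σ 0 = x → σ 3 = ctx →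
    ∃ s τ, s ≤ t ∧ Runs P σ s τ ∧ τ 0 = y ∧ τ 1 = σ 1 ∧ τ 3 = ctx

theorem Runs.assign_eq {σ : Store} {i : ℕ} {a : Expr} {v : Data} (h : a.eval σ = v) :
    Runs (.assign i a) σ (a.cost + 1) (Function.update σ i v) :=
  h ▸ Runs.assign σ i a

namespace Exec

variable {ctx x y z : Data} {P Q R : Cmd} {s t r : ℕ}

theorem mono (h : Exec ctx P x s y) (hst : s ≤ t) : Exec ctx P x t y := by
  intro σ h0 h3
  obtain ⟨u, τ, hu, h⟩ := h σ h0 h3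
  exact ⟨u, τ, hu.trans hst, h⟩

theorem assign (a : Expr) (h : ∀ σ : Store, σ 0 = x → σ 3 = ctx → a.eval σ = y) :
    Exec ctx (.assign 0 a) x (a.cost + 1) y := by
  intro σ h0 h3
  refine ⟨_, _, le_rfl, Runs.assign σ 0 a, ?_, ?_, ?_⟩ <;> simp [Function.update, h σ h0 h3, h3]

theorem seq (hP : Exec ctx P x s y) (hQ : Exec ctx Q y t z) :
    Exec ctx (.seq P Q) x (s + t) z := by
  intro σ h0 h3
  obtain ⟨u, τ, hu, hr, h0', h1', h3'⟩ := hP σ h0 h3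
  obtain ⟨v, υ, hv, hr', h0'', h1'', h3''⟩ := hQ τ h0' h3'
  exact ⟨u + v, υ, by omega, hr.seq hr', h0'', h1''.trans h1', h3''⟩

end Exec

/-! ### Program combinators that leave the stack unchanged -/

namespace Cmd

/-- Run `P` and `Q` on the same argument and pair the results. -/
def pair (P Q : Cmd) : Cmd :=
  .seq (.assign 1 (.cons (.var 0) (.var 1))) <| .seq P <|
  .seq (.assign 2 (.hd (.var 1))) <| .seq (.assign 1 (.cons (.var 0) (.tl (.var 1)))) <|
  .seq (.assign 0 (.var 2)) <| .seq Q <|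
  .seq (.assign 0 (.cons (.hd (.var 1)) (.var 0))) (.assign 1 (.tl (.var 1)))

/-- Run `P` or `Q` according to the result of `C`, all on the same argument. -/
def cond (C P Q : Cmd) : Cmd :=
  .seq (.assign 1 (.cons (.var 0) (.var 1))) <| .seq C <|
  .seq (.assign 2 (.var 0)) <| .seq (.assign 0 (.hd (.var 1))) <|
  .seq (.assign 1 (.tl (.var 1))) (.ite (.var 2) P Q)

/-- The loop of `foldl`: the top of the stack holds the parameter and the rest of the list. -/
def foldLoop (P : Cmd) : Cmd :=
  .loop (.tl (.hd (.var 1))) <|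
    .seq (.assign 0 (.cons (.hd (.hd (.var 1))) (.cons (.var 0) (.hd (.tl (.hd (.var 1))))))) <|
    .seq (.assign 1 (.cons (.cons (.hd (.hd (.var 1))) (.tl (.tl (.hd (.var 1)))))
      (.tl (.var 1)))) P

/-- Fold `P` over the list that `L` computes, starting from the value that `I` computes. -/
def foldl (L I P : Cmd) : Cmd :=
  .seq (pair (pair (.assign 0 (.var 0)) L) I) <|
  .seq (.assign 1 (.cons (.hd (.var 0)) (.var 1))) <|
  .seq (.assign 0 (.tl (.var 0))) <|
  .seq (foldLoop P) (.assign 1 (.tl (.var 1)))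

end Cmd

namespace Exec

variable {ctx x y z : Data} {P Q C : Cmd} {s t r : ℕ}

/-- The argument waits on the stack while `P` runs, and the result of `P` waits there while `Q`
runs. The constant `30` generously covers the bookkeeping assignments. -/
theorem pair (hP : Exec ctx P x s y) (hQ : Exec ctx Q x t z) :
    Exec ctx (P.pair Q) x (s + t + 30) (.cons y z) := by
  intro σ h0 h3
  obtain ⟨u, τ, hu, hr, h0', h1', h3'⟩ :=
    hP (Function.update σ 1 (.cons (σ 0) (σ 1))) (by simp [h0]) (by simp [h3])
  simp only [Function.update_self] at h1'
  set τ₁ := Function.update τ 2 (σ 0) with hτ₁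
  set τ₂ := Function.update τ₁ 1 (.cons y (σ 1)) with hτ₂
  set τ₃ := Function.update τ₂ 0 (σ 0) with hτ₃
  obtain ⟨v, υ, hv, hr', h0'', h1'', h3''⟩ := hQ τ₃ (by simp [hτ₃, h0])
    (by simp [hτ₃, hτ₂, hτ₁, h3'])
  have e1 : τ₃ 1 = .cons y (σ 1) := by simp [hτ₃, hτ₂]
  rw [e1] at h1''
  have r1 : Runs (.assign 2 (.hd (.var 1))) τ (Expr.cost _ + 1) τ₁ :=
      Runs.assign_eq (by simp [Expr.eval, h1', Data.hd])
  have r2 : Runs (.assign 1 (.cons (.var 0) (.tl (.var 1)))) τ₁ (Expr.cost _ + 1) τ₂ :=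
      Runs.assign_eq (by simp [Expr.eval, hτ₁, h0', h1', Data.tl])
  have r3 : Runs (.assign 0 (.var 2)) τ₂ (Expr.cost _ + 1) τ₃ :=
      Runs.assign_eq (by simp [Expr.eval, hτ₂, hτ₁])
  refine ⟨_, _, ?_, (Runs.assign _ _ _).seq <| hr.seq <| r1.seq <| r2.seq <| r3.seq <| hr'.seq <|
    (Runs.assign _ _ _).seq (Runs.assign _ _ _), ?_, ?_, ?_⟩
  · simp [Expr.cost]; omega
  · simp [Expr.eval, h1'', h0'', Data.hd]
  · simp [Expr.eval, h1'', Data.tl]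
  · simp [h3'']

/-- Each branch has to run only in the case in which it is taken, so its correctness may use the
outcome of the test. -/
theorem cond (hC : Exec ctx C x s y) (hP : y ≠ .nil → Exec ctx P x t z)
    (hQ : y = .nil → Exec ctx Q x t z) : Exec ctx (C.cond P Q) x (s + t + 20) z := by
  intro σ h0 h3
  obtain ⟨u, τ, hu, hr, h0', h1', h3'⟩ :=
    hC (Function.update σ 1 (.cons (σ 0) (σ 1))) (by simp [h0]) (by simp [h3])
  simp only [Function.update_self] at h1'
  set τ₁ := Function.update τ 2 y with hτ₁
  set τ₂ := Function.update τ₁ 0 x with hτ₂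
  set τ₃ := Function.update τ₂ 1 (σ 1) with hτ₃
  have r1 : Runs (.assign 2 (.var 0)) τ (Expr.cost _ + 1) τ₁ :=
      Runs.assign_eq (by simp [Expr.eval, h0'])
  have r2 : Runs (.assign 0 (.hd (.var 1))) τ₁ (Expr.cost _ + 1) τ₂ :=
      Runs.assign_eq (by simp [Expr.eval, hτ₁, h1', Data.hd, h0])
  have r3 : Runs (.assign 1 (.tl (.var 1))) τ₂ (Expr.cost _ + 1) τ₃ :=
      Runs.assign_eq (by simp [Expr.eval, hτ₂, hτ₁, h1', Data.tl])
  have e2 : (Expr.var 2).eval τ₃ = y := by simp [Expr.eval, hτ₃, hτ₂, hτ₁]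
  have e0 : τ₃ 0 = x := by simp [hτ₃, hτ₂]
  have e1 : τ₃ 1 = σ 1 := by simp [hτ₃]
  have e3 : τ₃ 3 = ctx := by simp [hτ₃, hτ₂, hτ₁, h3']
  by_cases hy : y = .nil
  · obtain ⟨v, υ, hv, hr', h0'', h1'', h3''⟩ := hQ hy τ₃ e0 e3
    refine ⟨_, υ, ?_, (Runs.assign _ _ _).seq <| hr.seq <| r1.seq <| r2.seq <| r3.seq <|
      Runs.ite_false (e2.trans hy) hr', h0'', h1''.trans e1, h3''⟩
    simp [Expr.cost]; omega
  · obtain ⟨v, υ, hv, hr', h0'', h1'', h3''⟩ := hP hy τ₃ e0 e3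
    refine ⟨_, υ, ?_, (Runs.assign _ _ _).seq <| hr.seq <| r1.seq <| r2.seq <| r3.seq <|
      Runs.ite_true (by rwa [e2]) hr', h0'', h1''.trans e1, h3''⟩
    simp [Expr.cost]; omega

/-- The step is required to run only on accumulators that are reached, namely those given by
prefixes of `l`. A fold can therefore be bounded through its actual intermediate values. -/
theorem foldLoop {β δ : Type} (eb : β → Data) (ed : δ → Data) (f : β → δ → β) {B : ℕ} {p : Data}
    (l : List δ) (b : β) (hf : ∀ pre a post, l = pre ++ a :: post →
      Exec ctx P (.cons p (.cons (eb (pre.foldl f b)) (ed a))) B (eb ((pre ++ [a]).foldl f b)))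
    (σ : Store) (k : Data) (h0 : σ 0 = eb b)
    (h1 : σ 1 = .cons (.cons p (.ofList (l.map ed))) k) (h3 : σ 3 = ctx) :
    ∃ s τ, s ≤ l.length * (B + 30) + 4 ∧ Runs P.foldLoop σ s τ ∧ τ 0 = eb (l.foldl f b) ∧
      τ 1 = .cons (.cons p .nil) k ∧ τ 3 = ctx := by
  induction l generalizing b σ with
  | nil =>
    refine ⟨_, σ, ?_, Runs.loop_false ?_, h0, h1, h3⟩
    · simp [Expr.cost]
    · simp [Expr.eval, h1, Data.hd, Data.tl, Data.ofList]
  | cons a l ih =>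
    simp only [List.map_cons, Data.ofList] at h1
    set σ₁ := Function.update σ 0 (.cons p (.cons (eb b) (ed a))) with hσ₁
    set σ₂ := Function.update σ₁ 1 (.cons (.cons p (.ofList (l.map ed))) k) with hσ₂
    have r1 : Runs (.assign 0 (.cons (.hd (.hd (.var 1)))
        (.cons (.var 0) (.hd (.tl (.hd (.var 1))))))) σ (Expr.cost _ + 1) σ₁ :=
      Runs.assign_eq (by simp [Expr.eval, h1, h0, Data.hd, Data.tl])
    have r2 : Runs (.assign 1 (.cons (.cons (.hd (.hd (.var 1))) (.tl (.tl (.hd (.var 1)))))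
        (.tl (.var 1)))) σ₁ (Expr.cost _ + 1) σ₂ :=
      Runs.assign_eq (by simp [Expr.eval, hσ₁, h1, Data.hd, Data.tl])
    obtain ⟨u, τ, hu, hr, h0', h1', h3'⟩ := hf [] a l rfl σ₂ (by simp [hσ₂, hσ₁])
      (by simp [hσ₂, hσ₁, h3])
    obtain ⟨v, υ, hv, hr', h0'', h1'', h3''⟩ := ih (f b a)
      (fun pre c post h => by simpa using hf (a :: pre) c post (by simp [h])) τ (by simpa using h0')
      (by rw [h1']; simp [hσ₂]) h3'
    refine ⟨_, υ, ?_, Runs.loop_true ?_ (r1.seq <| r2.seq hr) hr', h0'', h1'', h3''⟩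
    · simp [Expr.cost, Nat.add_mul]; omega
    · simp [Expr.eval, h1, Data.hd, Data.tl]

theorem foldl {β δ : Type} (eb : β → Data) (ed : δ → Data) (f : β → δ → β) {B : ℕ}
    {L I : Cmd} {l : List δ} {b : β} (hL : Exec ctx L x s (.ofList (l.map ed)))
    (hI : Exec ctx I x t (eb b)) (hf : ∀ pre a post, l = pre ++ a :: post →
      Exec ctx P (.cons x (.cons (eb (pre.foldl f b)) (ed a))) B (eb ((pre ++ [a]).foldl f b))) :
    Exec ctx (Cmd.foldl L I P) x (s + t + l.length * (B + 30) + 100) (eb (l.foldl f b)) := by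
  intro σ h0 h3
  have hpre := ((Exec.assign (ctx := ctx) (x := x) (y := x) (.var 0)
    fun σ h _ => by simp [Expr.eval, h]).pair hL).pair hI
  obtain ⟨u, τ, hu, hr, h0', h1', h3'⟩ := hpre σ h0 h3
  set τ₁ := Function.update τ 1 (.cons (.cons x (.ofList (l.map ed))) (σ 1)) with hτ₁
  set τ₂ := Function.update τ₁ 0 (eb b) with hτ₂
  have r1 : Runs (.assign 1 (.cons (.hd (.var 0)) (.var 1))) τ (Expr.cost _ + 1) τ₁ :=
      Runs.assign_eq (by simp [Expr.eval, h0', h1', Data.hd])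
  have r2 : Runs (.assign 0 (.tl (.var 0))) τ₁ (Expr.cost _ + 1) τ₂ :=
      Runs.assign_eq (by simp [Expr.eval, hτ₁, h0', Data.tl])
  obtain ⟨v, υ, hv, hr', h0'', h1'', h3''⟩ := foldLoop eb ed f l b hf τ₂ (σ 1)
    (by simp [hτ₂]) (by simp [hτ₂, hτ₁]) (by simp [hτ₂, hτ₁, h3'])
  refine ⟨_, _, ?_, hr.seq <| r1.seq <| r2.seq <| hr'.seq (Runs.assign _ _ _), ?_, ?_, ?_⟩
  · simp [Expr.cost] at hu ⊢; omega
  · simp [h0'']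
  · simp [Expr.eval, h1'', Data.tl]
  · simp [h3'']

end Exec

end WhileLang

/-! ### Uniformly computable families of functions -/

namespace AltTransporter

open WhileLang

/-- An instance of the transporter problem. -/
structure Inst where
  F : Type
  [field : Field F]
  [fintype : Fintype F]
  e : F ≃ Fin (Fintype.card F)
  n : ℕ
  gens : List (Matrix.GeneralLinearGroup (Fin n) F)
  A : Matrix (Fin n) (Fin n) F
  B : Matrix (Fin n) (Fin n) F

namespace Inst

attribute [instance] Inst.field Inst.fintype

/-- The order of the field. -/
def q (i : Inst) : ℕ := Fintype.card i.F

/-- The size parameter: polynomials in it are the time bounds `q ^ O(n + 1)`. -/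
def size (i : Inst) : ℕ := i.q ^ (i.n + 1)

/-- The encoded input. -/
def ctx (i : Inst) : Data := encodeInput i.e i.gens i.A i.B

theorem two_le_q (i : Inst) : 2 ≤ i.q := Fintype.one_lt_card

theorem two_le_size (i : Inst) : 2 ≤ i.size :=
  i.two_le_q.trans (Nat.le_self_pow (by omega) _)

theorem one_le_size_pow (i : Inst) (c : ℕ) : 1 ≤ i.size ^ c :=
  Nat.one_le_pow _ _ (by linarith [i.two_le_size])

theorem le_size_pow (i : Inst) (c : ℕ) : c ≤ i.size ^ c :=
  (Nat.lt_pow_self (by linarith [i.two_le_size])).le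

theorem size_pow_le (i : Inst) {c d : ℕ} (h : c ≤ d) : i.size ^ c ≤ i.size ^ d :=
  Nat.pow_le_pow_right (by linarith [i.two_le_size]) h

theorem n_le_size (i : Inst) : i.n + 1 ≤ i.size := (Nat.lt_pow_self (i.two_le_q)).le

theorem q_le_size (i : Inst) : i.q ≤ i.size := Nat.le_self_pow (by omega) _

theorem pow_n_le_size (i : Inst) : i.q ^ i.n ≤ i.size :=
  Nat.pow_le_pow_right (by linarith [i.two_le_q]) (by omega)

end Inst

/-- Encodings as trees. -/
class Enc (α : Type) where
  enc : α → Data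

open Enc (enc)

instance : Enc Data := ⟨id⟩
instance : Enc Unit := ⟨fun _ => .nil⟩
instance : Enc Bool := ⟨fun b => bif b then .cons .nil .nil else .nil⟩
instance : Enc ℕ := ⟨Data.ofNat⟩
instance {m : ℕ} : Enc (Fin m) := ⟨fun k => Data.ofNat k⟩
instance {α β : Type} [Enc α] [Enc β] : Enc (α × β) := ⟨fun p => .cons (enc p.1) (enc p.2)⟩
instance {α : Type} [Enc α] : Enc (List α) := ⟨fun l => .ofList (l.map enc)⟩
instance {α : Type} [Enc α] : Enc (Option α) := ⟨fun o => o.elim .nil fun a => .cons (enc a) .nil⟩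
instance {m : ℕ} {α : Type} [Enc α] : Enc (Fin m → α) :=
  ⟨fun v => .ofList (List.ofFn fun j => enc (v j))⟩
instance (i : Inst) : Enc i.F := ⟨encodeElem i.e⟩
instance (i : Inst) : Enc (Matrix (Fin i.n) (Fin i.n) i.F) := ⟨encodeMatrix i.e⟩
instance (i : Inst) : Enc (Matrix.GeneralLinearGroup (Fin i.n) i.F) :=
  ⟨fun g => encodeMatrix i.e (g : Matrix (Fin i.n) (Fin i.n) i.F)⟩
instance (i : Inst) : Enc (CosetDescription i.F i.n) := ⟨encodeOutput i.e⟩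

variable {α β γ δ ε : Inst → Type} [∀ i, Enc (α i)] [∀ i, Enc (β i)] [∀ i, Enc (γ i)]
  [∀ i, Enc (δ i)] [∀ i, Enc (ε i)]

/-- One program computes all functions `f i`, in time polynomial in the size parameter times the
weight `w`. -/
def CompIn (f : ∀ i, α i → β i) (w : ∀ i, α i → ℕ) : Prop :=
  ∃ (P : Cmd) (c : ℕ), ∀ i x, Exec i.ctx P (enc x) (i.size ^ c * (w i x + 1)) (enc (f i x))

/-- Computability in time polynomial in the size parameter. -/
abbrev Fast (f : ∀ i, α i → β i) : Prop := CompIn f fun _ _ => 0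

/-- Since the size parameter is at least 2, a constant factor `K` is at most `i.size ^ K` and only
raises the exponent. -/
theorem CompIn.of_exec {f : ∀ i, α i → β i} {w : ∀ i, α i → ℕ} (P : Cmd) (c K : ℕ)
    (h : ∀ i x, Exec i.ctx P (enc x) (i.size ^ c * (K * (w i x + 1))) (enc (f i x))) :
    CompIn f w := by
  refine ⟨P, c + K, fun i x => (h i x).mono ?_⟩
  rw [pow_add, mul_assoc]
  gcongr
  exact i.le_size_pow K

theorem CompIn.mono {f : ∀ i, α i → β i} {w w' : ∀ i, α i → ℕ} (hf : CompIn f w) (c : ℕ)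
    (h : ∀ i x, w i x ≤ i.size ^ c * (w' i x + 1)) : CompIn f w' := by
  obtain ⟨P, d, hP⟩ := hf
  refine CompIn.of_exec P (d + c) 2 fun i x => (hP i x).mono ?_
  have h1 := h i x
  have h2 := i.one_le_size_pow c
  rw [pow_add, mul_assoc]
  gcongr
  nlinarith

theorem CompIn.le {f : ∀ i, α i → β i} {w w' : ∀ i, α i → ℕ} (hf : CompIn f w)
    (h : ∀ i x, w i x ≤ w' i x) : CompIn f w' :=
  hf.mono 0 fun i x => by have := h i x; simp; omega

theorem Fast.of_exec {f : ∀ i, α i → β i} (P : Cmd) (K : ℕ)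
    (h : ∀ i x, Exec i.ctx P (enc x) K (enc (f i x))) : Fast f :=
  CompIn.of_exec P 0 K fun i x => (h i x).mono (by simp)

theorem Fast.weaken {f : ∀ i, α i → β i} {w : ∀ i, α i → ℕ} (hf : Fast f) : CompIn f w :=
  hf.le fun _ _ => Nat.zero_le _

theorem Fast.of_expr {f : ∀ i, α i → β i} (a : Expr)
    (h : ∀ i x (σ : Store), σ 0 = enc x → σ 3 = i.ctx → a.eval σ = enc (f i x)) : Fast f :=
  Fast.of_exec (.assign 0 a) _ fun i x => Exec.assign a (h i x)

/-- Programs see only trees, so a change of type that keeps the encoding is free. -/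
theorem CompIn.congr_enc {f : ∀ i, α i → β i} {g : ∀ i, α i → γ i} {w : ∀ i, α i → ℕ}
    (hf : CompIn f w) (h : ∀ i x, enc (g i x) = enc (f i x)) : CompIn g w := by
  obtain ⟨P, c, hP⟩ := hf
  exact ⟨P, c, fun i x => h i x ▸ hP i x⟩

theorem CompIn.of_eq {f g : ∀ i, α i → β i} {w : ∀ i, α i → ℕ}
    (hf : CompIn f w) (h : ∀ i x, g i x = f i x) : CompIn g w :=
  hf.congr_enc fun i x => by rw [h]

theorem Fast.recast {f : ∀ i, α i → β i} (h : ∀ i x, enc (f i x) = enc x) : Fast f :=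
  Fast.of_expr (.var 0) fun i x σ h0 _ => by rw [h, ← h0]; rfl

theorem Fast.id : Fast fun i (x : α i) => x := Fast.recast fun _ _ => rfl

theorem CompIn.comp {g : ∀ i, β i → γ i} {f : ∀ i, α i → β i} {v : ∀ i, β i → ℕ}
    {w : ∀ i, α i → ℕ} (hg : CompIn g v) (hf : CompIn f w) :
    CompIn (fun i x => g i (f i x)) fun i x => w i x + v i (f i x) := by
  obtain ⟨P, c, hP⟩ := hg
  obtain ⟨Q, d, hQ⟩ := hf
  refine CompIn.of_exec (.seq Q P) (c + d) 2 fun i x => ((hQ i x).seq (hP i (f i x))).mono ?_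
  have h1 := i.size_pow_le (Nat.le_add_right c d)
  have h2 := i.size_pow_le (Nat.le_add_left d c)
  nlinarith [Nat.mul_le_mul_right (v i (f i x) + 1) h1, Nat.mul_le_mul_right (w i x + 1) h2,
    Nat.zero_le (i.size ^ (c + d) * v i (f i x)), Nat.zero_le (i.size ^ (c + d) * w i x)]

theorem Fast.comp {g : ∀ i, β i → γ i} {f : ∀ i, α i → β i} (hg : Fast g) (hf : Fast f) :
    Fast fun i x => g i (f i x) := CompIn.comp hg hf

theorem CompIn.comp_fast {g : ∀ i, β i → γ i} {f : ∀ i, α i → β i} {v : ∀ i, β i → ℕ}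
    (hg : CompIn g v) (hf : Fast f) : CompIn (fun i x => g i (f i x)) fun i x => v i (f i x) :=
  (CompIn.comp hg hf).le fun i x => by omega

theorem CompIn.pair {f : ∀ i, α i → β i} {g : ∀ i, α i → γ i} {v w : ∀ i, α i → ℕ}
    (hf : CompIn f v) (hg : CompIn g w) :
    CompIn (fun i x => (f i x, g i x)) fun i x => v i x + w i x := by
  obtain ⟨P, c, hP⟩ := hf
  obtain ⟨Q, d, hQ⟩ := hg
  refine CompIn.of_exec (P.pair Q) (c + d) 32 fun i x => ((hP i x).pair (hQ i x)).mono ?_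
  have h1 := i.size_pow_le (Nat.le_add_right c d)
  have h2 := i.size_pow_le (Nat.le_add_left d c)
  have h3 := i.one_le_size_pow (c + d)
  nlinarith [Nat.mul_le_mul_right (v i x + 1) h1, Nat.mul_le_mul_right (w i x + 1) h2,
    Nat.zero_le (i.size ^ (c + d) * v i x), Nat.zero_le (i.size ^ (c + d) * w i x)]

theorem Fast.pair {f : ∀ i, α i → β i} {g : ∀ i, α i → γ i} (hf : Fast f) (hg : Fast g) :
    Fast fun i x => (f i x, g i x) := CompIn.pair hf hg

theorem Fast.fst : Fast fun i (x : α i × β i) => x.1 :=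
  Fast.of_expr (.hd (.var 0)) fun i x σ h0 _ => by simp only [Expr.eval, h0]; rfl

theorem Fast.snd : Fast fun i (x : α i × β i) => x.2 :=
  Fast.of_expr (.tl (.var 0)) fun i x σ h0 _ => by simp only [Expr.eval, h0]; rfl

theorem CompIn.ite {p : ∀ i, α i → Bool} {f g : ∀ i, α i → β i} {u v w : ∀ i, α i → ℕ}
    (hp : CompIn p u) (hf : CompIn f v) (hg : CompIn g w) :
    CompIn (fun i x => bif p i x then f i x else g i x) fun i x => u i x + v i x + w i x := by
  obtain ⟨C, b, hC⟩ := hp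
  obtain ⟨P, c, hP⟩ := hf
  obtain ⟨Q, d, hQ⟩ := hg
  refine CompIn.of_exec (Cmd.cond C P Q) (b + c + d) 32 fun i x => ((hC i x).cond
    (t := i.size ^ c * (v i x + 1) + i.size ^ d * (w i x + 1)) (fun h => ?_) fun h => ?_).mono ?_
  · have : p i x = true := by
      cases hx : p i x with
      | true => rfl
      | false => simp [hx, enc] at h
    rw [this]
    exact (hP i x).mono (by omega)
  · have : p i x = false := by
      cases hx : p i x with
      | true => simp [hx, enc] at h
      | false => rfl
    rw [this]
    exact (hQ i x).mono (by omega)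
  · have h0 := i.size_pow_le (show b ≤ b + c + d by omega)
    have h1 := i.size_pow_le (show c ≤ b + c + d by omega)
    have h2 := i.size_pow_le (show d ≤ b + c + d by omega)
    have h3 := i.one_le_size_pow (b + c + d)
    nlinarith [Nat.mul_le_mul_right (v i x + 1) h1, Nat.mul_le_mul_right (w i x + 1) h2,
      Nat.mul_le_mul_right (u i x + 1) h0,
      Nat.zero_le (i.size ^ (b + c + d) * v i x), Nat.zero_le (i.size ^ (b + c + d) * w i x),
      Nat.zero_le (i.size ^ (b + c + d) * u i x)]

theorem Fast.ite {p : ∀ i, α i → Bool} {f g : ∀ i, α i → β i}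
    (hp : Fast p) (hf : Fast f) (hg : Fast g) :
    Fast fun i x => bif p i x then f i x else g i x := CompIn.ite hp hf hg

/-- A fold whose steps have weight at most `B`. -/
theorem CompIn.foldl {l : ∀ i, α i → List (δ i)} {b : ∀ i, α i → β i}
    {s : ∀ i, α i × β i × δ i → β i} {u v B : ∀ i, α i → ℕ} {w : ∀ i, α i × β i × δ i → ℕ}
    (hl : CompIn l u) (hb : CompIn b v) (hs : CompIn s w)
    (hB : ∀ i x (pre : List (δ i)) a post, l i x = pre ++ a :: post →
      w i (x, pre.foldl (fun y z => s i (x, y, z)) (b i x), a) ≤ B i x) :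
    CompIn (fun i x => (l i x).foldl (fun y z => s i (x, y, z)) (b i x))
      fun i x => u i x + v i x + (l i x).length * (B i x + 1) := by
  obtain ⟨L, c, hL⟩ := hl
  obtain ⟨I, d, hI⟩ := hb
  obtain ⟨P, e, hP⟩ := hs
  refine CompIn.of_exec (Cmd.foldl L I P) (c + d + e) 200 fun i x =>
    ((Exec.foldl enc enc (fun y z => s i (x, y, z)) (hL i x) (hI i x)
      (B := i.size ^ e * (B i x + 1)) fun pre a post h => ?_)).mono ?_
  · rw [List.foldl_append]
    exact (hP i (x, pre.foldl (fun y z => s i (x, y, z)) (b i x), a)).mono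
      (Nat.mul_le_mul_left _ (Nat.succ_le_succ (hB i x pre a post h)))
  · have h0 := i.size_pow_le (show c ≤ c + d + e by omega)
    have h1 := i.size_pow_le (show d ≤ c + d + e by omega)
    have h2 := i.size_pow_le (show e ≤ c + d + e by omega)
    have h3 := i.one_le_size_pow (c + d + e)
    set M := i.size ^ (c + d + e)
    set k := (l i x).length
    have e0 := Nat.mul_le_mul_right (u i x + 1) h0
    have e1 := Nat.mul_le_mul_right (v i x + 1) h1
    have e2 := Nat.mul_le_mul_left k (Nat.mul_le_mul_right (B i x + 1) h2)
    have e3 : k * 30 ≤ M * (k * (B i x + 1)) * 30 := by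
      calc k * 30 ≤ (1 * (k * 1)) * 30 := by omega
        _ ≤ _ := by gcongr; omega
    have e4 : k * (M * (B i x + 1)) = M * (k * (B i x + 1)) := by ring
    nlinarith [Nat.zero_le (M * u i x), Nat.zero_le (M * v i x),
      Nat.zero_le (M * (k * (B i x + 1)))]

theorem Fast.foldl {l : ∀ i, α i → List (δ i)} {b : ∀ i, α i → β i}
    {s : ∀ i, α i × β i × δ i → β i} (hl : Fast l) (hb : Fast b) (hs : Fast s) (c : ℕ)
    (hc : ∀ i x, (l i x).length ≤ i.size ^ c) :
    Fast fun i x => (l i x).foldl (fun y z => s i (x, y, z)) (b i x) :=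
  (CompIn.foldl (B := fun _ _ => 0) hl hb hs fun _ _ _ _ _ _ => le_rfl).mono c
    fun i x => by simpa using hc i x

end AltTransporter

/-! ### List operations -/

namespace AltTransporter

open WhileLang
open Enc (enc)

variable {α β γ δ ε : Inst → Type} [∀ i, Enc (α i)] [∀ i, Enc (β i)] [∀ i, Enc (γ i)]
  [∀ i, Enc (δ i)] [∀ i, Enc (ε i)]

theorem Fast.nil : Fast fun i (_ : α i) => ([] : List (β i)) :=
  Fast.of_expr .nil fun _ _ _ _ _ => rfl

theorem Fast.true : Fast fun i (_ : α i) => Bool.true :=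
  Fast.of_expr (.cons .nil .nil) fun _ _ _ _ _ => rfl

theorem Fast.false : Fast fun i (_ : α i) => Bool.false :=
  Fast.of_expr .nil fun _ _ _ _ _ => rfl

theorem Fast.unit : Fast fun i (_ : α i) => () :=
  Fast.of_expr .nil fun _ _ _ _ _ => rfl

theorem Fast.none : Fast fun i (_ : α i) => (Option.none : Option (β i)) :=
  Fast.of_expr .nil fun _ _ _ _ _ => rfl

theorem Fast.cons {f : ∀ i, α i → β i} {g : ∀ i, α i → List (β i)} (hf : Fast f) (hg : Fast g) :
    Fast fun i x => f i x :: g i x :=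
  CompIn.congr_enc (hf.pair hg) fun _ _ => rfl

theorem Fast.some {f : ∀ i, α i → β i} (hf : Fast f) : Fast fun i x => Option.some (f i x) :=
  CompIn.congr_enc (hf.pair Fast.unit) fun _ _ => rfl

/-- Whether a tree is a cons cell. -/
def isCons : Data → Bool
  | .nil => Bool.false
  | .cons _ _ => Bool.true

theorem Fast.isCons : Fast fun i (d : Data) => isCons d := by
  refine Fast.of_exec (Cmd.cond (.assign 0 (.var 0)) (.assign 0 (.cons .nil .nil))
    (.assign 0 .nil)) 100 fun i d => ((Exec.assign (y := d) _ fun σ h _ => by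
      exact h).cond (t := 10)
      (fun h => (Exec.assign (.cons .nil .nil) fun _ _ _ => ?_).mono (by simp [Expr.cost]))
      fun h => (Exec.assign .nil fun _ _ _ => ?_).mono (by simp [Expr.cost])).mono
      (by simp [Expr.cost])
  · cases d
    · exact absurd rfl h
    · rfl
  · rw [h]; rfl

theorem Fast.hd : Fast fun i (d : Data) => d.hd :=
  Fast.of_expr (.hd (.var 0)) fun i x σ h0 _ => by simp only [Expr.eval, h0]; rfl

theorem Fast.tl : Fast fun i (d : Data) => d.tl :=
  Fast.of_expr (.tl (.var 0)) fun i x σ h0 _ => by simp only [Expr.eval, h0]; rfl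

theorem CompIn.toData {f : ∀ i, α i → β i} {w : ∀ i, α i → ℕ} (hf : CompIn f w) :
    CompIn (fun i x => enc (f i x)) w :=
  hf.congr_enc fun _ _ => rfl

theorem Fast.not {f : ∀ i, α i → Bool} (hf : Fast f) : Fast fun i x => !f i x :=
  CompIn.of_eq (hf.ite Fast.false Fast.true) fun i x => by cases f i x <;> rfl

theorem Fast.and {f g : ∀ i, α i → Bool} (hf : Fast f) (hg : Fast g) :
    Fast fun i x => f i x && g i x :=
  CompIn.of_eq (hf.ite hg Fast.false) fun i x => by cases f i x <;> rfl

theorem Fast.or {f g : ∀ i, α i → Bool} (hf : Fast f) (hg : Fast g) :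
    Fast fun i x => f i x || g i x :=
  CompIn.of_eq (hf.ite Fast.true hg) fun i x => by cases f i x <;> rfl

theorem Fast.isSome {f : ∀ i, α i → Option (β i)} (hf : Fast f) : Fast fun i x => (f i x).isSome :=
  CompIn.of_eq (Fast.isCons.comp hf.toData) fun i x => by cases f i x <;> rfl

theorem Fast.isEmpty {f : ∀ i, α i → List (β i)} (hf : Fast f) : Fast fun i x => (f i x).isEmpty :=
  CompIn.of_eq (Fast.isCons.comp hf.toData).not fun i x => by cases f i x <;> rfl

theorem Fast.getD {f : ∀ i, α i → Option (β i)} {g : ∀ i, α i → β i} (hf : Fast f) (hg : Fast g) :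
    Fast fun i x => (f i x).getD (g i x) :=
  CompIn.congr_enc (hf.isSome.ite (Fast.hd.comp hf.toData) hg.toData)
    fun i x => by cases h : f i x <;> simp [enc, Data.hd, Data.ofList]

theorem Fast.headD {f : ∀ i, α i → List (β i)} {g : ∀ i, α i → β i} (hf : Fast f) (hg : Fast g) :
    Fast fun i x => (f i x).headD (g i x) :=
  CompIn.congr_enc (hf.isEmpty.ite hg.toData (Fast.hd.comp hf.toData))
    fun i x => by cases h : f i x <;> simp [enc, Data.hd, Data.ofList]

theorem Fast.tail {f : ∀ i, α i → List (β i)} (hf : Fast f) : Fast fun i x => (f i x).tail :=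
  CompIn.congr_enc (Fast.tl.comp hf.toData)
    fun i x => by cases h : f i x <;> simp [enc, Data.tl, Data.ofList]

theorem CompIn.reverseAux : CompIn (fun i (p : List (β i) × List (β i)) => p.1.reverseAux p.2)
    fun i p => p.1.length := by
  refine CompIn.of_eq (CompIn.le (CompIn.foldl (B := fun _ _ => 0)
    (s := fun i (p : (List (β i) × List (β i)) × List (β i) × β i) => p.2.2 :: p.2.1)
    Fast.fst Fast.snd
    (Fast.cons (Fast.snd.comp Fast.snd) (Fast.fst.comp Fast.snd))
    (by intros; rfl)) ?_) ?_
  · simp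
  · rintro i ⟨l, m⟩
    induction l generalizing m with
    | nil => rfl
    | cons a l ih => exact ih (a :: m)

theorem CompIn.reverse : CompIn (fun i (l : List (β i)) => l.reverse) fun i l => l.length :=
  CompIn.comp_fast (g := fun i (p : List (β i) × List (β i)) => p.1.reverseAux p.2)
    CompIn.reverseAux (Fast.id.pair Fast.nil)

/-- The first list is reversed and pushed onto the second, whose length therefore does not affect
the time. -/
theorem CompIn.append : CompIn (fun i (p : List (β i) × List (β i)) => p.1 ++ p.2)
    fun i p => p.1.length := by
  refine CompIn.of_eq (CompIn.mono (CompIn.comp CompIn.reverseAux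
    ((CompIn.comp_fast CompIn.reverse Fast.fst).pair Fast.snd)) 1 ?_) ?_
  · intro i p
    have := i.two_le_size
    simp only [List.length_reverse, pow_one]
    nlinarith
  · intro i p
    simp [List.reverseAux_eq]

/-- Results are pushed onto a reversed accumulator, so a step does not pay for the output produced
so far; one final reversal restores the order. Filters and flat maps are treated in the same way. -/
theorem foldl_cons_reverse {A B : Type} (f : A → B) (l : List A) (m : List B) :
    (l.foldl (fun y z => f z :: y) m).reverse = m.reverse ++ l.map f := by
  induction l generalizing m with
  | nil => simp
  | cons a l ih => rw [List.foldl_cons, ih]; simp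

theorem CompIn.map {l : ∀ i, α i → List (δ i)} {f : ∀ i, α i × δ i → ε i}
    {u B : ∀ i, α i → ℕ} {w : ∀ i, α i × δ i → ℕ} (hl : CompIn l u) (hf : CompIn f w)
    (hB : ∀ i x, ∀ a ∈ l i x, w i (x, a) ≤ B i x) :
    CompIn (fun i x => (l i x).map fun a => f i (x, a))
      fun i x => u i x + (l i x).length * (B i x + 1) := by
  have h := CompIn.comp CompIn.reverse (CompIn.foldl (B := B)
    (s := fun i (p : α i × List (ε i) × δ i) => f i (p.1, p.2.2) :: p.2.1) hl Fast.nil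
    (w := fun i p => w i (p.1, p.2.2) + 0)
    (CompIn.congr_enc (CompIn.pair (CompIn.comp_fast hf
      (Fast.fst.pair (Fast.snd.comp Fast.snd))) (Fast.fst.comp Fast.snd)) fun _ _ => rfl)
    fun i x pre a post h => hB i x a (by simp [h]))
  refine CompIn.of_eq (CompIn.mono h 1 ?_) ?_
  · intro i x
    have := i.two_le_size
    have h3 := congrArg List.length (foldl_cons_reverse (fun z => f i (x, z)) (l i x) [])
    rw [List.length_reverse] at h3
    dsimp only
    rw [h3]
    simp only [List.reverse_nil, List.nil_append, List.length_map, pow_one]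
    nlinarith [Nat.zero_le ((l i x).length * B i x)]
  · intro i x
    dsimp only
    rw [foldl_cons_reverse]; rfl

theorem foldl_filter_reverse {A : Type} (p : A → Bool) (l : List A) (m : List A) :
    (l.foldl (fun y z => bif p z then z :: y else y) m).reverse = m.reverse ++ l.filter p := by
  induction l generalizing m with
  | nil => simp
  | cons a l ih => cases h : p a <;> simp [ih, h]

theorem CompIn.filter {l : ∀ i, α i → List (δ i)} {f : ∀ i, α i × δ i → Bool}
    {u B : ∀ i, α i → ℕ} {w : ∀ i, α i × δ i → ℕ} (hl : CompIn l u) (hf : CompIn f w)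
    (hB : ∀ i x, ∀ a ∈ l i x, w i (x, a) ≤ B i x) :
    CompIn (fun i x => (l i x).filter fun a => f i (x, a))
      fun i x => u i x + (l i x).length * (B i x + 1) := by
  have h := CompIn.comp CompIn.reverse (CompIn.foldl (B := B)
    (s := fun i (p : α i × List (δ i) × δ i) =>
      bif f i (p.1, p.2.2) then p.2.2 :: p.2.1 else p.2.1) hl Fast.nil
    (w := fun i p => w i (p.1, p.2.2) + 0 + 0)
    (CompIn.ite (CompIn.comp_fast hf
      (Fast.fst.pair (Fast.snd.comp Fast.snd)))
      (Fast.cons (Fast.snd.comp Fast.snd) (Fast.fst.comp Fast.snd)) (Fast.fst.comp Fast.snd))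
    fun i x pre a post h => hB i x a (by simp [h]))
  refine CompIn.of_eq (CompIn.mono h 1 ?_) ?_
  · intro i x
    have := i.two_le_size
    have h3 := congrArg List.length (foldl_filter_reverse (fun z => f i (x, z)) (l i x) [])
    rw [List.length_reverse] at h3
    dsimp only
    rw [h3]
    have h2 := List.length_filter_le (fun a => f i (x, a)) (l i x)
    simp only [List.reverse_nil, List.nil_append, pow_one]
    nlinarith [Nat.zero_le ((l i x).length * B i x)]
  · intro i x
    dsimp only
    rw [foldl_filter_reverse]; rfl

theorem foldl_reverseAux_reverse {A B : Type} (f : A → List B) (l : List A) (m : List B) :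
    (l.foldl (fun y z => (f z).reverseAux y) m).reverse = m.reverse ++ l.flatMap f := by
  induction l generalizing m with
  | nil => simp
  | cons a l ih => rw [List.foldl_cons, ih]; simp [List.reverseAux_eq]

theorem length_flatMap_le {A B : Type} (f : A → List B) (l : List A) {k : ℕ}
    (h : ∀ a ∈ l, (f a).length ≤ k) : (l.flatMap f).length ≤ l.length * k := by
  induction l with
  | nil => simp
  | cons a l ih =>
    have h1 := h a (by simp)
    have h2 := ih fun b hb => h b (by simp [hb])
    simp only [List.flatMap_cons, List.length_append, List.length_cons]
    linarith [Nat.succ_mul l.length k]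

/-- The bound `hk` is needed because pushing a piece onto the accumulator costs its length. -/
theorem CompIn.flatMap {l : ∀ i, α i → List (δ i)} {f : ∀ i, α i × δ i → List (ε i)}
    {u B : ∀ i, α i → ℕ} {w : ∀ i, α i × δ i → ℕ} (hl : CompIn l u) (hf : CompIn f w)
    (hB : ∀ i x, ∀ a ∈ l i x, w i (x, a) ≤ B i x)
    (hk : ∀ i x, ∀ a ∈ l i x, (f i (x, a)).length ≤ B i x) :
    CompIn (fun i x => (l i x).flatMap fun a => f i (x, a))
      fun i x => u i x + (l i x).length * (B i x + 1) := by
  have h := CompIn.comp CompIn.reverse (CompIn.foldl (B := fun i x => B i x + B i x)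
    (s := fun i (p : α i × List (ε i) × δ i) => (f i (p.1, p.2.2)).reverseAux p.2.1) hl Fast.nil
    (CompIn.comp CompIn.reverseAux (CompIn.pair (CompIn.comp_fast hf
      (Fast.fst.pair (Fast.snd.comp Fast.snd))) (Fast.fst.comp Fast.snd)))
    fun i x pre a post h => add_le_add (hB i x a (by simp [h])) (hk i x a (by simp [h])))
  refine CompIn.of_eq (CompIn.mono h 2 ?_) ?_
  · intro i x
    have h1 : 4 ≤ i.size ^ 2 := by nlinarith [i.two_le_size]
    have h2 := length_flatMap_le (fun a => f i (x, a)) (l i x) (hk i x)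
    have h3 := congrArg List.length (foldl_reverseAux_reverse (fun z => f i (x, z)) (l i x) [])
    rw [List.length_reverse] at h3
    dsimp only
    rw [h3]
    simp only [List.reverse_nil, List.nil_append, add_zero]
    calc _ ≤ 4 * (u i x + (l i x).length * (B i x + 1) + 1) := by nlinarith
      _ ≤ _ := Nat.mul_le_mul_right _ h1
  · intro i x
    dsimp only
    rw [foldl_reverseAux_reverse]; rfl

/-- The search never stops early: after a success the accumulator is passed along to the end of the
list. -/
theorem foldl_find {A : Type} (p : A → Bool) (l : List A) (o : Option A) :
    l.foldl (fun y z => bif y.isSome then y else bif p z then some z else none) o =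
      o.or (l.find? p) := by
  induction l generalizing o with
  | nil => simp
  | cons a l ih => cases o <;> cases h : p a <;> simp [ih, h]

theorem CompIn.find? {l : ∀ i, α i → List (δ i)} {f : ∀ i, α i × δ i → Bool}
    {u B : ∀ i, α i → ℕ} {w : ∀ i, α i × δ i → ℕ} (hl : CompIn l u) (hf : CompIn f w)
    (hB : ∀ i x, ∀ a ∈ l i x, w i (x, a) ≤ B i x) :
    CompIn (fun i x => (l i x).find? fun a => f i (x, a))
      fun i x => u i x + (l i x).length * (B i x + 1) := by
  have h := CompIn.foldl (B := B)
    (s := fun i (p : α i × Option (δ i) × δ i) => bif p.2.1.isSome then p.2.1 else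
      bif f i (p.1, p.2.2) then Option.some p.2.2 else Option.none) hl Fast.none
    (w := fun i p => 0 + 0 + (w i (p.1, p.2.2) + 0 + 0))
    (CompIn.ite (Fast.isSome (Fast.fst.comp Fast.snd)) (Fast.fst.comp Fast.snd)
      (CompIn.ite (CompIn.comp_fast hf (Fast.fst.pair (Fast.snd.comp Fast.snd)))
        (Fast.some (Fast.snd.comp Fast.snd)) Fast.none))
    fun i x pre a post h => by simpa using hB i x a (by simp [h])
  refine CompIn.of_eq (CompIn.le h fun i x => by simp) fun i x => ?_
  dsimp only
  rw [foldl_find]; rfl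

theorem foldl_all {A : Type} (p : A → Bool) (l : List A) (o : Bool) :
    l.foldl (fun y z => y && p z) o = (o && l.all p) := by
  induction l generalizing o with
  | nil => simp
  | cons a l ih => simp [ih, Bool.and_assoc]

theorem Fast.all {l : ∀ i, α i → List (δ i)} {f : ∀ i, α i × δ i → Bool}
    (hl : Fast l) (hf : Fast f) (c : ℕ) (hc : ∀ i x, (l i x).length ≤ i.size ^ c) :
    Fast fun i x => (l i x).all fun a => f i (x, a) := by
  refine CompIn.of_eq (Fast.foldl (s := fun i (p : α i × Bool × δ i) => p.2.1 && f i (p.1, p.2.2))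
    hl Fast.true (Fast.and (Fast.fst.comp Fast.snd)
      (hf.comp (Fast.fst.pair (Fast.snd.comp Fast.snd)))) c hc) fun i x => ?_
  dsimp only
  rw [foldl_all]; rfl

theorem Fast.map {l : ∀ i, α i → List (δ i)} {f : ∀ i, α i × δ i → ε i}
    (hl : Fast l) (hf : Fast f) (c : ℕ) (hc : ∀ i x, (l i x).length ≤ i.size ^ c) :
    Fast fun i x => (l i x).map fun a => f i (x, a) :=
  (CompIn.map (B := fun _ _ => 0) hl hf (by intros; rfl)).mono c fun i x => by simpa using hc i x

theorem Fast.find? {l : ∀ i, α i → List (δ i)} {f : ∀ i, α i × δ i → Bool}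
    (hl : Fast l) (hf : Fast f) (c : ℕ) (hc : ∀ i x, (l i x).length ≤ i.size ^ c) :
    Fast fun i x => (l i x).find? fun a => f i (x, a) :=
  (CompIn.find? (B := fun _ _ => 0) hl hf (by intros; rfl)).mono c fun i x => by simpa using hc i x

/-! ### Indexing -/

theorem enc_replicate (k : ℕ) : enc (List.replicate k ()) = Data.ofNat k := by
  simp [enc, Data.ofNat]

theorem CompIn.units {f : ∀ i, α i → ℕ} {w : ∀ i, α i → ℕ} (hf : CompIn f w) :
    CompIn (fun i x => List.replicate (f i x) ()) w :=
  hf.congr_enc fun i x => enc_replicate _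

theorem foldl_replicate {A : Type} (f : A → A) (k : ℕ) (a : A) :
    (List.replicate k ()).foldl (fun y _ => f y) a = f^[k] a := by
  induction k generalizing a with
  | zero => rfl
  | succ k ih => simp [List.replicate_succ, ih]

theorem Fast.iterate {f : ∀ i, α i → ℕ} {b : ∀ i, α i → β i} {s : ∀ i, α i × β i → β i}
    (hf : Fast f) (hb : Fast b) (hs : Fast s) (c : ℕ) (hc : ∀ i x, f i x ≤ i.size ^ c) :
    Fast fun i x => (fun y => s i (x, y))^[f i x] (b i x) :=
  CompIn.of_eq (Fast.foldl (s := fun i (p : α i × β i × Unit) => s i (p.1, p.2.1))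
    (CompIn.units hf) hb (hs.comp (Fast.fst.pair (Fast.fst.comp Fast.snd))) c
    fun i x => by simpa using hc i x) fun i x =>
    (foldl_replicate (fun y => s i (x, y)) (f i x) (b i x)).symm

theorem hd_iterate_tl (l : List Data) (k : ℕ) (h : k < l.length) :
    (Data.tl^[k] (Data.ofList l)).hd = l[k] := by
  induction l generalizing k with
  | nil => simp at h
  | cons a l ih =>
    cases k with
    | zero => rfl
    | succ k => exact ih k (by simpa using h)

/-- A function on `Fin m` is stored as the list of its values, and the unary index drives the walk
to the required entry. -/
theorem Fast.apply {m : Inst → ℕ} {v : ∀ i, α i → Fin (m i) → β i} {k : ∀ i, α i → Fin (m i)}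
    (hv : Fast v) (hk : Fast k) (c : ℕ) (hc : ∀ i, m i ≤ i.size ^ c) :
    Fast fun i x => v i x (k i x) := by
  refine CompIn.congr_enc (Fast.hd.comp (Fast.iterate (s := fun i (p : α i × Data) => p.2.tl)
    (f := fun i x => (k i x : ℕ)) (b := fun i x => enc (v i x)) (CompIn.congr_enc hk fun _ _ => rfl)
    hv.toData (Fast.tl.comp Fast.snd) c fun i x => (k i x).2.le.trans (hc i))) fun i x => ?_
  exact ((hd_iterate_tl _ (k i x) (by simp)).trans (by simp)).symm

/-- The lists `[0, …, m - 1]` of indices can be formed. -/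
theorem Fast.finRange {m : Inst → ℕ} (hm : Fast fun i (_ : α i) => m i) (c : ℕ)
    (hc : ∀ i, m i ≤ i.size ^ c) : Fast fun i (_ : α i) => List.finRange (m i) := by
  have h := Fast.iterate (β := fun _ => ℕ × List ℕ)
    (s := fun i (p : α i × ℕ × List ℕ) => (p.2.1 + 1, p.2.1 :: p.2.2)) hm
    (b := fun i _ => (0, []))
    (Fast.pair (Fast.of_expr (f := fun i (_ : α i) => 0) .nil fun _ _ _ _ _ => rfl) Fast.nil)
    (Fast.pair (CompIn.congr_enc (Fast.cons Fast.unit (CompIn.units (Fast.fst.comp Fast.snd)))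
        fun i x => ?_)
      (Fast.cons (Fast.fst.comp Fast.snd) (Fast.snd.comp Fast.snd))) c fun i _ => hc i
  · have key : ∀ k : ℕ, (fun y : ℕ × List ℕ => (y.1 + 1, y.1 :: y.2))^[k] (0, []) =
        (k, (List.range k).reverse) := by
      intro k
      induction k with
      | zero => rfl
      | succ k ih => simp [Function.iterate_succ_apply', ih, List.range_succ]
    refine CompIn.congr_enc (CompIn.mono (CompIn.comp CompIn.reverse (Fast.snd.comp h)) c
      fun i x => ?_) fun i x => ?_
    · simpa [key] using hc i
    · simp only [key, List.reverse_reverse]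
      show Data.ofList _ = Data.ofList _
      rw [← List.map_coe_finRange_eq_range, List.map_map]
      rfl
  · show Data.ofNat _ = Data.cons .nil (Data.ofList _)
    simp [Data.ofNat, Data.ofList, List.replicate_succ, enc]

theorem Fast.tabulate {m : Inst → ℕ} {f : ∀ i, α i × Fin (m i) → β i}
    (hm : Fast fun i (_ : α i) => m i) (hf : Fast f) (c : ℕ) (hc : ∀ i, m i ≤ i.size ^ c) :
    Fast fun i x => fun k => f i (x, k) := by
  refine CompIn.congr_enc (Fast.map (Fast.finRange hm c hc) hf c fun i x => by simpa using hc i)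
    fun i x => ?_
  show Data.ofList _ = Data.ofList _
  rw [List.map_map, List.ofFn_eq_map]
  rfl

theorem Fast.forall_fin {m : Inst → ℕ} {f : ∀ i, α i × Fin (m i) → Bool}
    (hm : Fast fun i (_ : α i) => m i) (hf : Fast f) (c : ℕ) (hc : ∀ i, m i ≤ i.size ^ c) :
    Fast fun i x => decide (∀ k, f i (x, k) = Bool.true) :=
  CompIn.of_eq (Fast.all (Fast.finRange hm c hc) hf c fun i x => by simpa using hc i)
    fun i x => by rw [Bool.eq_iff_iff]; simp

theorem iterate_tail {A : Type} (l : List A) (k : ℕ) : List.tail^[k] l = l.drop k := by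
  induction k generalizing l with
  | zero => simp
  | succ k ih => simp [ih]

/-- In unary, `f < g` means that something is left of `g` after `f` cells have been dropped. -/
theorem Fast.lt {f g : ∀ i, α i → ℕ} (hf : Fast f) (hg : Fast g) (c : ℕ)
    (hc : ∀ i x, f i x ≤ i.size ^ c) : Fast fun i x => decide (f i x < g i x) := by
  refine CompIn.of_eq (Fast.not (Fast.isEmpty (Fast.iterate
    (s := fun i (p : α i × List Unit) => p.2.tail) hf (CompIn.units hg)
    (Fast.tail Fast.snd) c hc))) fun i x => ?_
  show _ = !(List.tail^[_] _).isEmpty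
  rw [iterate_tail, Bool.eq_iff_iff]
  simp
  omega

theorem Fast.nat_eq {f g : ∀ i, α i → ℕ} (hf : Fast f) (hg : Fast g) (c : ℕ)
    (hc : ∀ i x, f i x ≤ i.size ^ c) (hd : ∀ i x, g i x ≤ i.size ^ c) :
    Fast fun i x => decide (f i x = g i x) :=
  CompIn.of_eq (Fast.and (Fast.not (Fast.lt hf hg c hc)) (Fast.not (Fast.lt hg hf c hd)))
    fun i x => by rw [Bool.eq_iff_iff]; simp; omega

theorem Fast.val {m : Inst → ℕ} {k : ∀ i, α i → Fin (m i)} (hk : Fast k) :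
    Fast fun i x => (k i x : ℕ) := CompIn.congr_enc hk fun _ _ => rfl

end AltTransporter

/-! ### Linear algebra over the field of the instance -/

namespace AltTransporter

open WhileLang
open Enc (enc)

variable {α β γ δ ε : Inst → Type} [∀ i, Enc (α i)] [∀ i, Enc (β i)] [∀ i, Enc (γ i)]
  [∀ i, Enc (δ i)] [∀ i, Enc (ε i)]

/-- The numbering of the field. -/
def Inst.num (i : Inst) : i.F ≃ Fin i.q := i.e

noncomputable instance (i : Inst) : DecidableEq i.F := Classical.decEq _

theorem encodeGLList_eq (i : Inst) (S : List (Matrix.GeneralLinearGroup (Fin i.n) i.F)) :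
    encodeGLList i.e S = enc S := by
  show Data.ofList _ = Data.ofList _
  congr 1
  induction S with
  | nil => rfl
  | cons g S ih => exact congrArg (encodeMatrix i.e (g : Matrix (Fin i.n) (Fin i.n) i.F) :: ·) ih

theorem Fast.dim : Fast fun i (_ : α i) => i.n :=
  Fast.of_expr (.hd (.var 3)) fun i x σ _ h3 => by simp only [Expr.eval, h3]; rfl

theorem Fast.gens : Fast fun i (_ : α i) => i.gens :=
  Fast.of_expr (.hd (.tl (.tl (.tl (.var 3))))) fun i x σ _ h3 => by
    simp only [Expr.eval, h3]
    exact encodeGLList_eq i i.gens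

theorem Fast.matA : Fast fun i (_ : α i) => i.A :=
  Fast.of_expr (.hd (.tl (.tl (.tl (.tl (.var 3)))))) fun i x σ _ h3 => by
    simp only [Expr.eval, h3]; rfl

theorem Fast.matB : Fast fun i (_ : α i) => i.B :=
  Fast.of_expr (.hd (.tl (.tl (.tl (.tl (.tl (.var 3))))))) fun i x σ _ h3 => by
    simp only [Expr.eval, h3]; rfl

theorem Fast.addTable :
    Fast fun i (_ : α i) => fun a b : Fin i.q => i.num.symm a + i.num.symm b :=
  Fast.of_expr (.hd (.tl (.var 3))) fun i x σ _ h3 => by simp only [Expr.eval, h3]; rfl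

theorem Fast.mulTable :
    Fast fun i (_ : α i) => fun a b : Fin i.q => i.num.symm a * i.num.symm b :=
  Fast.of_expr (.hd (.tl (.tl (.var 3)))) fun i x σ _ h3 => by simp only [Expr.eval, h3]; rfl

/-- The order of the field is not a separate input; it is read off as the number of rows of the
addition table. -/
theorem Fast.order : Fast fun i (_ : α i) => i.q := by
  refine CompIn.congr_enc (Fast.map (δ := fun i => Fin i.q → i.F) (f := fun _ _ => ())
    (l := fun i _ => List.ofFn fun a b : Fin i.q => i.num.symm a + i.num.symm b)
    (CompIn.congr_enc Fast.addTable fun i x => ?_) Fast.unit 1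
    fun i x => by simpa using i.q_le_size) fun i x => ?_
  · show Data.ofList _ = Data.ofList _
    rw [List.map_ofFn]; rfl
  · show Data.ofNat _ = enc _
    rw [← enc_replicate]
    congr 1
    exact (List.eq_replicate_iff.2 ⟨by simp, fun _ _ => rfl⟩).symm

/-- The elements of the field in the order of their numbers. -/
def Inst.elems (i : Inst) : List i.F := (List.finRange i.q).map i.num.symm

theorem Inst.mem_elems (i : Inst) (x : i.F) : x ∈ i.elems := by
  simp only [elems, List.mem_map, List.mem_finRange, true_and]
  exact ⟨i.num x, by simp⟩

theorem Inst.length_elems (i : Inst) : i.elems.length = i.q := by simp [elems]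

theorem Inst.length_elems_le (i : Inst) : i.elems.length ≤ i.size ^ 1 := by
  simpa [elems] using i.q_le_size

theorem Fast.elems : Fast fun i (_ : α i) => i.elems :=
  CompIn.congr_enc (Fast.finRange Fast.order 1 fun i => by simpa using i.q_le_size) fun i x => by
    show Data.ofList _ = Data.ofList _
    simp only [Inst.elems, List.map_map]
    congr 1
    refine List.map_congr_left fun a _ => ?_
    show Data.ofNat (i.num (i.num.symm a)) = Data.ofNat a
    simp

theorem Fast.number {f : ∀ i, α i → i.F} (hf : Fast f) :
    Fast fun i x => i.num (f i x) := CompIn.congr_enc hf fun _ _ => rfl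

theorem Fast.add {f g : ∀ i, α i → i.F} (hf : Fast f) (hg : Fast g) :
    Fast fun i x => f i x + g i x :=
  CompIn.of_eq (Fast.apply (Fast.apply Fast.addTable hf.number 1
    fun i => by simpa using i.q_le_size) hg.number 1 fun i => by simpa using i.q_le_size)
    fun i x => by simp

theorem Fast.mul {f g : ∀ i, α i → i.F} (hf : Fast f) (hg : Fast g) :
    Fast fun i x => f i x * g i x :=
  CompIn.of_eq (Fast.apply (Fast.apply Fast.mulTable hf.number 1
    fun i => by simpa using i.q_le_size) hg.number 1 fun i => by simpa using i.q_le_size)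
    fun i x => by simp

theorem Fast.elem_eq {f g : ∀ i, α i → i.F} (hf : Fast f) (hg : Fast g) :
    Fast fun i x => decide (f i x = g i x) :=
  CompIn.of_eq (Fast.nat_eq hf.number.val hg.number.val 1
    (fun i x => by simpa using (i.num (f i x)).2.le.trans i.q_le_size)
    fun i x => by simpa using (i.num (g i x)).2.le.trans i.q_le_size)
    fun i x => by rw [Bool.eq_iff_iff]; simp [Fin.val_inj]

/-- A field element that is characterized by a computable property can be found. -/
theorem Fast.theElem (p : ∀ i : Inst, i.F → Bool) (z : ∀ i : Inst, i.F)
    (hp : Fast fun i (x : i.F) => p i x) (h : ∀ i x, p i x = Bool.true ↔ x = z i) :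
    Fast fun i (_ : α i) => z i := by
  refine CompIn.congr_enc (Fast.hd.comp (CompIn.toData (Fast.find?
    (f := fun i (x : α i × i.F) => p i x.2) Fast.elems (hp.comp Fast.snd) 1
      fun i _ => i.length_elems_le))) fun i x => ?_
  have : i.elems.find? (fun a => p i a) = Option.some (z i) := by
    obtain ⟨b, hb⟩ := Option.isSome_iff_exists.1 (List.find?_isSome.2
      ⟨z i, i.mem_elems _, (h i _).2 rfl⟩)
    rw [hb, (h i b).1 (by simpa using List.find?_some hb)]
  rw [this]; rfl

/-- The constants are recovered from the tables: `0` is the only solution of x + x = x, and `1`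
below is the only nonzero solution of x * x = x. -/
theorem Fast.zero : Fast fun i (_ : α i) => (0 : i.F) :=
  Fast.theElem (fun i x => decide (x + x = x)) _ ((Fast.id.add Fast.id).elem_eq Fast.id)
    fun i x => by simp

theorem Fast.one : Fast fun i (_ : α i) => (1 : i.F) :=
  Fast.theElem (fun i x => decide (x * x = x) && !decide (x = 0)) _
    (((Fast.id.mul Fast.id).elem_eq Fast.id).and (Fast.id.elem_eq Fast.zero).not)
    fun i x => by
      by_cases h : x = 0
      · simp [h]
      · simp [h]

theorem Inst.dim_le (i : Inst) : i.n ≤ i.size ^ 1 := by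
  have := i.n_le_size
  simp; omega

theorem Fast.all_fin {f : ∀ i, α i × Fin i.n → Bool} (hf : Fast f) :
    Fast fun i x => decide (∀ k, f i (x, k) = Bool.true) :=
  Fast.forall_fin Fast.dim hf 1 Inst.dim_le

theorem Fast.sum {f : ∀ i, α i × Fin i.n → i.F} (hf : Fast f) :
    Fast fun i x => ∑ k, f i (x, k) := by
  refine CompIn.of_eq (Fast.foldl (s := fun i (p : α i × i.F × Fin i.n) => p.2.1 + f i (p.1, p.2.2))
    (Fast.finRange Fast.dim 1 Inst.dim_le) Fast.zero ((Fast.fst.comp Fast.snd).add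
      (hf.comp (Fast.fst.pair (Fast.snd.comp Fast.snd)))) 1 fun i x => by
        simpa using i.dim_le) fun i x => ?_
  rw [Fin.sum_univ_def, List.sum_eq_foldl, List.foldl_map]

/-! #### Vectors and matrices -/

theorem Fast.coord {v : ∀ i, α i → Fin i.n → i.F} {k : ∀ i, α i → Fin i.n} (hv : Fast v)
    (hk : Fast k) : Fast fun i x => v i x (k i x) := Fast.apply hv hk 1 Inst.dim_le

theorem Fast.vector {f : ∀ i, α i × Fin i.n → i.F} (hf : Fast f) :
    Fast fun i x => fun k => f i (x, k) := Fast.tabulate Fast.dim hf 1 Inst.dim_le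

theorem Fast.entry {M : ∀ i, α i → Matrix (Fin i.n) (Fin i.n) i.F} {r c : ∀ i, α i → Fin i.n}
    (hM : Fast M) (hr : Fast r) (hc : Fast c) : Fast fun i x => M i x (r i x) (c i x) :=
  Fast.apply (Fast.apply (v := fun i x (a b : Fin i.n) => M i x a b)
    (CompIn.congr_enc hM fun _ _ => rfl) hr 1 Inst.dim_le) hc 1 Inst.dim_le

theorem Fast.matrix {f : ∀ i, (α i × Fin i.n) × Fin i.n → i.F} (hf : Fast f) :
    Fast fun i x => Matrix.of fun r c => f i ((x, r), c) :=
  CompIn.congr_enc (Fast.tabulate Fast.dim (Fast.vector hf) 1 Inst.dim_le) fun _ _ => rfl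

theorem Fast.transpose {M : ∀ i, α i → Matrix (Fin i.n) (Fin i.n) i.F} (hM : Fast M) :
    Fast fun i x => (M i x).transpose :=
  CompIn.of_eq (Fast.matrix (Fast.entry (hM.comp (Fast.fst.comp Fast.fst)) Fast.snd
    (Fast.snd.comp Fast.fst))) fun _ _ => rfl

theorem Fast.matMul {M N : ∀ i, α i → Matrix (Fin i.n) (Fin i.n) i.F} (hM : Fast M) (hN : Fast N) :
    Fast fun i x => M i x * N i x :=
  CompIn.of_eq (Fast.matrix (Fast.sum ((Fast.entry
    (hM.comp (Fast.fst.comp (Fast.fst.comp Fast.fst)))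
    (Fast.snd.comp (Fast.fst.comp Fast.fst)) Fast.snd).mul
    (Fast.entry (hN.comp (Fast.fst.comp (Fast.fst.comp Fast.fst))) Fast.snd
    (Fast.snd.comp Fast.fst))))) fun _ _ => rfl

theorem Fast.vecMul {v : ∀ i, α i → Fin i.n → i.F} {M : ∀ i, α i → Matrix (Fin i.n) (Fin i.n) i.F}
    (hv : Fast v) (hM : Fast M) : Fast fun i x => (M i x).vecMul (v i x) :=
  CompIn.of_eq (Fast.vector (Fast.sum ((Fast.coord (hv.comp (Fast.fst.comp Fast.fst))
    Fast.snd).mul (Fast.entry (hM.comp (Fast.fst.comp Fast.fst)) Fast.snd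
    (Fast.snd.comp Fast.fst))))) fun _ _ => rfl

theorem Fast.mulVec {v : ∀ i, α i → Fin i.n → i.F} {M : ∀ i, α i → Matrix (Fin i.n) (Fin i.n) i.F}
    (hM : Fast M) (hv : Fast v) : Fast fun i x => (M i x).mulVec (v i x) :=
  CompIn.of_eq (Fast.vector (Fast.sum ((Fast.entry (hM.comp (Fast.fst.comp Fast.fst))
    (Fast.snd.comp Fast.fst) Fast.snd).mul (Fast.coord (hv.comp (Fast.fst.comp Fast.fst))
    Fast.snd)))) fun _ _ => rfl

theorem Fast.fin_eq {r c : ∀ i, α i → Fin i.n} (hr : Fast r) (hc : Fast c) :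
    Fast fun i x => decide (r i x = c i x) :=
  CompIn.of_eq (Fast.nat_eq hr.val hc.val 1 (fun i x => (r i x).2.le.trans i.dim_le)
    fun i x => (c i x).2.le.trans i.dim_le) fun i x => by simp [Fin.ext_iff]

theorem Fast.oneMat : Fast fun i (_ : α i) => (1 : Matrix (Fin i.n) (Fin i.n) i.F) :=
  CompIn.of_eq (Fast.matrix ((Fast.fin_eq (Fast.snd.comp Fast.fst) Fast.snd).ite Fast.one
    Fast.zero)) fun i x => by
      ext r c
      by_cases h : r = c <;> simp [Matrix.one_apply, h]

/-! #### All vectors -/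

/-- All vectors with entries from a list. -/
def vecsOf {F : Type} (l : List F) : ∀ m : ℕ, List (Fin m → F)
  | 0 => [Fin.elim0]
  | m + 1 => l.flatMap fun a => (vecsOf l m).map fun v => Fin.cons a v

theorem mem_vecsOf {F : Type} {l : List F} (hl : ∀ a, a ∈ l) {m : ℕ} (v : Fin m → F) :
    v ∈ vecsOf l m := by
  induction m with
  | zero => simp [vecsOf]; exact Subsingleton.elim _ _
  | succ m ih =>
    simp only [vecsOf, List.mem_flatMap, List.mem_map]
    exact ⟨v 0, hl _, Fin.tail v, ih _, Fin.cons_self_tail v⟩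

theorem length_vecsOf {F : Type} (l : List F) (m : ℕ) : (vecsOf l m).length = l.length ^ m := by
  induction m with
  | zero => simp [vecsOf]
  | succ m ih => simp [vecsOf, ih, pow_succ, List.length_flatMap, mul_comm]

/-- The recursion of `vecsOf` passes through the types `Fin m → F`. On the level of lists it becomes
the iteration of a single function, which a loop can carry out. -/
theorem map_ofFn_vecsOf {F : Type} (l : List F) (m : ℕ) :
    (vecsOf l m).map List.ofFn =
      (fun y : List (List F) => l.flatMap fun a => y.map fun v => a :: v)^[m] [[]] := by
  induction m with
  | zero => simp [vecsOf]
  | succ m ih =>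
    rw [Function.iterate_succ_apply', ← ih]
    simp only [vecsOf, List.map_flatMap, List.map_map]
    congr 1
    funext a
    refine List.map_congr_left fun v _ => ?_
    simp [List.ofFn_cons]

/-- All vectors. -/
def Inst.vecs (i : Inst) : List (Fin i.n → i.F) := vecsOf i.elems i.n

theorem Inst.mem_vecs (i : Inst) (v : Fin i.n → i.F) : v ∈ i.vecs := mem_vecsOf i.mem_elems v

theorem Inst.length_vecs (i : Inst) : i.vecs.length = i.q ^ i.n := by
  rw [vecs, length_vecsOf, length_elems]

theorem Inst.length_vecs_le (i : Inst) : i.vecs.length ≤ i.size ^ 1 := by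
  rw [i.length_vecs, pow_one]; exact i.pow_n_le_size

theorem Fast.vecs : Fast fun i (_ : α i) => i.vecs := by
  have hstep : CompIn (fun i (p : α i × List (List i.F) × Unit) =>
      i.elems.flatMap fun a => p.2.1.map fun v => a :: v) fun i p => p.2.1.length := by
    refine CompIn.mono (CompIn.flatMap
      (f := fun i (r : (α i × List (List i.F) × Unit) × i.F) => r.1.2.1.map fun v => r.2 :: v)
      (B := fun i p => p.2.1.length) Fast.elems
      (CompIn.map (B := fun _ _ => 0)
        (f := fun i (r : ((α i × List (List i.F) × Unit) × i.F) × List i.F) => r.1.2 :: r.2)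
        (Fast.fst.comp (Fast.snd.comp Fast.fst))
        (Fast.cons (Fast.snd.comp Fast.fst) Fast.snd) (by intros; rfl)) ?_ ?_) 1 ?_
    · intros; simp
    · intros; simp
    · intro i p
      simpa using Nat.mul_le_mul_right (p.2.1.length + 1) i.length_elems_le
  have h := CompIn.foldl (l := fun i (_ : α i) => List.replicate i.n ()) (B := fun i _ => i.size)
    (CompIn.units Fast.dim) (b := fun i _ => [[]]) (Fast.cons Fast.nil Fast.nil) hstep ?_
  · refine CompIn.congr_enc (CompIn.mono h 2 fun i x => ?_) fun i x => ?_
    · have := i.n_le_size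
      simp only [List.length_replicate]
      nlinarith
    · dsimp only
      rw [foldl_replicate, ← map_ofFn_vecsOf]
      show Data.ofList _ = Data.ofList _
      rw [List.map_map]
      congr 1
      refine List.map_congr_left fun v _ => ?_
      show Data.ofList _ = Data.ofList _
      rw [List.map_ofFn]
      rfl
  -- After k ≤ n rounds the list has q^k ≤ q^n members, so no intermediate list exceeds the size
  -- parameter.
  · intro i x pre a post hp
    obtain ⟨k, hk, rfl⟩ : ∃ k, k ≤ i.n ∧ pre = List.replicate k () := by
      refine ⟨pre.length, ?_, List.eq_replicate_iff.2 ⟨rfl, fun _ _ => rfl⟩⟩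
      have := congrArg List.length hp
      simp at this; omega
    dsimp only
    rw [foldl_replicate, ← map_ofFn_vecsOf, List.length_map, length_vecsOf, i.length_elems]
    exact (Nat.pow_le_pow_right (by linarith [i.two_le_q]) hk).trans i.pow_n_le_size

/-! #### The general linear group -/

/-- The group of the instance. -/
abbrev Inst.G (i : Inst) : Type := Matrix.GeneralLinearGroup (Fin i.n) i.F

theorem Fast.coe {g : ∀ i, α i → i.G} (hg : Fast g) :
    Fast fun i x => (g i x : Matrix (Fin i.n) (Fin i.n) i.F) := CompIn.congr_enc hg fun _ _ => rfl

theorem Fast.of_coe {g : ∀ i, α i → i.G}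
    (hg : Fast fun i x => (g i x : Matrix (Fin i.n) (Fin i.n) i.F)) : Fast g :=
  CompIn.congr_enc hg fun _ _ => rfl

theorem Fast.glOne : Fast fun i (_ : α i) => (1 : i.G) :=
  Fast.of_coe (CompIn.of_eq Fast.oneMat fun _ _ => rfl)

theorem Fast.glMul {g h : ∀ i, α i → i.G} (hg : Fast g) (hh : Fast h) :
    Fast fun i x => g i x * h i x :=
  Fast.of_coe (CompIn.of_eq (hg.coe.matMul hh.coe) fun _ _ => rfl)

theorem Fast.vec_eq {v w : ∀ i, α i → Fin i.n → i.F} (hv : Fast v) (hw : Fast w) :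
    Fast fun i x => decide (v i x = w i x) :=
  CompIn.of_eq (Fast.all_fin (Fast.elem_eq (Fast.coord (hv.comp Fast.fst) Fast.snd)
    (Fast.coord (hw.comp Fast.fst) Fast.snd))) fun i x => by simp [funext_iff]

/-- Row r of the inverse is the only vector v with vg = e_r. Searching all q^n vectors for it is
affordable, so neither elimination nor division in the field has to be programmed. -/
theorem Fast.glInv {g : ∀ i, α i → i.G} (hg : Fast g) : Fast fun i x => (g i x)⁻¹ := by
  refine Fast.of_coe (CompIn.congr_enc (Fast.tabulate (β := fun i => Fin i.n → i.F) Fast.dim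
    (f := fun i (p : α i × Fin i.n) => (i.vecs.find? fun v => decide
      ((g i p.1 : Matrix (Fin i.n) (Fin i.n) i.F).vecMul v = fun k =>
        (1 : Matrix (Fin i.n) (Fin i.n) i.F) p.2 k)).getD fun _ => 0)
    (Fast.getD (Fast.find? (f := fun i (r : (α i × Fin i.n) × (Fin i.n → i.F)) => decide
      ((g i r.1.1 : Matrix (Fin i.n) (Fin i.n) i.F).vecMul r.2 = fun k =>
        (1 : Matrix (Fin i.n) (Fin i.n) i.F) r.1.2 k)) Fast.vecs
      (Fast.vec_eq (Fast.vecMul Fast.snd (hg.comp (Fast.fst.comp Fast.fst)).coe)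
        (Fast.vector (Fast.entry Fast.oneMat (Fast.snd.comp (Fast.fst.comp Fast.fst)) Fast.snd)))
      1 fun i _ => i.length_vecs_le)
      (Fast.vector Fast.zero)) 1 Inst.dim_le) fun i x => ?_)
  show enc (fun r : Fin i.n => fun c : Fin i.n =>
    (((g i x)⁻¹ : i.G) : Matrix (Fin i.n) (Fin i.n) i.F) r c) = _
  congr 1
  funext r
  set M := (g i x : Matrix (Fin i.n) (Fin i.n) i.F)
  have key : ∀ v : Fin i.n → i.F, M.vecMul v = (fun k => (1 : Matrix (Fin i.n) (Fin i.n) i.F) r k) ↔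
      v = fun c => (((g i x)⁻¹ : i.G) : Matrix (Fin i.n) (Fin i.n) i.F) r c := by
    have h1 : M * (((g i x)⁻¹ : i.G) : Matrix (Fin i.n) (Fin i.n) i.F) = 1 := by
      rw [← Units.val_mul, mul_inv_cancel]; rfl
    have h2 : (((g i x)⁻¹ : i.G) : Matrix (Fin i.n) (Fin i.n) i.F) * M = 1 := by
      rw [← Units.val_mul, inv_mul_cancel]; rfl
    intro v
    constructor
    · intro h
      have := congrArg (Matrix.vecMul · (((g i x)⁻¹ : i.G) : Matrix (Fin i.n) (Fin i.n) i.F)) h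
      simp only [Matrix.vecMul_vecMul, h1, Matrix.vecMul_one] at this
      rw [this]
      funext c
      show ∑ k, (1 : Matrix (Fin i.n) (Fin i.n) i.F) r k * _ = _
      simp [Matrix.one_apply]
    · rintro rfl
      funext c
      rw [← h2]; rfl
  have hs : (i.vecs.find? fun v => decide (M.vecMul v = fun k =>
      (1 : Matrix (Fin i.n) (Fin i.n) i.F) r k)).isSome :=
    List.find?_isSome.2 ⟨_, i.mem_vecs _, decide_eq_true ((key _).2 rfl)⟩
  obtain ⟨b, hb⟩ := Option.isSome_iff_exists.1 hs
  have hb' := List.find?_some hb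
  simp only [decide_eq_true_eq] at hb'
  exact ((key b).1 hb').symm.trans (by rw [← Option.getD_some (a := b), ← hb])

end AltTransporter

/-! ### Sifting along a chain of subgroups -/

namespace Sift

variable {Γ : Type} [Group Γ]

/-- One level of sifting: divide by a table entry in the same coset, or enter the element. -/
def step (pass : ℕ → Γ → Bool) (p : List Γ × Γ) (j : ℕ) : List Γ × Γ :=
  bif (p.1.find? fun r => pass j (r⁻¹ * p.2)).isSome then
    (p.1, ((p.1.find? fun r => pass j (r⁻¹ * p.2)).getD 1)⁻¹ * p.2)
  else (p.2 :: p.1, 1)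

/-- Sift an element through a table. -/
def insert (pass : ℕ → Γ → Bool) (m : ℕ) (T : List Γ) (g : Γ) : List Γ :=
  ((List.range m).foldl (step pass) (T, g)).1

/-- Sift a list of elements through a table. -/
def fill (pass : ℕ → Γ → Bool) (m : ℕ) (T S : List Γ) : List Γ := S.foldl (insert pass m) T

/-- Sift all products of two table entries. -/
def round (pass : ℕ → Γ → Bool) (m : ℕ) (T : List Γ) : List Γ :=
  fill pass m T (T.flatMap fun s => T.map fun r => s * r)

/-- The table of a list of generators, after `N` rounds. -/
def table (pass : ℕ → Γ → Bool) (m N : ℕ) (S : List Γ) : List Γ :=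
  (round pass m)^[N] (fill pass m [1] S)

/-- The entries of a table are distinct modulo the relevant member of the chain. -/
structure Good (C : ℕ → Subgroup Γ) (m : ℕ) (T : List Γ) : Prop where
  nodup : T.Nodup
  one_mem : (1 : Γ) ∈ T
  inj : ∀ r ∈ T, ∀ r' ∈ T, ∀ j < m, r ∈ C j → r ∉ C (j + 1) → r' ∈ C j → r⁻¹ * r' ∈ C (j + 1) →
    r = r'

/-- The subgroup generated by the entries below the first level. -/
def below (C : ℕ → Subgroup Γ) (T : List Γ) : Subgroup Γ := Subgroup.closure {t | t ∈ T ∧ t ∈ C 1}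

theorem below_le (C : ℕ → Subgroup Γ) (T : List Γ) : below C T ≤ C 1 :=
  (Subgroup.closure_le _).2 fun _ h => h.2

variable {pass : ℕ → Γ → Bool} {m : ℕ} {C : ℕ → Subgroup Γ}

/-- As `1` is an entry, `h` shows that `g` is not in `C (j + 1)`, so the level of `g` is exactly
`j`. A clash with an old entry could occur only on that level, where `h` excludes it. -/
theorem Good.cons {T : List Γ} (hC : Antitone C) (hT : Good C m T) {g : Γ} {j : ℕ}
    (hg : g ∈ C j) (h : ∀ r ∈ T, r⁻¹ * g ∉ C (j + 1)) : Good C m (g :: T) := by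
  have hg1 : g ∉ C (j + 1) := by simpa using h 1 hT.one_mem
  have h' : ∀ r ∈ T, g⁻¹ * r ∉ C (j + 1) := fun r hr hh =>
    h r hr (by simpa using (C (j + 1)).inv_mem hh)
  refine ⟨List.nodup_cons.2 ⟨fun hgT => h g hgT (by simp), hT.nodup⟩,
    List.mem_cons_of_mem _ hT.one_mem, ?_⟩
  intro r hr r' hr' k hk h1 h2 h3 h4
  rcases List.mem_cons.1 hr with hrg | hrT <;> rcases List.mem_cons.1 hr' with hrg' | hrT'
  · rw [hrg, hrg']
  · rw [hrg] at h1 h2 h4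
    have hkj : k = j := by
      rcases lt_trichotomy k j with hlt | rfl | hlt
      · exact absurd (hC (Nat.succ_le_of_lt hlt) hg) h2
      · rfl
      · exact absurd (hC (Nat.succ_le_of_lt hlt) h1) hg1
    subst hkj
    exact absurd h4 (h' r' hrT')
  · rw [hrg'] at h3 h4
    rcases lt_trichotomy k j with hlt | rfl | hlt
    · have h5 := hC (Nat.succ_le_of_lt hlt) hg
      exact absurd (by simpa using (C (k + 1)).mul_mem h5 ((C (k + 1)).inv_mem h4)) h2
    · exact absurd h4 (h r hrT)
    · exact absurd (hC (Nat.succ_le_of_lt hlt) h3) hg1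
  · exact hT.inj r hrT r' hrT' k hk h1 h2 h3 h4

/-- What holds after sifting `g` through `T` along the first `k` levels. -/
structure Sifted (C : ℕ → Subgroup Γ) (m : ℕ) (T : List Γ) (g : Γ) (k : ℕ) (p : List Γ × Γ) :
    Prop where
  suffix : T <:+ p.1
  rest : p.2 ∈ C k
  good : Good C m p.1
  mem : p.2 ∈ Subgroup.closure (Insert.insert g {t | t ∈ T})
  sub : ∀ t ∈ p.1, t ∈ Subgroup.closure (Insert.insert g {t | t ∈ T})
  factor : ∃ a ∈ Subgroup.closure {t | t ∈ p.1}, g = a * p.2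
  same : p.1.length = T.length → (k = 0 ∧ p.2 = g) ∨ 1 ≤ k ∧ ∃ r ∈ T, ∃ c ∈ below C T, g = r * c * p.2
  length_le : p.1.length ≤ T.length + k

/-- At each level the remainder is divided by an entry in its coset, or it is entered and sifting
goes on with `1`. If nothing is ever entered, then `g` is the product of its divisors and the
remainder; the divisor of level 0 is `r`, and all later divisors lie in `C 1`. This gives `same`. -/
theorem sifted (hC : Antitone C) (h0 : C 0 = ⊤)
    (hp : ∀ j < m, ∀ g, pass j g = true ↔ g ∈ C (j + 1)) {T : List Γ} (hT : Good C m T) (g : Γ)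
    {k : ℕ} (hk : k ≤ m) : Sifted C m T g k ((List.range k).foldl (step pass) (T, g)) := by
  induction k with
  | zero =>
    exact ⟨List.suffix_rfl, by simp [h0], hT, Subgroup.subset_closure (by simp),
      fun t ht => Subgroup.subset_closure (by simp [show t ∈ T from ht]),
      ⟨1, one_mem _, by simp⟩, fun _ => Or.inl ⟨rfl, rfl⟩, by simp⟩
  | succ k ih =>
    have hs := ih (by omega)
    rw [List.range_succ, List.foldl_append, List.foldl_cons, List.foldl_nil]
    generalize (List.range k).foldl (step pass) (T, g) = p at hs
    have hpk := hp k hk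
    cases hf : p.1.find? fun r => pass k (r⁻¹ * p.2) with
    | none =>
      have hno : ∀ r ∈ p.1, r⁻¹ * p.2 ∉ C (k + 1) := by
        intro r hr hh
        have := List.find?_eq_none.1 hf r hr
        exact this ((hpk _).2 hh)
      have e : step pass p k = (p.2 :: p.1, 1) := by simp [step, hf]
      rw [e]
      refine ⟨hs.suffix.trans (List.suffix_cons _ _), one_mem _, hs.good.cons hC hs.rest hno,
        one_mem _, ?_, ?_, ?_, ?_⟩
      · intro t ht
        rcases List.mem_cons.1 ht with rfl | ht
        · exact hs.mem
        · exact hs.sub t ht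
      · obtain ⟨a, ha, hga⟩ := hs.factor
        refine ⟨a * p.2, mul_mem (Subgroup.closure_mono (fun t ht => ?_) ha)
          (Subgroup.subset_closure (by simp)), by simpa using hga⟩
        exact List.mem_cons_of_mem _ ht
      · intro hl
        have := hs.suffix.length_le
        simp at hl; omega
      · have := hs.length_le
        simp; omega
    | some r =>
      have hr := List.mem_of_find?_eq_some hf
      have hrp : r⁻¹ * p.2 ∈ C (k + 1) := (hpk _).1 (by simpa using List.find?_some hf)
      have e : step pass p k = (p.1, r⁻¹ * p.2) := by simp [step, hf]
      rw [e]
      refine ⟨hs.suffix, hrp, hs.good, mul_mem (inv_mem (hs.sub r hr)) hs.mem, hs.sub, ?_, ?_, ?_⟩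
      · obtain ⟨a, ha, hga⟩ := hs.factor
        exact ⟨a * r, mul_mem ha (Subgroup.subset_closure hr), by rw [hga]; group⟩
      · intro hl
        have hTp : p.1 = T := (hs.suffix.eq_of_length hl.symm).symm
        have hrT : r ∈ T := hTp ▸ hr
        right
        rcases hs.same hl with ⟨rfl, hg⟩ | ⟨hk1, r0, hr0, c, hc, hg⟩
        · exact ⟨by omega, r, hrT, 1, one_mem _, by rw [hg]; group⟩
        · refine ⟨by omega, r0, hr0, c * r, mul_mem hc (Subgroup.subset_closure ⟨hrT, ?_⟩),
            hg.trans (by group)⟩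
          -- The divisor `r` is a quotient of the old remainder by the new one, and both lie in `C
          -- 1` because `1 ≤ k`.
          simpa using (C 1).mul_mem (hC hk1 hs.rest) ((C 1).inv_mem (hC (by omega) hrp))
      · have := hs.length_le
        simp; omega

/-- Sifting along the whole chain. -/
structure Inserted (C : ℕ → Subgroup Γ) (m : ℕ) (T : List Γ) (g : Γ) (T' : List Γ) : Prop where
  suffix : T <:+ T'
  good : Good C m T'
  sub : ∀ t ∈ T', t ∈ Subgroup.closure (Insert.insert g {t | t ∈ T})
  mem : g ∈ Subgroup.closure {t | t ∈ T'}
  same : T'.length = T.length → ∃ r ∈ T, ∃ c ∈ below C T, g = r * c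

/-- The standing assumptions on a chain of subgroups with a membership test. -/
structure IsChain (C : ℕ → Subgroup Γ) (m : ℕ) (pass : ℕ → Γ → Bool) : Prop where
  anti : Antitone C
  zero : C 0 = ⊤
  last : C m = ⊥
  pos : 0 < m
  pass_iff : ∀ j < m, ∀ g, pass j g = true ↔ g ∈ C (j + 1)

theorem IsChain.good_one (h : IsChain C m pass) : Good C m [1] :=
  ⟨List.nodup_singleton 1, by simp, fun r hr r' hr' _ _ _ _ _ _ => by simp_all⟩

theorem IsChain.inserted (h : IsChain C m pass) {T : List Γ} (hT : Good C m T) (g : Γ) :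
    Inserted C m T g (insert pass m T g) := by
  have hs := sifted h.anti h.zero h.pass_iff hT g le_rfl
  have h1 := hs.rest
  rw [h.last, Subgroup.mem_bot] at h1
  refine ⟨hs.suffix, hs.good, hs.sub, ?_, fun hl => ?_⟩
  · obtain ⟨a, ha, hg⟩ := hs.factor
    rw [h1, mul_one] at hg
    exact hg ▸ ha
  · rcases hs.same hl with ⟨h0, -⟩ | ⟨-, r, hr, c, hc, hg⟩
    · exact absurd h0 h.pos.ne'
    · exact ⟨r, hr, c, hc, by rwa [h1, mul_one] at hg⟩

/-- What holds after sifting a list. -/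
structure Filled (C : ℕ → Subgroup Γ) (m : ℕ) (T S T' : List Γ) : Prop where
  suffix : T <:+ T'
  good : Good C m T'
  sub : ∀ t ∈ T', t ∈ Subgroup.closure ({s | s ∈ S} ∪ {t | t ∈ T})
  mem : ∀ s ∈ S, s ∈ Subgroup.closure {t | t ∈ T'}
  same : T'.length = T.length → ∀ s ∈ S, ∃ r ∈ T, ∃ c ∈ below C T, s = r * c

theorem IsChain.filled (h : IsChain C m pass) {T : List Γ} (hT : Good C m T) (S : List Γ) :
    Filled C m T S (fill pass m T S) := by
  induction S generalizing T with
  | nil =>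
    exact ⟨List.suffix_rfl, hT, fun t ht => Subgroup.subset_closure (Or.inr ht),
      fun _ h => absurd h List.not_mem_nil, fun _ _ h => absurd h List.not_mem_nil⟩
  | cons g S ih =>
    have h1 := h.inserted hT g
    have h2 := ih h1.good
    have e : fill pass m T (g :: S) = fill pass m (insert pass m T g) S := rfl
    rw [e]
    refine ⟨h1.suffix.trans h2.suffix, h2.good, fun t ht => ?_, fun s hs => ?_, fun hl => ?_⟩
    · refine (Subgroup.closure_le _).2 ?_ (h2.sub t ht)
      rintro x (hx | hx)
      · exact Subgroup.subset_closure (Or.inl (List.mem_cons_of_mem _ hx))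
      · refine Subgroup.closure_mono ?_ (h1.sub x hx)
        rintro y (rfl | hy)
        · exact Or.inl List.mem_cons_self
        · exact Or.inr hy
    · rcases List.mem_cons.1 hs with rfl | hs
      · exact Subgroup.closure_mono (fun t ht => h2.suffix.subset ht) h1.mem
      · exact h2.mem s hs
    · have l1 := h1.suffix.length_le
      have l2 := h2.suffix.length_le
      have hl1 : (insert pass m T g).length = T.length := by omega
      have eT := h1.suffix.eq_of_length hl1.symm
      rw [← eT] at h2 hl
      intro s hs
      rcases List.mem_cons.1 hs with rfl | hs
      · exact h1.same hl1
      · exact h2.same hl s hs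

/-- A nontrivial entry lies in exactly one difference C j \ C (j + 1). Its observation on that level
determines its coset modulo `C (j + 1)`, and `Good` allows one entry per coset. The summand 1 counts
the identity. -/
theorem IsChain.length_le (h : IsChain C m pass) {Ω : Type} [Fintype Ω] (obs : ℕ → Γ → Ω)
    (hobs : ∀ j < m, ∀ g ∈ C j, ∀ g' ∈ C j, obs j g = obs j g' → g⁻¹ * g' ∈ C (j + 1))
    {T : List Γ} (hT : Good C m T) : T.length ≤ m * Fintype.card Ω + 1 := by
  classical
  have hlev : ∀ g : Γ, g ≠ 1 → ∃ j : Fin m, g ∈ C j ∧ g ∉ C (j + 1) := by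
    intro g hg
    have hex : ∃ k, g ∉ C k := ⟨m, by simpa [h.last] using hg⟩
    have h1 := Nat.find_spec hex
    have h2 := fun {k : ℕ} => Nat.find_min hex (m := k)
    have h0 : Nat.find hex ≠ 0 := fun h0 => by
      rw [h0, h.zero] at h1
      exact h1 trivial
    have hm : Nat.find hex ≤ m := Nat.find_min' hex (by simpa [h.last] using hg)
    refine ⟨⟨Nat.find hex - 1, by omega⟩, not_not.1 (h2 (Nat.sub_one_lt h0)), ?_⟩
    rwa [show Nat.find hex - 1 + 1 = Nat.find hex by omega]
  choose lev hlev1 hlev2 using hlev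
  let f : Γ → Option (Fin m × Ω) := fun g =>
    if hg : g = 1 then none else some (lev g hg, obs (lev g hg) g)
  rw [← List.toFinset_card_of_nodup hT.nodup]
  calc T.toFinset.card ≤ (Finset.univ : Finset (Option (Fin m × Ω))).card := by
        refine Finset.card_le_card_of_injOn f (fun _ _ => Finset.mem_univ _) ?_
        intro r hr r' hr' he
        simp only [Finset.mem_coe, List.mem_toFinset] at hr hr'
        by_cases h1 : r = 1 <;> by_cases h2 : r' = 1
        · rw [h1, h2]
        · simp [f, h1, h2] at he
        · simp [f, h1, h2] at he
        · simp only [f, h1, h2, dite_false, Option.some.injEq, Prod.mk.injEq] at he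
          obtain ⟨e1, e2⟩ := he
          have h3 := hlev1 r' h2
          rw [← e1] at e2 h3
          exact hT.inj r hr r' hr' _ (lev r h1).2 (hlev1 r h1) (hlev2 r h1) h3
            (hobs _ (lev r h1).2 r (hlev1 r h1) r' h3 e2)
    _ = m * Fintype.card Ω + 1 := by simp

/-- As long as no fixed point is reached, the length grows with every iteration, so after `k`
iterations it is at least `k`. -/
theorem iterate_fixed {X : Type} (f : X → X) (len : X → ℕ) (x : X) (N : ℕ)
    (hf : ∀ k, f (f^[k] x) = f^[k] x ∨ len (f^[k] x) < len (f (f^[k] x)))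
    (hN : ∀ k, len (f^[k] x) < N) : f (f^[N] x) = f^[N] x := by
  have key : ∀ k, f (f^[k] x) = f^[k] x ∨ k ≤ len (f^[k] x) := by
    intro k
    induction k with
    | zero => exact Or.inr (Nat.zero_le _)
    | succ k ih =>
      rw [Function.iterate_succ_apply']
      rcases hf k with h1 | h1
      · rw [h1]; exact Or.inl h1
      · rcases ih with h2 | h2
        · rw [h2]; exact Or.inl h2
        · exact Or.inr (by omega)
  exact (key N).resolve_right (by have := hN N; omega)

/-- The invariants of the rounds. -/
theorem IsChain.rounds (h : IsChain C m pass) (S : List Γ) (k : ℕ) :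
    Good C m ((round pass m)^[k] (fill pass m [1] S)) ∧
      Subgroup.closure {t | t ∈ (round pass m)^[k] (fill pass m [1] S)} =
        Subgroup.closure {s | s ∈ S} := by
  induction k with
  | zero =>
    have h1 := h.filled h.good_one S
    refine ⟨h1.good, le_antisymm ((Subgroup.closure_le _).2 fun t ht => ?_)
      ((Subgroup.closure_le _).2 fun s hs => h1.mem s hs)⟩
    refine (Subgroup.closure_le _).2 ?_ (h1.sub t ht)
    rintro x (hx | hx)
    · exact Subgroup.subset_closure hx
    · rw [List.mem_singleton.1 hx]; exact one_mem _
  | succ k ih =>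
    rw [Function.iterate_succ_apply']
    generalize (round pass m)^[k] (fill pass m [1] S) = T at ih
    have h1 := h.filled ih.1 (T.flatMap fun s => T.map fun r => s * r)
    refine ⟨h1.good, le_antisymm ?_ ?_⟩
    · rw [← ih.2]
      refine (Subgroup.closure_le _).2 fun t ht => (Subgroup.closure_le _).2 ?_ (h1.sub t ht)
      rintro x (hx | hx)
      · simp only [Set.mem_ofPred_eq, List.mem_flatMap, List.mem_map] at hx
        obtain ⟨a, ha, b, hb, rfl⟩ := hx
        exact mul_mem (Subgroup.subset_closure ha) (Subgroup.subset_closure hb)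
      · exact Subgroup.subset_closure hx
    · rw [← ih.2]
      exact Subgroup.closure_mono fun t ht => h1.suffix.subset ht

/-- A completed table: every element of the group is a table entry times an element below. -/
theorem IsChain.table_spec (h : IsChain C m pass) [Finite Γ] (S : List Γ) (N : ℕ)
    (hN : ∀ T, Good C m T → T.length < N) :
    Good C m (table pass m N S) ∧
      (Subgroup.closure {t | t ∈ table pass m N S} = Subgroup.closure {s | s ∈ S}) ∧
      ∀ s ∈ Subgroup.closure {s | s ∈ S}, ∃ r ∈ table pass m N S,
        ∃ c ∈ below C (table pass m N S), s = r * c := by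
  have hr := h.rounds S N
  have hfix : round pass m (table pass m N S) = table pass m N S := by
    refine iterate_fixed (round pass m) List.length _ N (fun k => ?_)
      fun k => hN _ (h.rounds S k).1
    have h1 := h.filled (h.rounds S k).1 (((round pass m)^[k] (fill pass m [1] S)).flatMap fun s =>
      ((round pass m)^[k] (fill pass m [1] S)).map fun r => s * r)
    rcases h1.suffix.length_le.eq_or_lt with h2 | h2
    · exact Or.inl (h1.suffix.eq_of_length h2).symm
    · exact Or.inr h2
  refine ⟨hr.1, hr.2, ?_⟩
  change Good C m (table pass m N S) ∧ Subgroup.closure {t | t ∈ table pass m N S} = _ at hr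
  rw [← hr.2]
  generalize table pass m N S = T at hr hfix
  -- The fixed table did not grow while the products of its entries were sifted, so the field `same`
  -- applies to all of them.
  have hprod : ∀ a ∈ T, ∀ b ∈ T, ∃ r ∈ T, ∃ c ∈ below C T, a * b = r * c := by
    intro a ha b hb
    refine (h.filled hr.1 (T.flatMap fun s => T.map fun r => s * r)).same
      (congrArg List.length hfix) _ ?_
    simp only [List.mem_flatMap, List.mem_map]
    exact ⟨a, ha, b, hb, rfl⟩
  intro s hs
  -- In a finite group the generated subgroup is the generated monoid. It is therefore enough that
  -- the set of products r * c is stable under left multiplication by entries of `T`.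
  rw [← Subgroup.mem_toSubmonoid, Subgroup.closure_toSubmonoid_of_finite] at hs
  have key : ∀ r ∈ T, ∀ c ∈ below C T, ∃ r' ∈ T, ∃ c' ∈ below C T, s * (r * c) = r' * c' := by
    induction hs using Submonoid.closure_induction with
    | mem x hx =>
      intro r hr' c hc
      obtain ⟨r1, hr1, c1, hc1, e⟩ := hprod x hx r hr'
      exact ⟨r1, hr1, c1 * c, mul_mem hc1 hc, by rw [← mul_assoc, e, mul_assoc]⟩
    | one => exact fun r hr' c hc => ⟨r, hr', c, hc, one_mul _⟩
    | mul x y _ _ hx hy =>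
      intro r hr' c hc
      obtain ⟨r1, hr1, c1, hc1, e⟩ := hy r hr' c hc
      rw [mul_assoc, e]
      exact hx r1 hr1 c1 hc1
  simpa using key 1 hr.1.one_mem 1 (one_mem _)

end Sift

/-! ### Removing duplicates with a binary trie -/

namespace Trie

open WhileLang AltTransporter

/-- The subtrie at a path. -/
def descend (t : Data) (k : List Bool) : Data := k.foldl (fun t b => bif b then t.hd else t.tl) t

/-- Whether a key has been entered. -/
def mem (t : Data) (k : List Bool) : Bool := isCons (descend t k)

/-- Enter a key. -/
def ins : Data → List Bool → Data
  | _, [] => .cons .nil .nil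
  | t, b :: k => bif b then .cons (ins t.hd k) t.tl else .cons t.hd (ins t.tl k)

/-- Equal lengths are essential: entering a key overwrites everything below the end of its path, and
it makes all its prefixes look entered. -/
theorem mem_ins (t : Data) (k k' : List Bool) (h : k.length = k'.length) :
    mem (ins t k) k' = true ↔ k' = k ∨ mem t k' = true := by
  induction k generalizing t k' with
  | nil =>
    cases k' with
    | nil => simp [mem, ins, descend, isCons]
    | cons b k' => simp at h
  | cons b k ih =>
    cases k' with
    | nil => simp at h
    | cons b' k' =>
      have hl : k.length = k'.length := by simpa using h
      have e : ∀ (t : Data), mem t (b' :: k') = mem (bif b' then t.hd else t.tl) k' := fun _ => rfl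
      rw [e, e]
      cases b <;> cases b' <;> simp [ins, Data.hd, Data.tl, ih _ _ hl]

variable {X : Type}

/-- One representative for every key. -/
def dedup (key : X → List Bool) (l : List X) : List X :=
  (l.foldl (fun (p : Data × List X) x =>
    bif mem p.1 (key x) then p else (ins p.1 (key x), x :: p.2)) (.nil, [])).2

theorem mem_nil (k : List Bool) : mem .nil k = false := by
  induction k with
  | nil => rfl
  | cons b k ih => cases b <;> exact ih

/-- Every lookup costs only the length of a key, whatever the number of elements kept. This makes
the removal of duplicates linear in the length of the list. -/
theorem dedup_spec (key : X → List Bool) {N : ℕ} (hN : ∀ x, (key x).length = N) (l : List X) :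
    (∀ x ∈ dedup key l, x ∈ l) ∧ (∀ x ∈ l, ∃ y ∈ dedup key l, key y = key x) ∧
      ((dedup key l).map key).Nodup := by
  -- The loop invariant: `done` is the part of the list already treated, and among words of length
  -- `N` the trie holds exactly the keys of the kept elements.
  suffices H : ∀ (l done : List X) (p : Data × List X),
      (∀ k : List Bool, k.length = N → (mem p.1 k = true ↔ ∃ y ∈ p.2, key y = k)) →
      (∀ x ∈ p.2, x ∈ done) → (∀ x ∈ done, ∃ y ∈ p.2, key y = key x) → (p.2.map key).Nodup →
      ∀ q, q = l.foldl (fun (p : Data × List X) x =>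
        bif mem p.1 (key x) then p else (ins p.1 (key x), x :: p.2)) p →
      (∀ x ∈ q.2, x ∈ done ++ l) ∧ (∀ x ∈ done ++ l, ∃ y ∈ q.2, key y = key x) ∧
        (q.2.map key).Nodup by
    simpa [dedup] using H l [] (.nil, []) (by simp [mem_nil]) (by simp) (by simp) (by simp) _ rfl
  intro l
  induction l with
  | nil =>
    rintro done p - h2 h3 h4 q rfl
    simpa using ⟨h2, h3, h4⟩
  | cons a l ih =>
    intro done p h1 h2 h3 h4 q hq
    rw [List.foldl_cons] at hq
    have e : done ++ a :: l = (done ++ [a]) ++ l := by simp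
    rw [e]
    cases hm : mem p.1 (key a) with
    | true =>
      rw [hm, cond_true] at hq
      refine ih (done ++ [a]) p h1 (fun x hx => by simp [h2 x hx]) (fun x hx => ?_) h4 q hq
      rcases List.mem_append.1 hx with hx | hx
      · exact h3 x hx
      · rw [List.mem_singleton.1 hx]
        exact (h1 _ (hN a)).1 hm
    | false =>
      rw [hm, cond_false] at hq
      refine ih (done ++ [a]) _ (fun k hk => ?_) (fun x hx => ?_) (fun x hx => ?_) ?_ q hq
      · rw [mem_ins _ _ _ ((hN a).trans hk.symm), h1 k hk]
        simp [eq_comm]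
      · rcases List.mem_cons.1 hx with rfl | hx
        · simp
        · simp [h2 x hx]
      · rcases List.mem_append.1 hx with hx | hx
        · obtain ⟨y, hy, e⟩ := h3 x hx
          exact ⟨y, List.mem_cons_of_mem _ hy, e⟩
        · exact ⟨a, List.mem_cons_self, by rw [List.mem_singleton.1 hx]⟩
      · rw [List.map_cons, List.nodup_cons]
        refine ⟨fun hmem => ?_, h4⟩
        have := (h1 _ (hN a)).2 (by simpa using hmem)
        simp [hm] at this

end Trie

/-! ### The transporter algorithm -/

namespace AltTransporter

open Matrix

variable {F : Type} [Field F] {n : ℕ}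

local notation "GLn" => Matrix.GeneralLinearGroup (Fin n) F

/-- The standard basis vectors. -/
def basisVec (k : Fin n) : Fin n → F := fun r => (1 : Matrix (Fin n) (Fin n) F) r k

theorem mulVec_basisVec (M : Matrix (Fin n) (Fin n) F) (k : Fin n) :
    M *ᵥ basisVec k = fun r => M r k := by
  funext r
  have := congrFun (congrFun (Matrix.mul_one M) r) k
  rw [Matrix.mul_apply] at this
  exact this

theorem basisVec_vecMul (M : Matrix (Fin n) (Fin n) F) (k : Fin n) :
    basisVec k ᵥ* M = fun c => M k c := by
  funext c
  have := congrFun (congrFun (Matrix.one_mul M) k) c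
  rw [Matrix.mul_apply] at this
  rw [← this]
  simp [vecMul, dotProduct, basisVec, Matrix.one_apply, eq_comm]

/-- The matrices that fix a column vector. -/
def fixVec (v : Fin n → F) : Subgroup GLn where
  carrier := {s | (s : Matrix (Fin n) (Fin n) F) *ᵥ v = v}
  one_mem' := by simp
  mul_mem' {a b} ha hb := by
    rw [Set.mem_ofPred_eq] at *
    rw [Units.val_mul, ← mulVec_mulVec, hb, ha]
  inv_mem' {a} ha := by
    rw [Set.mem_ofPred_eq] at *
    have h : ((a⁻¹ : GLn) : Matrix (Fin n) (Fin n) F) * (a : Matrix (Fin n) (Fin n) F) = 1 := by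
      rw [← Units.val_mul, inv_mul_cancel, Units.val_one]
    nth_rw 1 [← ha]
    rw [mulVec_mulVec, h, one_mulVec]

/-- The matrices that fix a row vector. -/
def fixRow (v : Fin n → F) : Subgroup GLn where
  carrier := {s | v ᵥ* (s : Matrix (Fin n) (Fin n) F) = v}
  one_mem' := by simp
  mul_mem' {a b} ha hb := by
    rw [Set.mem_ofPred_eq] at *
    rw [Units.val_mul, ← vecMul_vecMul, ha, hb]
  inv_mem' {a} ha := by
    rw [Set.mem_ofPred_eq] at *
    have h : (a : Matrix (Fin n) (Fin n) F) * ((a⁻¹ : GLn) : Matrix (Fin n) (Fin n) F) = 1 := by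
      rw [← Units.val_mul, mul_inv_cancel, Units.val_one]
    nth_rw 1 [← ha]
    rw [vecMul_vecMul, h, vecMul_one]

theorem mem_fixVec {v : Fin n → F} {s : GLn} :
    s ∈ fixVec v ↔ (s : Matrix (Fin n) (Fin n) F) *ᵥ v = v := Iff.rfl

theorem mem_fixRow {v : Fin n → F} {s : GLn} :
    s ∈ fixRow v ↔ v ᵥ* (s : Matrix (Fin n) (Fin n) F) = v := Iff.rfl

/-- The matrices that fix a basis vector and both functionals that a form attaches to it. -/
def fixForm (B : Matrix (Fin n) (Fin n) F) (k : Fin n) : Subgroup GLn :=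
  fixVec (basisVec k) ⊓ fixRow (B *ᵥ basisVec k) ⊓ fixRow (basisVec k ᵥ* B)

/-- The chain of subgroups used for sifting. -/
def chain (B : Matrix (Fin n) (Fin n) F) (k : Fin n) : ℕ → Subgroup GLn
  | 0 => ⊤
  | j + 1 => fixForm B k ⊓ ⨅ i : Fin n, ⨅ _ : (i : ℕ) < j, fixVec (basisVec i)

open Classical in
/-- The membership test for the chain. -/
noncomputable def chainTest (B : Matrix (Fin n) (Fin n) F) (k : Fin n) (j : ℕ) (s : GLn) : Bool :=
  decide ((s : Matrix (Fin n) (Fin n) F) *ᵥ basisVec k = basisVec k) &&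
    (decide ((B *ᵥ basisVec k) ᵥ* (s : Matrix (Fin n) (Fin n) F) = B *ᵥ basisVec k) &&
    (decide ((basisVec k ᵥ* B) ᵥ* (s : Matrix (Fin n) (Fin n) F) = basisVec k ᵥ* B) &&
    decide (∀ i : Fin n, (!(decide ((i : ℕ) < j)) ||
      decide ((s : Matrix (Fin n) (Fin n) F) *ᵥ basisVec i = basisVec i)) = true)))

theorem chain_one (B : Matrix (Fin n) (Fin n) F) (k : Fin n) : chain B k 1 = fixForm B k := by
  simp [chain]

/-- One step of the chain leads to `fixForm` and `n` further steps fix the basis vectors one after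
another. A matrix that fixes them all is the identity. -/
theorem isChain (B : Matrix (Fin n) (Fin n) F) (k : Fin n) :
    Sift.IsChain (chain B k) (n + 1) (chainTest B k) where
  anti := by
    refine antitone_nat_of_succ_le fun j => ?_
    cases j with
    | zero => exact le_top
    | succ j =>
      refine inf_le_inf_left _ (le_iInf fun i => le_iInf fun hi => ?_)
      exact iInf_le_of_le i (iInf_le_of_le (by omega) le_rfl)
  zero := rfl
  last := by
    rw [eq_bot_iff]
    intro s hs
    rw [Subgroup.mem_bot]
    have h2 := (Subgroup.mem_inf.1 hs).2
    simp only [Subgroup.mem_iInf, mem_fixVec, mulVec_basisVec] at h2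
    ext r c
    exact congrFun (h2 c c.2) r
  pos := Nat.succ_pos n
  pass_iff := by
    intro j _ s
    simp [chain, chainTest, fixForm, Subgroup.mem_inf, Subgroup.mem_iInf, mem_fixVec, mem_fixRow,
      and_assoc, imp_iff_not_or]

/-- What distinguishes the cosets of a member of the chain in its predecessor. -/
noncomputable def chainObs (B : Matrix (Fin n) (Fin n) F) (k : Fin n) (j : ℕ) (g : GLn) :
    (Fin n → F) × (Fin n → F) × (Fin n → F) :=
  match j with
  | 0 => ((g : Matrix (Fin n) (Fin n) F) *ᵥ basisVec k,
      (B *ᵥ basisVec k) ᵥ* ((g⁻¹ : GLn) : Matrix (Fin n) (Fin n) F),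
      (basisVec k ᵥ* B) ᵥ* ((g⁻¹ : GLn) : Matrix (Fin n) (Fin n) F))
  | j + 1 => (if h : j < n then (g : Matrix (Fin n) (Fin n) F) *ᵥ basisVec ⟨j, h⟩ else 0, 0, 0)

theorem inv_mul_mem_fixVec {v : Fin n → F} {g h : GLn}
    (e : (g : Matrix (Fin n) (Fin n) F) *ᵥ v = (h : Matrix (Fin n) (Fin n) F) *ᵥ v) :
    g⁻¹ * h ∈ fixVec v := by
  rw [mem_fixVec, Units.val_mul, ← mulVec_mulVec, ← e, mulVec_mulVec, ← Units.val_mul,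
    inv_mul_cancel, Units.val_one, one_mulVec]

/-- The left cosets of a row stabilizer are told apart by v g⁻¹, which explains the inverses in
`chainObs`. -/
theorem inv_mul_mem_fixRow {v : Fin n → F} {g h : GLn}
    (e : v ᵥ* ((g⁻¹ : GLn) : Matrix (Fin n) (Fin n) F) =
      v ᵥ* ((h⁻¹ : GLn) : Matrix (Fin n) (Fin n) F)) :
    g⁻¹ * h ∈ fixRow v := by
  rw [mem_fixRow, Units.val_mul, ← vecMul_vecMul, e, vecMul_vecMul, ← Units.val_mul,
    inv_mul_cancel, Units.val_one, vecMul_one]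

theorem chainObs_spec (B : Matrix (Fin n) (Fin n) F) (k : Fin n) (j : ℕ) (hj : j < n + 1)
    (g : GLn) (hg : g ∈ chain B k j) (g' : GLn) (hg' : g' ∈ chain B k j)
    (e : chainObs B k j g = chainObs B k j g') : g⁻¹ * g' ∈ chain B k (j + 1) := by
  cases j with
  | zero =>
    simp only [chainObs, Prod.mk.injEq] at e
    rw [chain_one]
    exact ⟨⟨inv_mul_mem_fixVec e.1, inv_mul_mem_fixRow e.2.1⟩, inv_mul_mem_fixRow e.2.2⟩
  | succ j =>
    have hj' : j < n := by omega
    simp only [chainObs, hj', dite_true, and_true, Prod.mk.injEq] at e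
    have h := mul_mem (inv_mem hg) hg'
    refine Subgroup.mem_inf.2 ⟨(Subgroup.mem_inf.1 h).1, ?_⟩
    have h2 := (Subgroup.mem_inf.1 h).2
    simp only [Subgroup.mem_iInf] at h2 ⊢
    intro i hi
    rcases Nat.lt_succ_iff_lt_or_eq.1 hi with hi | hi
    · exact h2 i hi
    · have : i = ⟨j, hj'⟩ := Fin.ext hi
      subst this
      exact inv_mul_mem_fixVec e

/-- There are n + 1 levels with at most (q^n)³ observations each; only level 0 uses all three
components. -/
theorem length_le_of_good [Fintype F] {B : Matrix (Fin n) (Fin n) F} {k : Fin n} {T : List GLn}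
    (hT : Sift.Good (chain B k) (n + 1) T) :
    T.length ≤ (n + 1) * (Fintype.card F ^ n) ^ 3 + 1 := by
  classical
  have h := (isChain B k).length_le (chainObs B k)
    (fun j hj g hg g' hg' => chainObs_spec B k j hj g hg g' hg') hT
  simpa [Fintype.card_prod, pow_succ, mul_assoc] using h

end AltTransporter

/-! ### Correctness of the transporter algorithm -/

namespace AltTransporter

open Matrix

variable {F : Type} [Field F] {n : ℕ}

local notation "GLn" => Matrix.GeneralLinearGroup (Fin n) F
local notation "Mat" => Matrix (Fin n) (Fin n) F

/-- Two matrices agree in the first `K` rows and columns. -/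
def AgreeOn (K : ℕ) (M N : Mat) : Prop := ∀ r c : Fin n, (r : ℕ) < K → (c : ℕ) < K → M r c = N r c

/-- The span of the first `K` basis vectors is mapped to itself. -/
def StabFlag (K : ℕ) (s : Mat) : Prop := ∀ r c : Fin n, (c : ℕ) < K → K ≤ (r : ℕ) → s r c = 0

theorem StabFlag.one (K : ℕ) : StabFlag K (1 : Mat) := by
  intro r c hc hr
  have : r ≠ c := fun h => by subst h; omega
  simp [Matrix.one_apply, this]

theorem StabFlag.mul {K : ℕ} {s t : Mat} (hs : StabFlag K s) (ht : StabFlag K t) :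
    StabFlag K (s * t) := by
  intro r c hc hr
  rw [Matrix.mul_apply]
  refine Finset.sum_eq_zero fun j _ => ?_
  by_cases hj : (j : ℕ) < K
  · rw [hs r j hj hr, zero_mul]
  · rw [ht j c hc (by omega), mul_zero]

/-- Since `s` maps the span into itself, the restriction of sᵗMs to the span depends only on that of
`M`. -/
theorem AgreeOn.conj {K : ℕ} {M N s : Mat} (h : AgreeOn K M N) (hs : StabFlag K s) :
    AgreeOn K (sᵀ * M * s) (sᵀ * N * s) := by
  intro r c hr hc
  simp only [Matrix.mul_apply, Matrix.transpose_apply]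
  refine Finset.sum_congr rfl fun j _ => ?_
  by_cases hj : (j : ℕ) < K
  · congr 1
    refine Finset.sum_congr rfl fun i _ => ?_
    by_cases hi : (i : ℕ) < K
    · rw [h i j hi hj]
    · rw [hs i r hr (by omega), zero_mul, zero_mul]
  · rw [hs j c hc (by omega), mul_zero, mul_zero]

theorem AgreeOn.trans {K : ℕ} {M N L : Mat} (h : AgreeOn K M N) (h' : AgreeOn K N L) :
    AgreeOn K M L := fun r c hr hc => (h r c hr hc).trans (h' r c hr hc)

theorem AgreeOn.symm {K : ℕ} {M N : Mat} (h : AgreeOn K M N) : AgreeOn K N M :=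
  fun r c hr hc => (h r c hr hc).symm

theorem AgreeOn.mono {K L : ℕ} (hKL : K ≤ L) {M N : Mat} (h : AgreeOn L M N) : AgreeOn K M N :=
  fun r c hr hc => h r c (by omega) (by omega)

/-- A nonempty closed subset of a finite group is a subgroup. -/
def subgroupOfFinite {Γ : Type} [Group Γ] [Finite Γ] (S : Set Γ) (h1 : 1 ∈ S)
    (hmul : ∀ a ∈ S, ∀ b ∈ S, a * b ∈ S) : Subgroup Γ where
  carrier := S
  one_mem' := h1
  mul_mem' {a b} ha hb := hmul a ha b hb
  inv_mem' {a} ha := by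
    have hpow : ∀ k : ℕ, a ^ k ∈ S := fun k => by
      induction k with
      | zero => simpa using h1
      | succ k ih => rw [pow_succ]; exact hmul _ ih _ ha
    have : a⁻¹ = a ^ (orderOf a - 1) := by
      rw [inv_eq_iff_mul_eq_one, ← pow_succ', Nat.sub_add_cancel (orderOf_pos a), pow_orderOf_eq_one]
    exact this ▸ hpow _

/-- The matrix of the form `A` pulled back along `g`. -/
def pull (A : Mat) (g : GLn) : Mat := (g : Mat)ᵀ * A * (g : Mat)

theorem pull_mul (A : Mat) (g h : GLn) : pull A (g * h) = (h : Mat)ᵀ * pull A g * (h : Mat) := by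
  simp only [pull, Units.val_mul, transpose_mul, Matrix.mul_assoc]

/-- The elements of `H` that carry `A` to `B` on the span of the first `K` basis vectors. -/
def partialTransporter (H : Subgroup GLn) (A B : Mat) (K : ℕ) : Set GLn :=
  {g | g ∈ H ∧ AgreeOn K (pull A g) B}

variable [Finite F]

/-- The stabilizer in `H` of the span of the first `K` basis vectors and of `B` on it. -/
def partialStabilizer (H : Subgroup GLn) (B : Mat) (K : ℕ) : Subgroup GLn :=
  subgroupOfFinite {s | s ∈ H ∧ StabFlag K (s : Mat) ∧ AgreeOn K (pull B s) B}
    ⟨one_mem _, StabFlag.one K, fun r c _ _ => by simp [pull]⟩ fun s hs t ht =>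
    ⟨mul_mem hs.1 ht.1, hs.2.1.mul ht.2.1, by
      rw [pull_mul]; exact (hs.2.2.conj ht.2.1).trans ht.2.2⟩

variable {H : Subgroup (Matrix.GeneralLinearGroup (Fin n) F)} {A B : Matrix (Fin n) (Fin n) F} {K : ℕ}

theorem mem_partialStabilizer {s : GLn} : s ∈ partialStabilizer H B K ↔
    s ∈ H ∧ StabFlag K (s : Mat) ∧ AgreeOn K (pull B s) B := Iff.rfl

theorem mul_mem_partialTransporter {x s : GLn} (hx : x ∈ partialTransporter H A B K)
    (hs : s ∈ partialStabilizer H B K) : x * s ∈ partialTransporter H A B K := by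
  refine ⟨mul_mem hx.1 hs.1, ?_⟩
  rw [pull_mul]
  exact (hx.2.conj hs.2.1).trans hs.2.2

/-- This is why one representative per image suffices: elements of the partial transporter with the
same image of the span lie in the same coset of the partial stabilizer. -/
theorem inv_mul_mem_partialStabilizer {x y : GLn} (hx : x ∈ partialTransporter H A B K)
    (hy : y ∈ partialTransporter H A B K) (h : StabFlag K ((x⁻¹ * y : GLn) : Mat)) :
    x⁻¹ * y ∈ partialStabilizer H B K := by
  refine ⟨mul_mem (inv_mem hx.1) hy.1, h, ?_⟩
  have h1 := hx.2.conj h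
  rw [← pull_mul, mul_inv_cancel_left] at h1
  exact h1.symm.trans hy.2

/-- Only row and column `k` of sᵗBs are new. With e the basis vector `k`, se = e gives sᵗBse =
sᵗ(Be), which equals Be because `s` fixes the row vector (Be)ᵗ; the row is treated in the same way
with eᵗB. -/
theorem fixForm_inf_le (k : Fin n) {s : GLn} (hs : s ∈ partialStabilizer H B k)
    (hk : s ∈ fixForm B k) : s ∈ partialStabilizer H B (k + 1) := by
  obtain ⟨⟨h1, h2⟩, h3⟩ := hk
  replace h1 : (s : Mat) *ᵥ basisVec k = basisVec k := h1
  replace h2 : (B *ᵥ basisVec k) ᵥ* (s : Mat) = B *ᵥ basisVec k := h2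
  replace h3 : (basisVec k ᵥ* B) ᵥ* (s : Mat) = basisVec k ᵥ* B := h3
  refine ⟨hs.1, fun r c hc hr => ?_, fun r c hr hc => ?_⟩
  · rcases Nat.lt_succ_iff_lt_or_eq.1 hc with hc | hc
    · exact hs.2.1 r c hc (by omega)
    · have : c = k := Fin.ext hc
      subst this
      rw [mulVec_basisVec] at h1
      have hne : r ≠ c := fun h => by subst h; omega
      rw [congrFun h1 r]
      simp [basisVec, Matrix.one_apply, hne]
  · have hcol : pull B s *ᵥ basisVec k = B *ᵥ basisVec k := by
      rw [pull, ← mulVec_mulVec, h1, ← mulVec_mulVec, mulVec_transpose, h2]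
    have hrow : basisVec k ᵥ* pull B s = basisVec k ᵥ* B := by
      rw [pull, ← vecMul_vecMul, ← vecMul_vecMul, vecMul_transpose, h1, h3]
    rw [mulVec_basisVec, mulVec_basisVec] at hcol
    rw [basisVec_vecMul, basisVec_vecMul] at hrow
    rcases Nat.lt_succ_iff_lt_or_eq.1 hr with hr | hr
    · rcases Nat.lt_succ_iff_lt_or_eq.1 hc with hc | hc
      · exact hs.2.2 r c hr hc
      · rw [Fin.ext hc]; exact congrFun hcol r
    · rw [Fin.ext hr]; exact congrFun hrow c

open Classical in
/-- Test for agreement on the first rows and columns. -/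
noncomputable def formTest (A B : Mat) (K : ℕ) (g : GLn) : Bool :=
  decide (∀ r : Fin n, decide (∀ c : Fin n, (!decide ((r : ℕ) < K) || (!decide ((c : ℕ) < K) ||
    decide (((g : Mat)ᵀ * A * (g : Mat)) r c = B r c))) = true) = true)

open Classical in
/-- Test for mapping the span of the first basis vectors to itself. -/
noncomputable def stabTest (K : ℕ) (s : GLn) : Bool :=
  decide (∀ r : Fin n, decide (∀ c : Fin n, (!decide ((c : ℕ) < K) || (decide ((r : ℕ) < K) ||
    decide ((s : Mat) r c = 0))) = true) = true)

open Classical in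
/-- The bits of a subspace: the membership of all vectors in the image of the span of the first
basis vectors. -/
noncomputable def imageKey (vecs : List (Fin n → F)) (K : ℕ) (x : GLn) : List Bool :=
  vecs.map fun w => decide (∀ r : Fin n, (decide ((r : ℕ) < K) ||
    decide ((((x⁻¹ : GLn) : Mat) *ᵥ w) r = 0)) = true)

theorem formTest_iff {g : GLn} : formTest A B K g = true ↔ AgreeOn K (pull A g) B := by
  simp [formTest, AgreeOn, pull, imp_iff_not_or]

theorem stabTest_iff {s : GLn} : stabTest K s = true ↔ StabFlag K (s : Mat) := by
  simp only [stabTest, StabFlag, decide_eq_true_eq, Bool.or_eq_true, Bool.not_eq_true',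
    decide_eq_false_iff_not]
  refine forall_congr' fun r => forall_congr' fun c => ?_
  by_cases h1 : (c : ℕ) < K <;> by_cases h2 : (r : ℕ) < K <;> simp [h1, h2]; omega

/-- The image of the span of the first basis vectors. -/
def imageSpace (K : ℕ) (x : GLn) : Submodule F (Fin n → F) where
  carrier := {w | ∀ r : Fin n, K ≤ (r : ℕ) → (((x⁻¹ : GLn) : Mat) *ᵥ w) r = 0}
  zero_mem' := by simp
  add_mem' {a b} ha hb r hr := by rw [mulVec_add, Pi.add_apply, ha r hr, hb r hr, add_zero]
  smul_mem' a w hw r hr := by rw [mulVec_smul, Pi.smul_apply, hw r hr, smul_zero]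

open Classical in
theorem imageKey_eq (vecs : List (Fin n → F)) (K : ℕ) (x : GLn) :
    imageKey vecs K x = vecs.map fun w => decide (w ∈ imageSpace K x) := by
  refine List.map_congr_left fun w _ => ?_
  rw [Bool.eq_iff_iff, decide_eq_true_eq, decide_eq_true_eq]
  refine forall_congr' fun r => ?_
  by_cases h : (r : ℕ) < K
  · simp [h]
  · simp [h, not_lt.1 h]

/-- For a basis vector e of the span, ye lies in the image under `y`, hence in the image under `x`,
so x⁻¹ye lies in the span. As `vecs` contains every vector, the key determines the image. -/
theorem stabFlag_of_imageKey {vecs : List (Fin n → F)} (hv : ∀ w, w ∈ vecs) {x y : GLn}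
    (h : imageKey vecs K x = imageKey vecs K y) : StabFlag K ((x⁻¹ * y : GLn) : Mat) := by
  rw [imageKey_eq, imageKey_eq] at h
  intro r c hc hr
  have h1 : (y : Mat) *ᵥ basisVec c ∈ imageSpace K y := by
    intro r' hr'
    rw [mulVec_mulVec, ← Units.val_mul, inv_mul_cancel, Units.val_one, one_mulVec]
    have hne : r' ≠ c := fun h => by subst h; omega
    simp [basisVec, Matrix.one_apply, hne]
  have h2 : (y : Mat) *ᵥ basisVec c ∈ imageSpace K x := by
    have := List.map_inj_left.1 h _ (hv ((y : Mat) *ᵥ basisVec c))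
    simpa [h1] using this
  have h3 := h2 r hr
  rwa [mulVec_mulVec, ← Units.val_mul, mulVec_basisVec] at h3

/-- One step of the algorithm: from the span of the first `k` basis vectors to that of the first
`k + 1`. The state consists of generators of the partial stabilizer and of one representative for
every image of the span under the partial transporter. -/
noncomputable def cosetStep (A B : Mat) (vecs : List (Fin n → F)) (N : ℕ) (k : Fin n)
    (p : List GLn × List GLn) : List GLn × List GLn :=
  let T := Sift.table (chainTest B k) (n + 1) N p.1
  let Y := (p.2.flatMap fun h => T.map fun r => h * r).filter (formTest A B (k + 1))
  (T.filter (chainTest B k 0) ++ (Y.map fun y => (Y.headD 1)⁻¹ * y).filter (stabTest (k + 1)),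
    Trie.dedup (imageKey vecs (k + 1)) Y)

/-- The invariant of the algorithm. -/
structure Invariant (H : Subgroup GLn) (A B : Mat) (K : ℕ) (p : List GLn × List GLn) : Prop where
  mem_iff : ∀ g, g ∈ partialTransporter H A B K ↔
    ∃ h ∈ p.2, ∃ s ∈ Subgroup.closure {s | s ∈ p.1}, g = h * s
  closure_eq : p.2 ≠ [] → Subgroup.closure {s | s ∈ p.1} = partialStabilizer H B K

theorem Invariant.init (gens : List GLn) : Invariant (generated gens) A B 0 (gens, [1]) where
  mem_iff g := by
    simp [partialTransporter, AgreeOn, generated]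
  closure_eq _ := by
    ext s
    simp [mem_partialStabilizer, AgreeOn, StabFlag, generated]

/-- The table splits the partial stabilizer into pieces rc, where c already belongs to the next
stabilizer. Hence only the finitely many products hr have to be tested, and the form test is
constant on each set hr·⟨c⟩. -/
theorem Invariant.step {vecs : List (Fin n → F)} (hv : ∀ w, w ∈ vecs) {N : ℕ} {k : Fin n}
    (hN : ∀ T, Sift.Good (chain B k) (n + 1) T → T.length < N) {p : List GLn × List GLn}
    (hp : Invariant H A B k p) : Invariant H A B (k + 1) (cosetStep A B vecs N k p) := by
  have hch := isChain B k
  obtain ⟨-, hT2, hT3⟩ := hch.table_spec p.1 N hN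
  unfold cosetStep
  generalize Sift.table (chainTest B k) (n + 1) N p.1 = T at hT2 hT3
  set Y := (p.2.flatMap fun h => T.map fun r => h * r).filter (formTest A B (k + 1)) with hY
  have hTsub : ∀ t ∈ T, t ∈ Subgroup.closure {s | s ∈ p.1} := fun t ht =>
    hT2 ▸ Subgroup.subset_closure ht
  have memY : ∀ x, x ∈ Y ↔ (∃ h ∈ p.2, ∃ r ∈ T, h * r = x) ∧ AgreeOn (k + 1) (pull A x) B := by
    intro x
    rw [hY, List.mem_filter, formTest_iff]
    simp
  have Ysub : ∀ x ∈ Y, x ∈ partialTransporter H A B (k + 1) := by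
    intro x hx
    obtain ⟨⟨h, hh, r, hr, e⟩, hf⟩ := (memY x).1 hx
    exact ⟨((hp.mem_iff x).2 ⟨h, hh, r, hTsub r hr, e.symm⟩).1, hf⟩
  have test0 : ∀ t, chainTest B k 0 t = true ↔ t ∈ fixForm B k := fun t => by
    rw [hch.pass_iff 0 (Nat.succ_pos n), chain_one]
  have hKsub : p.2 ≠ [] → ∀ c ∈ Sift.below (chain B k) T, c ∈ partialStabilizer H B (k + 1) := by
    intro hne c hc
    have hc1 := Sift.below_le _ _ hc
    rw [chain_one] at hc1
    refine fixForm_inf_le k ?_ hc1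
    rw [← hp.closure_eq hne]
    exact (Subgroup.closure_le _).2 (fun t ht => hTsub t ht.1) hc
  -- Write g = hrc. Dividing by c, which lies in the next stabilizer, stays in the next partial
  -- transporter, so hr passes the test.
  have cover : ∀ g ∈ partialTransporter H A B (k + 1), p.2 ≠ [] ∧
      ∃ x ∈ Y, ∃ c ∈ Sift.below (chain B k) T, g = x * c := by
    intro g hg
    obtain ⟨h, hh, s, hs, e⟩ := (hp.mem_iff g).1 ⟨hg.1, hg.2.mono (Nat.le_succ _)⟩
    have hne : p.2 ≠ [] := List.ne_nil_of_mem hh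
    obtain ⟨r, hr, c, hc, e'⟩ := hT3 s hs
    refine ⟨hne, h * r, (memY _).2 ⟨⟨h, hh, r, hr, rfl⟩, ?_⟩, c, hc, by rw [e, e', mul_assoc]⟩
    have := (mul_mem_partialTransporter hg (inv_mem (hKsub hne c hc))).2
    rwa [e, e', ← mul_assoc, mul_inv_cancel_right] at this
  -- The default `1` is harmless: if `Y` is empty, then so is the new list of representatives, and
  -- the invariant claims nothing about the generators.
  set x0 := Y.headD 1 with hx0
  have hx0mem : Y ≠ [] → x0 ∈ Y := by
    intro h
    cases hY' : Y with
    | nil => exact absurd hY' h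
    | cons a l => rw [hx0, hY']; simp
  have pne : Y ≠ [] → p.2 ≠ [] := by
    intro h
    obtain ⟨⟨h, hh, -⟩, -⟩ := (memY x0).1 (hx0mem h)
    exact List.ne_nil_of_mem hh
  set S' := T.filter (chainTest B k 0) ++ (Y.map fun y => x0⁻¹ * y).filter (stabTest (k + 1))
    with hS'
  have below_le : ∀ c ∈ Sift.below (chain B k) T, c ∈ Subgroup.closure {s | s ∈ S'} := by
    intro c hc
    refine Subgroup.closure_mono ?_ hc
    rintro t ⟨ht, ht1⟩
    rw [chain_one] at ht1
    rw [Set.mem_ofPred_eq, hS']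
    exact List.mem_append_left _ (List.mem_filter.2 ⟨ht, (test0 t).2 ht1⟩)
  -- For s in the new stabilizer, x₀s = xc with a candidate x. So s = (x₀⁻¹x)c, where x₀⁻¹x = sc⁻¹
  -- passes `stabTest` and is one of the new generators.
  have hclos : Y ≠ [] → Subgroup.closure {s | s ∈ S'} = partialStabilizer H B (k + 1) := by
    intro hne
    refine le_antisymm ((Subgroup.closure_le _).2 fun t ht => ?_) fun s hs => ?_
    · rcases List.mem_append.1 (show t ∈ _ ++ _ from ht) with ht | ht
      · obtain ⟨ht, ht0⟩ := List.mem_filter.1 ht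
        refine fixForm_inf_le k ?_ ((test0 t).1 ht0)
        rw [← hp.closure_eq (pne hne)]
        exact hTsub t ht
      · obtain ⟨ht, hst⟩ := List.mem_filter.1 ht
        obtain ⟨y, hy, rfl⟩ := List.mem_map.1 ht
        exact inv_mul_mem_partialStabilizer (Ysub _ (hx0mem hne)) (Ysub y hy) (stabTest_iff.1 hst)
    · obtain ⟨-, x, hx, c, hc, e⟩ := cover _ (mul_mem_partialTransporter (Ysub _ (hx0mem hne)) hs)
      have e1 : x0⁻¹ * x = s * c⁻¹ := by
        rw [inv_mul_eq_iff_eq_mul, ← mul_assoc, e, mul_inv_cancel_right]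
      have e2 : s = x0⁻¹ * x * c := by rw [e1, inv_mul_cancel_right]
      rw [e2]
      refine mul_mem (Subgroup.subset_closure ?_) (below_le c hc)
      rw [Set.mem_ofPred_eq, hS']
      refine List.mem_append_right _ (List.mem_filter.2 ⟨List.mem_map.2 ⟨x, hx, rfl⟩, ?_⟩)
      rw [stabTest_iff, e1]
      exact (mul_mem hs (inv_mem (hKsub (pne hne) c hc))).2.1
  obtain ⟨d1, d2, -⟩ := Trie.dedup_spec (imageKey vecs ((k : ℕ) + 1)) (N := vecs.length)
    (fun x => by simp [imageKey]) Y
  have Yne : Trie.dedup (imageKey vecs ((k : ℕ) + 1)) Y ≠ [] → Y ≠ [] := by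
    intro h h'
    exact h (by rw [h']; rfl)
  refine ⟨fun g => ⟨fun hg => ?_, ?_⟩, fun h => hclos (Yne h)⟩
  · obtain ⟨hne, x, hx, c, hc, e⟩ := cover g hg
    obtain ⟨y, hy, hyx⟩ := d2 x hx
    have hY0 : Y ≠ [] := List.ne_nil_of_mem hx
    have h1 := inv_mul_mem_partialStabilizer (Ysub y (d1 y hy)) (Ysub x hx)
      (stabFlag_of_imageKey hv hyx)
    refine ⟨y, hy, y⁻¹ * x * c, ?_, by rw [e]; group⟩
    show _ ∈ Subgroup.closure {s | s ∈ S'}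
    rw [hclos hY0]
    exact mul_mem h1 (hKsub hne c hc)
  · rintro ⟨y, hy, s, hs, rfl⟩
    change s ∈ Subgroup.closure {s | s ∈ S'} at hs
    rw [hclos (List.ne_nil_of_mem (d1 y hy))] at hs
    exact mul_mem_partialTransporter (Ysub y (d1 y hy)) hs

/-- The description that the final state gives. -/
def describe (p : List GLn × List GLn) : CosetDescription F n :=
  bif p.2.isEmpty then none
  else some (p.2.headD 1, p.1.map fun s => p.2.headD 1 * s * (p.2.headD 1)⁻¹)

/-- On the full space agreement is equality, and the left coset hG is rewritten as the right coset
(hGh⁻¹)h. The head of the list represents everything, since all elements have the same image of the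
full space. -/
theorem Invariant.describe {p : List GLn × List GLn} (hp : Invariant H A B n p) :
    (describe p).toSet = transporter H A B := by
  have hfull : ∀ M N : Mat, AgreeOn n M N ↔ M = N := fun M N =>
    ⟨fun h => by ext r c; exact h r c r.2 c.2, fun h r c _ _ => by rw [h]⟩
  have htr : ∀ g, g ∈ transporter H A B ↔ g ∈ partialTransporter H A B n := fun g => by
    rw [partialTransporter, Set.mem_ofPred_eq, hfull]; rfl
  obtain ⟨S, L⟩ := p
  cases L with
  | nil =>
    ext g
    rw [htr, hp.mem_iff]
    simp [AltTransporter.describe, CosetDescription.toSet]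
  | cons h L =>
    ext g
    have hh : h ∈ partialTransporter H A B n :=
      (hp.mem_iff h).2 ⟨h, by simp, 1, one_mem _, by simp⟩
    have hcl := hp.closure_eq (by simp)
    have hgen : generated (S.map fun s => h * s * h⁻¹) =
        (Subgroup.closure {s | s ∈ S}).map (MulAut.conj h).toMonoidHom := by
      rw [MonoidHom.map_closure, generated]
      congr 1
      ext x
      simp
    rw [htr]
    show (∃ k ∈ generated (S.map fun s => h * s * h⁻¹), g = k * h) ↔ _
    rw [hgen]
    constructor
    · rintro ⟨k, hk, rfl⟩
      obtain ⟨s, hs, rfl⟩ := Subgroup.mem_map.1 hk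
      refine (hp.mem_iff _).2 ⟨h, by simp, s, hs, by simp⟩
    · intro hg
      refine ⟨h * (h⁻¹ * g) * h⁻¹, Subgroup.mem_map.2 ⟨h⁻¹ * g, ?_, by simp⟩, by simp⟩
      rw [hcl]
      exact inv_mul_mem_partialStabilizer hh hg fun r c _ hr => absurd r.2 (by omega)

end AltTransporter

/-! ### The number of subspaces -/

namespace AltTransporter

variable {F : Type} [Field F] {n : ℕ}

/-- The graph of a linear map between complementary sets of coordinates, given by its matrix. -/
def graphSpace (J : Finset (Fin n)) (m : {c // c ∉ J} → {j // j ∈ J} → F) :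
    Submodule F (Fin n → F) where
  carrier := {w | ∀ c, w c.1 = ∑ j, m c j * w j.1}
  zero_mem' := by simp
  add_mem' {a b} ha hb c := by simp [ha c, hb c, mul_add, Finset.sum_add_distrib]
  smul_mem' a w hw c := by simp [hw c, Finset.mul_sum, mul_left_comm]

/-- Let J be a maximal set of coordinates that are linearly independent as functionals on W. The
other coordinates are combinations of these on W, which gives `m` and W ≤ `graphSpace J m`. Equality
follows from dimensions: a vector of the graph is determined by its J-coordinates, and |J| ≤ dim W*
= dim W. -/
theorem exists_eq_graphSpace (W : Submodule F (Fin n → F)) : ∃ J m, W = graphSpace J m := by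
  classical
  let co : Fin n → Module.Dual F W := fun j => (LinearMap.proj j).comp W.subtype
  obtain ⟨b, -, -, hb2, hb3⟩ := exists_linearIndepOn_extension (v := co)
    (linearIndepOn_empty F co) (Set.empty_subset Set.univ)
  set J := b.toFinset with hJ
  have hJb : ∀ j, j ∈ J ↔ j ∈ b := fun j => by simp [hJ]
  have hli : LinearIndependent F fun j : {j // j ∈ J} => co j.1 :=
    hb3.comp (fun j : {j // j ∈ J} => (⟨j.1, (hJb _).1 j.2⟩ : b)) fun i j h => by
      exact Subtype.ext (congrArg (fun x : b => x.1) h)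
  have hspan : ∀ c, ∃ m : {j // j ∈ J} → F, ∑ j, m j • co j.1 = co c := by
    intro c
    rw [← Submodule.mem_span_range_iff_exists_fun]
    refine Submodule.span_mono ?_ (hb2 ⟨c, trivial, rfl⟩)
    rintro _ ⟨j, hj, rfl⟩
    exact ⟨⟨j, (hJb _).2 hj⟩, rfl⟩
  choose m hm using hspan
  refine ⟨J, fun c => m c.1, Submodule.eq_of_le_of_finrank_le (fun w hw c => ?_) ?_⟩
  · have := LinearMap.congr_fun (hm c.1) ⟨w, hw⟩
    simp only [LinearMap.sum_apply, LinearMap.smul_apply, smul_eq_mul] at this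
    exact this.symm
  · have h1 : Fintype.card {j // j ∈ J} ≤ Module.finrank F W := by
      rw [← Subspace.dual_finrank_eq]
      exact hli.fintype_card_le_finrank
    refine le_trans ?_ h1
    rw [← Module.finrank_fintype_fun_eq_card (R := F)]
    refine LinearMap.finrank_le_finrank_of_injective
      (f := (LinearMap.funLeft F F (Subtype.val : {j // j ∈ J} → Fin n)).comp
        (graphSpace J fun c => m c.1).subtype) ?_
    rw [← LinearMap.ker_eq_bot, LinearMap.ker_eq_bot']
    rintro ⟨w, hw⟩ h0
    have hz : ∀ j : {j // j ∈ J}, w j.1 = 0 := fun j => congrFun h0 j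
    ext j
    by_cases hj : j ∈ J
    · exact hz ⟨j, hj⟩
    · show w j = 0
      rw [hw ⟨j, hj⟩]
      simp [hz]

/-- There are 2^n ≤ q^n choices of J, and for each of them q^(|J|(n - |J|)) matrices, where |J|(n -
|J|) ≤ n²/4. -/
theorem card_submodule_le [Fintype F] :
    Nat.card (Submodule F (Fin n → F)) ≤ Fintype.card F ^ (n + n ^ 2 / 4) := by
  classical
  have hq : 2 ≤ Fintype.card F := Fintype.one_lt_card
  let f : (Σ J : Finset (Fin n), ({c // c ∉ J} → {j // j ∈ J} → F)) →
      Submodule F (Fin n → F) := fun p => graphSpace p.1 p.2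
  have hf : Function.Surjective f := fun W => by
    obtain ⟨J, m, h⟩ := exists_eq_graphSpace W
    exact ⟨⟨J, m⟩, h.symm⟩
  refine (Nat.card_le_card_of_surjective f hf).trans ?_
  rw [Nat.card_eq_fintype_card, Fintype.card_sigma]
  calc _ ≤ ∑ _J : Finset (Fin n), Fintype.card F ^ (n ^ 2 / 4) := by
        refine Finset.sum_le_sum fun J _ => ?_
        rw [Fintype.card_fun, Fintype.card_fun, ← pow_mul]
        refine Nat.pow_le_pow_right (by omega) ?_
        rw [Fintype.card_coe, Fintype.card_subtype_compl, Fintype.card_coe, Fintype.card_fin,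
          Nat.le_div_iff_mul_le (by norm_num)]
        have hJ : J.card ≤ n := by simpa using J.card_le_univ
        obtain ⟨d, hd⟩ := Nat.exists_eq_add_of_le hJ
        rw [show n - J.card = d by omega]
        generalize J.card = a at hd
        subst hd
        zify
        nlinarith [sq_nonneg ((a : ℤ) - d)]
    _ = 2 ^ n * Fintype.card F ^ (n ^ 2 / 4) := by simp
    _ ≤ Fintype.card F ^ (n + n ^ 2 / 4) := by
        rw [pow_add]
        exact Nat.mul_le_mul_right _ (Nat.pow_le_pow_left hq n)

/-! ### The lengths of the lists of the algorithm -/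

local notation "GLn" => Matrix.GeneralLinearGroup (Fin n) F

/-- The keys of the kept elements are distinct and depend only on the image spaces, so the image
spaces are distinct as well. -/
theorem length_dedup_imageKey_le [Finite F] (vecs : List (Fin n → F)) (K : ℕ) (Y : List GLn) :
    (Trie.dedup (imageKey vecs K) Y).length ≤ Nat.card (Submodule F (Fin n → F)) := by
  classical
  obtain ⟨-, -, h⟩ := Trie.dedup_spec (imageKey vecs K) (N := vecs.length)
    (fun x => by simp [imageKey]) Y
  have : ((Trie.dedup (imageKey vecs K) Y).map (imageKey vecs K)).map id =
    ((Trie.dedup (imageKey vecs K) Y).map (imageSpace K)).map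
      fun W => vecs.map fun w => decide (w ∈ W) := by
    rw [List.map_id, List.map_map]
    exact List.map_congr_left fun x _ => imageKey_eq vecs K x
  rw [List.map_id] at this
  rw [this] at h
  have hnd := List.Nodup.of_map _ h
  have := hnd.length_le_natCard
  simpa using this

/-- A bound for the tables. -/
def tableBound (F : Type) [Fintype F] (n : ℕ) : ℕ := (n + 1) * (Fintype.card F ^ n) ^ 3 + 1

/-- Neither bound involves `p.1.length`: the table absorbs any number of incoming generators, so
generator lists cannot grow from step to step. -/
theorem cosetStep_length [Fintype F] (A B : Matrix (Fin n) (Fin n) F) (vecs : List (Fin n → F))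
    (N : ℕ) (k : Fin n) (p : List GLn × List GLn) :
    (cosetStep A B vecs N k p).1.length ≤ (p.2.length + 1) * tableBound F n ∧
      (cosetStep A B vecs N k p).2.length ≤ Nat.card (Submodule F (Fin n → F)) := by
  refine ⟨?_, length_dedup_imageKey_le _ _ _⟩
  have hT : (Sift.table (chainTest B k) (n + 1) N p.1).length ≤ tableBound F n :=
    length_le_of_good ((isChain B k).rounds p.1 N).1
  unfold cosetStep
  generalize Sift.table (chainTest B k) (n + 1) N p.1 = T at hT
  dsimp only
  generalize hY : (p.2.flatMap fun h => T.map fun r => h * r).filter (formTest A B (k + 1)) = Y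
  have h1 : Y.length ≤ p.2.length * tableBound F n := by
    rw [← hY]
    exact (List.length_filter_le _ _).trans (length_flatMap_le _ _ fun h _ => by simpa using hT)
  have h2 := List.length_filter_le (stabTest ((k : ℕ) + 1)) (Y.map fun y => (Y.headD 1)⁻¹ * y)
  have h3 := List.length_filter_le (chainTest B k 0) T
  rw [List.length_map] at h2
  rw [List.length_append, Nat.add_mul, one_mul]
  omega

end AltTransporter

/-! ### The algorithm as a program -/

namespace AltTransporter

open WhileLang
open Enc (enc)

variable {α β γ δ ε : Inst → Type} [∀ i, Enc (α i)] [∀ i, Enc (β i)] [∀ i, Enc (γ i)]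
  [∀ i, Enc (δ i)] [∀ i, Enc (ε i)]

theorem Fast.basisVec {k : ∀ i, α i → Fin i.n} (hk : Fast k) :
    Fast fun i x => (basisVec (k i x) : Fin i.n → i.F) :=
  CompIn.of_eq (Fast.vector (Fast.entry Fast.oneMat Fast.snd (hk.comp Fast.fst))) fun _ _ => rfl

theorem Fast.lt_val {k : ∀ i, α i → Fin i.n} {j : ∀ i, α i → ℕ} (hk : Fast k) (hj : Fast j) :
    Fast fun i x => decide ((k i x : ℕ) < j i x) :=
  Fast.lt hk.val hj 1 fun i x => (k i x).2.le.trans i.dim_le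

theorem Fast.chainTest {k : ∀ i, α i → Fin i.n} {j : ∀ i, α i → ℕ} {g : ∀ i, α i → i.G}
    (hk : Fast k) (hj : Fast j) (hg : Fast g) :
    Fast fun i x => chainTest i.B (k i x) (j i x) (g i x) :=
  CompIn.of_eq ((Fast.vec_eq (hg.coe.mulVec hk.basisVec) hk.basisVec).and <|
    (Fast.vec_eq (Fast.vecMul (Fast.matB.mulVec hk.basisVec) hg.coe)
      (Fast.matB.mulVec hk.basisVec)).and <|
    (Fast.vec_eq (Fast.vecMul (Fast.vecMul hk.basisVec Fast.matB) hg.coe)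
      (Fast.vecMul hk.basisVec Fast.matB)).and <|
    Fast.all_fin ((Fast.lt_val Fast.snd (hj.comp Fast.fst)).not.or
      (Fast.vec_eq ((hg.coe.comp Fast.fst).mulVec (Fast.basisVec Fast.snd))
        (Fast.basisVec Fast.snd)))) fun i x => by
    rw [Bool.eq_iff_iff]; simp [AltTransporter.chainTest]

theorem Fast.formTest {K : ∀ i, α i → ℕ} {g : ∀ i, α i → i.G} (hK : Fast K) (hg : Fast g) :
    Fast fun i x => formTest i.A i.B (K i x) (g i x) :=
  CompIn.of_eq (Fast.all_fin (Fast.all_fin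
    ((Fast.lt_val (Fast.snd.comp Fast.fst) (hK.comp (Fast.fst.comp Fast.fst))).not.or
    ((Fast.lt_val Fast.snd (hK.comp (Fast.fst.comp Fast.fst))).not.or
    (Fast.elem_eq (Fast.entry (((hg.comp (Fast.fst.comp Fast.fst)).coe.transpose.matMul
      Fast.matA).matMul (hg.comp (Fast.fst.comp Fast.fst)).coe)
      (Fast.snd.comp Fast.fst) Fast.snd)
      (Fast.entry Fast.matB (Fast.snd.comp Fast.fst) Fast.snd)))))) fun i x => by
    rw [Bool.eq_iff_iff]; simp [AltTransporter.formTest]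

theorem Fast.stabTest {K : ∀ i, α i → ℕ} {g : ∀ i, α i → i.G} (hK : Fast K) (hg : Fast g) :
    Fast fun i x => stabTest (K i x) (g i x) :=
  CompIn.of_eq (Fast.all_fin (Fast.all_fin
    ((Fast.lt_val Fast.snd (hK.comp (Fast.fst.comp Fast.fst))).not.or
    ((Fast.lt_val (Fast.snd.comp Fast.fst) (hK.comp (Fast.fst.comp Fast.fst))).or
    (Fast.elem_eq (Fast.entry (hg.comp (Fast.fst.comp Fast.fst)).coe
      (Fast.snd.comp Fast.fst) Fast.snd) Fast.zero))))) fun i x => by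
    rw [Bool.eq_iff_iff]; simp [AltTransporter.stabTest]

theorem Fast.imageKey {K : ∀ i, α i → ℕ} {g : ∀ i, α i → i.G} (hK : Fast K) (hg : Fast g) :
    Fast fun i x => imageKey i.vecs (K i x) (g i x) :=
  CompIn.of_eq (Fast.map
    (f := fun i (p : α i × (Fin i.n → i.F)) => decide (∀ r : Fin i.n,
      (decide ((r : ℕ) < K i p.1) || decide (((((g i p.1)⁻¹ : i.G) :
        Matrix (Fin i.n) (Fin i.n) i.F).mulVec p.2) r = 0)) = Bool.true)) Fast.vecs
    (Fast.all_fin ((Fast.lt_val Fast.snd (hK.comp (Fast.fst.comp Fast.fst))).or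
    (Fast.elem_eq (Fast.coord (Fast.mulVec
      (hg.comp (Fast.fst.comp Fast.fst)).glInv.coe (Fast.snd.comp Fast.fst)) Fast.snd)
      Fast.zero))) 1 fun i _ => i.length_vecs_le) fun i x => by
    refine List.map_congr_left fun w _ => ?_
    rw [Bool.eq_iff_iff]

/-! #### Tries -/

theorem Fast.dataCons {f g : ∀ i, α i → Data} (hf : Fast f) (hg : Fast g) :
    Fast fun i x => Data.cons (f i x) (g i x) := CompIn.congr_enc (hf.pair hg) fun _ _ => rfl

theorem Fast.dataNil : Fast fun i (_ : α i) => Data.nil :=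
  Fast.of_expr .nil fun _ _ _ _ _ => rfl

theorem Fast.trieMem {t : ∀ i, α i → Data} {k : ∀ i, α i → List Bool} (ht : Fast t) (hk : Fast k)
    (c : ℕ) (hc : ∀ i x, (k i x).length ≤ i.size ^ c) :
    Fast fun i x => Trie.mem (t i x) (k i x) :=
  CompIn.of_eq (Fast.isCons.comp (Fast.foldl
    (s := fun i (p : α i × Data × Bool) => bif p.2.2 then p.2.1.hd else p.2.1.tl) hk ht
    ((Fast.snd.comp Fast.snd).ite (Fast.hd.comp (Fast.fst.comp Fast.snd))
      (Fast.tl.comp (Fast.fst.comp Fast.snd))) c hc)) fun _ _ => rfl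

theorem length_path (k : List Bool) (p : Data × List (Bool × Data)) :
    (k.foldl (fun (p : Data × List (Bool × Data)) b =>
      (bif b then p.1.hd else p.1.tl, (b, p.1) :: p.2)) p).2.length = p.2.length + k.length := by
  induction k generalizing p with
  | nil => rfl
  | cons b k ih => rw [List.foldl_cons, ih]; simp; omega

/-- The recursion of `Trie.ins` is unrolled into two loops: one descends and records the subtries
passed, the other rebuilds the trie upwards along the record. -/
theorem ins_eq_foldl_path (k : List Bool) (t : Data) (P : List (Bool × Data)) :
    (k.foldl (fun (p : Data × List (Bool × Data)) b =>
      (bif b then p.1.hd else p.1.tl, (b, p.1) :: p.2)) (t, P)).2.foldl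
        (fun u (q : Bool × Data) => bif q.1 then .cons u q.2.tl else .cons q.2.hd u)
        (.cons .nil .nil) =
      P.foldl (fun u (q : Bool × Data) => bif q.1 then .cons u q.2.tl else .cons q.2.hd u)
        (Trie.ins t k) := by
  induction k generalizing t P with
  | nil => rfl
  | cons b k ih =>
    rw [List.foldl_cons, ih, List.foldl_cons]
    cases b <;> rfl

theorem Fast.trieIns {t : ∀ i, α i → Data} {k : ∀ i, α i → List Bool} (ht : Fast t) (hk : Fast k)
    (c : ℕ) (hc : ∀ i x, (k i x).length ≤ i.size ^ c) :
    Fast fun i x => Trie.ins (t i x) (k i x) :=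
  CompIn.of_eq (Fast.foldl
    (s := fun i (p : α i × Data × Bool × Data) =>
      bif p.2.2.1 then Data.cons p.2.1 p.2.2.2.tl else Data.cons p.2.2.2.hd p.2.1)
    (l := fun i x => ((k i x).foldl (fun (p : Data × List (Bool × Data)) b =>
      (bif b then p.1.hd else p.1.tl, (b, p.1) :: p.2)) (t i x, [])).2)
    (Fast.snd.comp (Fast.foldl (β := fun _ => Data × List (Bool × Data))
      (s := fun i (p : α i × (Data × List (Bool × Data)) × Bool) =>
        (bif p.2.2 then p.2.1.1.hd else p.2.1.1.tl, (p.2.2, p.2.1.1) :: p.2.1.2))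
      hk (ht.pair Fast.nil)
      (((Fast.snd.comp Fast.snd).ite (Fast.hd.comp (Fast.fst.comp (Fast.fst.comp Fast.snd)))
        (Fast.tl.comp (Fast.fst.comp (Fast.fst.comp Fast.snd)))).pair
        (Fast.cons ((Fast.snd.comp Fast.snd).pair (Fast.fst.comp (Fast.fst.comp Fast.snd)))
          (Fast.snd.comp (Fast.fst.comp Fast.snd)))) c hc))
    (b := fun _ _ => Data.cons .nil .nil) (Fast.dataNil.dataCons Fast.dataNil)
    ((Fast.fst.comp (Fast.snd.comp Fast.snd)).ite
      ((Fast.fst.comp Fast.snd).dataCons (Fast.tl.comp (Fast.snd.comp (Fast.snd.comp Fast.snd))))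
      ((Fast.hd.comp (Fast.snd.comp (Fast.snd.comp Fast.snd))).dataCons (Fast.fst.comp Fast.snd)))
    c fun i x => by rw [length_path]; simpa using hc i x)
    fun i x => (ins_eq_foldl_path (k i x) (t i x) []).symm

theorem length_imageKey_le (i : Inst) (K : ℕ) (x : i.G) :
    (imageKey i.vecs K x).length ≤ i.size ^ 1 := by
  simpa [imageKey] using i.length_vecs_le

theorem CompIn.dedup : CompIn (fun i (p : Fin i.n × List i.G) =>
    Trie.dedup (imageKey i.vecs ((p.1 : ℕ) + 1)) p.2) fun _ p => p.2.length := by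
  have hK : Fast fun i (p : (Fin i.n × List i.G) × (Data × List i.G) × i.G) =>
      ((p.1.1 : ℕ) + 1) :=
    CompIn.congr_enc (Fast.cons Fast.unit (CompIn.units
      (Fast.val (Fast.fst.comp Fast.fst)))) fun i x => by
      show Data.ofNat _ = Data.cons .nil (Data.ofList _)
      simp [Data.ofNat, Data.ofList, List.replicate_succ, enc]
  have hkey : Fast fun i (p : (Fin i.n × List i.G) × (Data × List i.G) × i.G) =>
      imageKey i.vecs ((p.1.1 : ℕ) + 1) p.2.2 := hK.imageKey (Fast.snd.comp Fast.snd)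
  refine CompIn.of_eq (CompIn.le (Fast.snd.weaken.comp (v := fun _ _ => 0) (CompIn.foldl (B := fun _ _ => 0)
    (β := fun i => Data × List i.G)
    (s := fun i (p : (Fin i.n × List i.G) × (Data × List i.G) × i.G) =>
      bif Trie.mem p.2.1.1 (imageKey i.vecs ((p.1.1 : ℕ) + 1) p.2.2) then p.2.1 else
        (Trie.ins p.2.1.1 (imageKey i.vecs ((p.1.1 : ℕ) + 1) p.2.2), p.2.2 :: p.2.1.2))
    Fast.snd (b := fun _ _ => (Data.nil, [])) (Fast.dataNil.pair Fast.nil)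
    ((Fast.trieMem (Fast.fst.comp (Fast.fst.comp Fast.snd)) hkey 1
        fun i x => length_imageKey_le i _ _).ite (Fast.fst.comp Fast.snd)
      ((Fast.trieIns (Fast.fst.comp (Fast.fst.comp Fast.snd)) hkey 1
        fun i x => length_imageKey_le i _ _).pair
        (Fast.cons (Fast.snd.comp Fast.snd) (Fast.snd.comp (Fast.fst.comp Fast.snd)))))
    (by intros; rfl))) ?_) ?_
  · intro i x; simp
  · intro i x; rfl

end AltTransporter

/-! ### The tables as programs -/

namespace AltTransporter

open WhileLang
open Enc (enc)

variable {α β γ δ ε : Inst → Type} [∀ i, Enc (α i)] [∀ i, Enc (β i)] [∀ i, Enc (γ i)]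
  [∀ i, Enc (δ i)] [∀ i, Enc (ε i)]

instance {X : Type} [Enc X] {p : X → Prop} : Enc {x // p x} := ⟨fun x => enc x.1⟩

theorem Fast.succ {f : ∀ i, α i → ℕ} (hf : Fast f) : Fast fun i x => f i x + 1 :=
  CompIn.congr_enc (Fast.cons Fast.unit (CompIn.units hf)) fun i x => by
    show Data.ofNat _ = Data.cons .nil (Data.ofList _)
    simp [Data.ofNat, Data.ofList, List.replicate_succ, enc]

/-- A unary product is the concatenation of `f` copies of a list of `g` units. -/
theorem Fast.natMul {f g : ∀ i, α i → ℕ} (hf : Fast f) (hg : Fast g) (c : ℕ)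
    (hc : ∀ i x, f i x ≤ i.size ^ c) (hd : ∀ i x, g i x ≤ i.size ^ c) :
    Fast fun i x => f i x * g i x := by
  refine CompIn.congr_enc (CompIn.mono (CompIn.flatMap (B := fun i _ => i.size ^ c)
    (l := fun i x => List.replicate (f i x) ())
    (f := fun i (p : α i × Unit) => List.replicate (g i p.1) ()) (CompIn.units hf)
    (CompIn.units (hg.comp Fast.fst)) (fun _ _ _ _ => Nat.zero_le _) ?_) (2 * c + 1) ?_) ?_
  · intro i x a _
    simpa using hd i x
  · intro i x
    have h1 := i.two_le_size
    have h2 := hc i x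
    have h3 := i.one_le_size_pow c
    simp only [List.length_replicate, zero_add, mul_one]
    calc f i x * (i.size ^ c + 1) ≤ i.size ^ c * (i.size ^ c * 2) := by
          gcongr; omega
      _ ≤ i.size ^ c * (i.size ^ c * i.size) := by gcongr
      _ = i.size ^ (2 * c + 1) := by ring
  · intro i x
    show Data.ofNat _ = enc _
    rw [← enc_replicate]
    congr 1
    refine (List.eq_replicate_iff.2 ⟨by simp, fun _ _ => rfl⟩).symm

/-! #### Sifting -/

theorem CompIn.isSome {f : ∀ i, α i → Option (β i)} {w : ∀ i, α i → ℕ} (hf : CompIn f w) :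
    CompIn (fun i x => (f i x).isSome) w :=
  (CompIn.comp (g := fun i (o : Option (β i)) => o.isSome) (Fast.isSome Fast.id) hf).le fun _ _ => le_rfl

/-- The argument of a sifting step. -/
abbrev SiftArg (i : Inst) : Type := (Fin i.n × List i.G × i.G) × (List i.G × i.G) × Fin (i.n + 1)

theorem CompIn.siftStep : CompIn (fun i (p : SiftArg i) =>
    Sift.step (chainTest i.B p.1.1) p.2.1 p.2.2) fun _ p => p.2.1.1.length := by
  have hT : Fast fun i (p : SiftArg i) => p.2.1.1 := Fast.fst.comp (Fast.fst.comp Fast.snd)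
  have hg : Fast fun i (p : SiftArg i) => p.2.1.2 := Fast.snd.comp (Fast.fst.comp Fast.snd)
  have hfind : CompIn (fun i (p : SiftArg i) => p.2.1.1.find? fun r =>
      chainTest i.B p.1.1 p.2.2 (r⁻¹ * p.2.1.2)) fun i p => p.2.1.1.length :=
    (CompIn.find? (B := fun _ _ => 0) (f := fun i (r : SiftArg i × i.G) =>
      chainTest i.B r.1.1.1 r.1.2.2 (r.2⁻¹ * r.1.2.1.2)) hT
      (Fast.chainTest (Fast.fst.comp (Fast.fst.comp Fast.fst))
        (Fast.val (Fast.snd.comp (Fast.snd.comp Fast.fst)))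
        (Fast.glMul Fast.snd.glInv (hg.comp Fast.fst))) (by intros; rfl)).le fun i x => by simp
  have hgetD : CompIn (fun i (p : SiftArg i) => (p.2.1.1.find? fun r =>
      chainTest i.B p.1.1 p.2.2 (r⁻¹ * p.2.1.2)).getD 1) fun i p => p.2.1.1.length :=
    (CompIn.comp (g := fun i (o : Option i.G) => o.getD 1) (Fast.getD Fast.id Fast.glOne)
      hfind).le fun _ _ => le_rfl
  have hquot := CompIn.comp (g := fun i (p : i.G × i.G) => p.1⁻¹ * p.2)
    (Fast.glMul Fast.fst.glInv Fast.snd) (CompIn.pair hgetD hg)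
  refine CompIn.mono (CompIn.ite (CompIn.isSome hfind) (CompIn.pair hT hquot)
    (Fast.pair (Fast.cons hg hT) Fast.glOne)) 2 fun i p => ?_
  have : 4 ≤ i.size ^ 2 := by nlinarith [i.two_le_size]
  nlinarith [Nat.zero_le p.2.1.1.length]

theorem length_siftStep_le {Γ : Type} [Group Γ] (pass : ℕ → Γ → Bool) (p : List Γ × Γ) (j : ℕ) :
    (Sift.step pass p j).1.length ≤ p.1.length + 1 := by
  unfold Sift.step
  cases (p.1.find? fun r => pass j (r⁻¹ * p.2)).isSome <;> simp

theorem length_foldl_siftStep_le {Γ : Type} [Group Γ] (pass : ℕ → Γ → Bool) {m : ℕ}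
    (l : List (Fin m)) (p : List Γ × Γ) :
    (l.foldl (fun y (j : Fin m) => Sift.step pass y j) p).1.length ≤ p.1.length + l.length := by
  induction l generalizing p with
  | nil => simp
  | cons j l ih =>
    have h1 := ih (Sift.step pass p j)
    have h2 := length_siftStep_le pass p j
    rw [List.foldl_cons, List.length_cons]
    omega

/-- A step adds at most one entry, so throughout the n + 1 levels the table has at most n + 1
entries more than at the start. -/
theorem CompIn.siftInsert : CompIn (fun i (p : Fin i.n × List i.G × i.G) =>
    Sift.insert (chainTest i.B p.1) (i.n + 1) p.2.1 p.2.2) fun _ p => p.2.1.length := by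
  have h := CompIn.foldl (B := fun i (p : Fin i.n × List i.G × i.G) => p.2.1.length + i.n + 1)
    (s := fun i (p : SiftArg i) => Sift.step (chainTest i.B p.1.1) p.2.1 p.2.2)
    (Fast.finRange (m := fun i => i.n + 1) (Fast.succ Fast.dim) 1 fun i => by
      simpa using i.n_le_size) Fast.snd CompIn.siftStep fun i x pre a post hl => by
        have h1 := length_foldl_siftStep_le (chainTest i.B x.1) pre x.2
        have h2 := congrArg List.length hl
        simp only [List.length_finRange, List.length_append, List.length_cons] at h2
        refine h1.trans ?_
        omega
  refine CompIn.of_eq (CompIn.mono (Fast.fst.weaken.comp (v := fun _ _ => 0) h) 4 fun i x => ?_)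
    fun i x => ?_
  · have h1 := i.n_le_size
    have h2 := i.two_le_size
    simp only [List.length_finRange, zero_add, add_zero]
    set M := i.size
    set l := x.2.1.length
    calc (i.n + 1) * (l + i.n + 1 + 1) ≤ M * (M * (l + 1) + M * (l + 1)) := by
          refine Nat.mul_le_mul h1 ?_
          nlinarith
      _ = M * M * 2 * (l + 1) := by ring
      _ ≤ M * M * (M * M) * (l + 1) := by gcongr; nlinarith
      _ = M ^ 4 * (l + 1) := by ring
  · unfold Sift.insert
    rw [← List.map_coe_finRange_eq_range, List.foldl_map]

/-- The tables that occur, together with the index that determines the chain. -/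
abbrev Tab (i : Inst) : Type :=
  {p : Fin i.n × List i.G // Sift.Good (chain i.B p.1) (i.n + 1) p.2}

/-- `CompIn` quantifies over all arguments, so the bound on tables has to be part of their type.
With it, sifting one element into a table takes time polynomial in the size parameter. -/
theorem Tab.length_le {i : Inst} (t : Tab i) : t.1.2.length ≤ i.size ^ 5 := by
  have h1 := length_le_of_good t.2
  have h2 := i.n_le_size
  have h3 := i.pow_n_le_size
  have h4 := i.two_le_size
  have h5 : (i.q ^ i.n) ^ 3 ≤ i.size ^ 3 := Nat.pow_le_pow_left h3 3
  have h6 : (i.n + 1) * (i.q ^ i.n) ^ 3 ≤ i.size * i.size ^ 3 := Nat.mul_le_mul h2 h5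
  have h7 : 1 ≤ i.size ^ 4 := i.one_le_size_pow 4
  calc _ ≤ (i.n + 1) * (i.q ^ i.n) ^ 3 + 1 := h1
    _ ≤ i.size ^ 4 * 2 := by nlinarith
    _ ≤ i.size ^ 4 * i.size := by gcongr
    _ = i.size ^ 5 := by ring

theorem Fast.tabIndex : Fast fun i (t : Tab i) => t.1.1 :=
  Fast.fst.comp (f := fun i (t : Tab i) => t.1) (Fast.recast fun _ _ => rfl)

theorem Fast.tabList : Fast fun i (t : Tab i) => t.1.2 :=
  Fast.snd.comp (f := fun i (t : Tab i) => t.1) (Fast.recast fun _ _ => rfl)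

/-- Sift an element through a table. -/
noncomputable def Tab.insert {i : Inst} (t : Tab i) (g : i.G) : Tab i :=
  ⟨(t.1.1, Sift.insert (chainTest i.B t.1.1) (i.n + 1) t.1.2 g),
    ((isChain i.B t.1.1).inserted t.2 g).good⟩

theorem Fast.tabInsert : Fast fun i (p : Tab i × i.G) => p.1.insert p.2 :=
  CompIn.congr_enc (CompIn.mono (CompIn.pair (Fast.tabIndex.comp Fast.fst)
    (CompIn.siftInsert.comp_fast (Fast.pair (Fast.tabIndex.comp Fast.fst)
      (Fast.pair (Fast.tabList.comp Fast.fst) Fast.snd)))) 5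
    fun i p => by simpa using p.1.length_le) fun i p => rfl

/-- Sift a list of elements through a table. -/
noncomputable def Tab.fill {i : Inst} (t : Tab i) (S : List i.G) : Tab i := S.foldl Tab.insert t

theorem Tab.val_fill {i : Inst} (t : Tab i) (S : List i.G) :
    (t.fill S).1 = (t.1.1, Sift.fill (chainTest i.B t.1.1) (i.n + 1) t.1.2 S) := by
  induction S generalizing t with
  | nil => rfl
  | cons g S ih => exact ih (t.insert g)

theorem CompIn.tabFill : CompIn (fun i (p : Tab i × List i.G) => p.1.fill p.2)
    fun _ p => p.2.length :=
  (CompIn.foldl (B := fun _ _ => 0)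
    (s := fun i (p : (Tab i × List i.G) × Tab i × i.G) => p.2.1.insert p.2.2)
    Fast.snd Fast.fst (Fast.tabInsert.comp Fast.snd) (by intros; rfl)).le fun i p => by simp

theorem Fast.tabProducts : Fast fun i (t : Tab i) =>
    t.1.2.flatMap fun s => t.1.2.map fun r => s * r :=
  CompIn.mono (CompIn.flatMap (B := fun i _ => i.size ^ 5)
    (f := fun i (p : Tab i × i.G) => p.1.1.2.map fun r => p.2 * r) Fast.tabList
    (Fast.map (f := fun i (p : (Tab i × i.G) × i.G) => p.1.2 * p.2)
      (Fast.tabList.comp Fast.fst) (Fast.glMul (Fast.snd.comp Fast.fst) Fast.snd) 5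
      fun i p => p.1.length_le) (fun _ _ _ _ => Nat.zero_le _)
    fun i t _ _ => by simpa using t.length_le) 11 fun i t => by
      have h1 := t.length_le
      have h2 := i.two_le_size
      have h3 := i.one_le_size_pow 5
      calc 0 + t.1.2.length * (i.size ^ 5 + 1) ≤ i.size ^ 5 * (i.size ^ 5 * 2) := by
            rw [zero_add]; gcongr; omega
        _ ≤ i.size ^ 5 * (i.size ^ 5 * i.size) := by gcongr
        _ = i.size ^ 11 * (0 + 1) := by ring

/-- Sift all products of two table entries. -/
noncomputable def Tab.round {i : Inst} (t : Tab i) : Tab i :=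
  t.fill (t.1.2.flatMap fun s => t.1.2.map fun r => s * r)

theorem Tab.val_round {i : Inst} (t : Tab i) :
    t.round.1 = (t.1.1, Sift.round (chainTest i.B t.1.1) (i.n + 1) t.1.2) := Tab.val_fill _ _

theorem Fast.tabRound : Fast fun i (t : Tab i) => t.round :=
  CompIn.mono (CompIn.tabFill.comp_fast (Fast.id.pair Fast.tabProducts)) 10 fun i t => by
    have h1 := length_flatMap_le (fun s => t.1.2.map fun r => s * r) t.1.2 (k := i.size ^ 5)
      fun _ _ => by simpa using t.length_le
    calc _ ≤ _ := h1
      _ ≤ i.size ^ 5 * i.size ^ 5 := by gcongr; exact t.length_le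
      _ = i.size ^ 10 * (0 + 1) := by ring

/-- The number of rounds. -/
def Inst.rounds (i : Inst) : ℕ := (i.n + 1 + 1) * (i.vecs.length * (i.vecs.length * i.vecs.length)) + 1

/-- The number of rounds must strictly exceed the table bound, as `Sift.IsChain.table_spec`
requires; the factor n + 2 in place of n + 1 provides the margin. -/
theorem Inst.lt_rounds (i : Inst) : (i.n + 1) * (i.q ^ i.n) ^ 3 + 1 < i.rounds := by
  have h1 : 1 ≤ i.q ^ i.n := Nat.one_le_pow _ _ (by linarith [i.two_le_q])
  have h2 : 1 ≤ (i.q ^ i.n) ^ 3 := Nat.one_le_pow _ _ h1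
  have h3 : i.q ^ i.n * (i.q ^ i.n * i.q ^ i.n) = (i.q ^ i.n) ^ 3 := by ring
  rw [Inst.rounds, i.length_vecs, h3]
  nlinarith

theorem Inst.rounds_le (i : Inst) : i.rounds ≤ i.size ^ 6 := by
  have h1 := i.n_le_size
  have h2 := i.two_le_size
  have h3 := i.pow_n_le_size
  rw [Inst.rounds, i.length_vecs]
  have h4 : i.q ^ i.n * (i.q ^ i.n * i.q ^ i.n) ≤ i.size * (i.size * i.size) := by gcongr
  have h5 : i.n + 1 + 1 ≤ i.size * 2 := by omega
  have h6 := Nat.mul_le_mul h5 h4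
  have h7 := i.one_le_size_pow 4
  calc _ ≤ i.size * 2 * (i.size * (i.size * i.size)) + 1 := by omega
    _ = i.size ^ 4 * 2 + 1 := by ring
    _ ≤ i.size ^ 4 * (2 * 2) := by omega
    _ ≤ i.size ^ 4 * (i.size * i.size) := by gcongr
    _ = i.size ^ 6 := by ring

theorem Fast.numVecs : Fast fun i (_ : α i) => i.vecs.length :=
  CompIn.congr_enc (Fast.map (f := fun _ _ => ()) Fast.vecs Fast.unit 1
    fun i _ => i.length_vecs_le) fun i x => by
    show Data.ofNat _ = enc _
    rw [← enc_replicate]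
    congr 1
    exact (List.eq_replicate_iff.2 ⟨by simp, fun _ _ => rfl⟩).symm

theorem Fast.rounds : Fast fun i (_ : α i) => i.rounds := by
  have h1 : ∀ i : Inst, i.vecs.length ≤ i.size := fun i => by simpa using i.length_vecs_le
  have h2 : ∀ i : Inst, i.vecs.length * i.vecs.length ≤ i.size ^ 2 := fun i => by
    rw [pow_two]; exact Nat.mul_le_mul (h1 i) (h1 i)
  have h3 : ∀ i : Inst, i.vecs.length * (i.vecs.length * i.vecs.length) ≤ i.size ^ 3 := fun i => by
    calc _ ≤ i.size * i.size ^ 2 := Nat.mul_le_mul (h1 i) (h2 i)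
      _ = i.size ^ 3 := by ring
  refine Fast.succ (Fast.natMul (Fast.succ (Fast.succ Fast.dim)) (Fast.natMul Fast.numVecs
    (Fast.natMul Fast.numVecs Fast.numVecs 1 ?_ ?_) 2 ?_ ?_) 3 ?_ ?_)
  · exact fun i _ => i.length_vecs_le
  · exact fun i _ => i.length_vecs_le
  · exact fun i _ => (h1 i).trans (Nat.le_self_pow (by omega) _)
  · exact fun i _ => h2 i
  · intro i _
    have := i.n_le_size
    have := i.two_le_size
    calc i.n + 1 + 1 ≤ i.size ^ 1 * 2 := by rw [pow_one]; omega
      _ ≤ i.size ^ 1 * i.size ^ 2 := by gcongr; nlinarith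
      _ = i.size ^ 3 := by ring
  · exact fun i _ => h3 i

/-- The completed table of a list of generators. -/
noncomputable def Tab.make {i : Inst} (k : Fin i.n) (S : List i.G) : Tab i :=
  Tab.round^[i.rounds] (Tab.fill ⟨(k, [1]), (isChain i.B k).good_one⟩ S)

theorem Tab.val_make {i : Inst} (k : Fin i.n) (S : List i.G) :
    (Tab.make k S).1 = (k, Sift.table (chainTest i.B k) (i.n + 1) i.rounds S) := by
  unfold Tab.make Sift.table
  generalize i.rounds = N
  induction N with
  | zero => exact Tab.val_fill _ _
  | succ N ih => rw [Function.iterate_succ_apply', Function.iterate_succ_apply', Tab.val_round, ih]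

theorem CompIn.tabMake : CompIn (fun i (p : Fin i.n × List i.G) => Tab.make p.1 p.2)
    fun _ p => p.2.length := by
  have h1 : Fast fun i (p : Fin i.n × List i.G) =>
      (⟨(p.1, [1]), (isChain i.B p.1).good_one⟩ : Tab i) :=
    CompIn.congr_enc (Fast.pair Fast.fst (Fast.cons Fast.glOne Fast.nil)) fun _ _ => rfl
  have h2 : Fast fun i (t : Tab i) => Tab.round^[i.rounds] t :=
    Fast.iterate (s := fun i (p : Tab i × Tab i) => p.2.round) Fast.rounds Fast.id
      (Fast.tabRound.comp Fast.snd) 6 fun i _ => i.rounds_le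
  exact (CompIn.comp h2 (CompIn.tabFill.comp_fast (h1.pair Fast.snd))).le fun i p => by simp

end AltTransporter

/-! ### The main program -/

namespace AltTransporter

open WhileLang
open Enc (enc)

variable {α β γ δ ε : Inst → Type} [∀ i, Enc (α i)] [∀ i, Enc (β i)] [∀ i, Enc (γ i)]
  [∀ i, Enc (δ i)] [∀ i, Enc (ε i)]

/-- The products of representatives and table entries that carry the first form to the second one
on the next span. -/
noncomputable def candidates {i : Inst} (t : Tab i) (L : List i.G) : List i.G :=
  (L.flatMap fun h => t.1.2.map fun r => h * r).filter (formTest i.A i.B ((t.1.1 : ℕ) + 1))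

theorem length_products_le {i : Inst} (t : Tab i) (L : List i.G) :
    (L.flatMap fun h => t.1.2.map fun r => h * r).length ≤ L.length * i.size ^ 5 :=
  length_flatMap_le _ _ fun _ _ => by simpa using t.length_le

theorem length_candidates_le {i : Inst} (t : Tab i) (L : List i.G) :
    (candidates t L).length ≤ L.length * i.size ^ 5 :=
  (List.length_filter_le _ _).trans (length_products_le t L)

theorem Fast.tabSucc : Fast fun i (t : Tab i) => (t.1.1 : ℕ) + 1 :=
  Fast.succ (Fast.val Fast.tabIndex)

theorem CompIn.candidates : CompIn (fun i (p : Tab i × List i.G) => candidates p.1 p.2)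
    fun _ p => p.2.length := by
  have h1 : CompIn (fun i (p : Tab i × List i.G) =>
      p.2.flatMap fun h => p.1.1.2.map fun r => h * r) fun _ p => p.2.length :=
    (CompIn.flatMap (B := fun i _ => i.size ^ 5)
      (f := fun i (p : (Tab i × List i.G) × i.G) => p.1.1.1.2.map fun r => p.2 * r) Fast.snd
      (Fast.map (f := fun i (p : ((Tab i × List i.G) × i.G) × i.G) => p.1.2 * p.2)
        (Fast.tabList.comp (Fast.fst.comp Fast.fst)) (Fast.glMul (Fast.snd.comp Fast.fst) Fast.snd)
        5 fun i p => p.1.1.length_le) (fun _ _ _ _ => Nat.zero_le _)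
      fun i p _ _ => by simpa using p.1.length_le).mono 6 fun i p => by
        have h2 := i.two_le_size
        have h3 := i.one_le_size_pow 5
        calc 0 + p.2.length * (i.size ^ 5 + 1) ≤ (p.2.length + 1) * (i.size ^ 5 * 2) := by
              rw [zero_add]; gcongr <;> omega
          _ ≤ (p.2.length + 1) * (i.size ^ 5 * i.size) := by gcongr
          _ = i.size ^ 6 * (p.2.length + 1) := by ring
  exact (CompIn.filter (B := fun _ _ => 0)
    (f := fun i (p : (Tab i × List i.G) × i.G) =>
      formTest i.A i.B ((p.1.1.1.1 : ℕ) + 1) p.2) h1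
    (Fast.formTest (Fast.tabSucc.comp (Fast.fst.comp Fast.fst)) Fast.snd) (by intros; rfl)).mono 6
    fun i p => by
      have h1 := length_products_le p.1 p.2
      have h2 := i.two_le_size
      have h3 := i.one_le_size_pow 5
      have h4 : i.size ^ 5 * 2 ≤ i.size ^ 6 := by
        calc i.size ^ 5 * 2 ≤ i.size ^ 5 * i.size := by gcongr
          _ = i.size ^ 6 := by ring
      rw [zero_add, mul_one]
      nlinarith [Nat.mul_le_mul_right (p.2.length + 1) h4]

/-- The second half of a step of the algorithm. -/
noncomputable def finishStep {i : Inst} (t : Tab i) (Y : List i.G) : List i.G × List i.G :=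
  (t.1.2.filter (chainTest i.B t.1.1 0) ++
    (Y.map fun y => (Y.headD 1)⁻¹ * y).filter (stabTest ((t.1.1 : ℕ) + 1)),
    Trie.dedup (imageKey i.vecs ((t.1.1 : ℕ) + 1)) Y)

theorem CompIn.finishStep : CompIn (fun i (p : Tab i × List i.G) => finishStep p.1 p.2)
    fun _ p => p.2.length := by
  have h1 : Fast fun i (p : Tab i × List i.G) => p.1.1.2.filter (chainTest i.B p.1.1.1 0) :=
    (CompIn.filter (B := fun _ _ => 0)
      (f := fun i (p : (Tab i × List i.G) × i.G) => chainTest i.B p.1.1.1.1 0 p.2)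
      (Fast.tabList.comp Fast.fst) (Fast.chainTest (Fast.tabIndex.comp (Fast.fst.comp Fast.fst))
        (j := fun _ _ => 0) (Fast.of_expr .nil fun _ _ _ _ _ => rfl) Fast.snd)
      (by intros; rfl)).mono 5 fun i p => by simpa using p.1.length_le
  have h2 : CompIn (fun i (p : Tab i × List i.G) => p.2.map fun y => (p.2.headD 1)⁻¹ * y)
      fun _ p => p.2.length :=
    (CompIn.map (B := fun _ _ => 0)
      (f := fun i (p : (Tab i × List i.G) × i.G) => (p.1.2.headD 1)⁻¹ * p.2)
      Fast.snd (Fast.glMul (Fast.glInv (Fast.headD (Fast.snd.comp Fast.fst) Fast.glOne)) Fast.snd)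
      (by intros; rfl)).le fun i p => by simp
  have h3 := CompIn.filter (B := fun _ _ => 0)
    (f := fun i (p : (Tab i × List i.G) × i.G) => stabTest ((p.1.1.1.1 : ℕ) + 1) p.2) h2
    (Fast.stabTest (Fast.tabSucc.comp (Fast.fst.comp Fast.fst)) Fast.snd) (by intros; rfl)
  have h4 := CompIn.dedup.comp_fast (f := fun i (p : Tab i × List i.G) => (p.1.1.1, p.2))
    (Fast.pair (Fast.tabIndex.comp Fast.fst) Fast.snd)
  refine CompIn.of_eq (CompIn.mono ((CompIn.append.comp (CompIn.pair h1 h3)).pair h4) 7 ?_)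
    fun i p => rfl
  intro i p
  have h5 := (List.length_filter_le (chainTest i.B p.1.1.1 0) p.1.1.2).trans p.1.length_le
  have h6 := i.two_le_size
  have h7 := i.one_le_size_pow 5
  have h8 : i.size ^ 5 * 4 ≤ i.size ^ 7 := by
    calc i.size ^ 5 * 4 ≤ i.size ^ 5 * (i.size * i.size) := by gcongr; nlinarith
      _ = i.size ^ 7 := by ring
  simp only [List.length_map]
  nlinarith [Nat.mul_le_mul_right (p.2.length + 1) h8, Nat.zero_le (i.size ^ 5 * p.2.length)]

theorem CompIn.cosetStep : CompIn (fun i (p : Fin i.n × List i.G × List i.G) =>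
    cosetStep i.A i.B i.vecs i.rounds p.1 p.2) fun _ p => p.2.1.length + p.2.2.length := by
  have h1 := CompIn.pair (CompIn.tabMake.comp_fast
    (f := fun i (p : Fin i.n × List i.G × List i.G) => (p.1, p.2.1))
    (Fast.pair Fast.fst (Fast.fst.comp Fast.snd))) (Fast.snd.comp Fast.snd)
  have h2 : CompIn (fun i (p : Tab i × List i.G) => AltTransporter.finishStep p.1
      (AltTransporter.candidates p.1 p.2)) fun _ p => p.2.length :=
    (CompIn.finishStep.comp (CompIn.pair Fast.fst CompIn.candidates)).mono 6 fun i p => by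
      have h3 := length_candidates_le p.1 p.2
      have h4 := i.one_le_size_pow 5
      have h5 : i.size ^ 5 * 2 ≤ i.size ^ 6 := by
        have := i.two_le_size
        calc i.size ^ 5 * 2 ≤ i.size ^ 5 * i.size := by gcongr
          _ = i.size ^ 6 := by ring
      dsimp only
      nlinarith [Nat.mul_le_mul_right (p.2.length + 1) h5]
  refine CompIn.of_eq (CompIn.le (h2.comp h1) fun i p => by simp) fun i p => ?_
  simp only [AltTransporter.cosetStep, AltTransporter.finishStep, AltTransporter.candidates,
    Tab.val_make]

/-! ### Bounds and correctness for the whole run -/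

/-- The states of the algorithm. -/
noncomputable def states (i : Inst) (l : List (Fin i.n)) : List i.G × List i.G :=
  l.foldl (fun p k => cosetStep i.A i.B i.vecs i.rounds k p) (i.gens, [1])

/-- The number of subspaces. -/
noncomputable def Inst.numSubspaces (i : Inst) : ℕ := Nat.card (Submodule i.F (Fin i.n → i.F))

theorem Inst.tableBound_le (i : Inst) : tableBound i.F i.n ≤ i.size ^ 6 :=
  (i.lt_rounds.le).trans i.rounds_le

/-- These bounds hold at every moment of the run. The summand `i.gens.length` and the extra 1
account for the initial state; the 2 arises because a step starts from at most `i.numSubspaces + 1`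
representatives and adds the entries of one more table. -/
theorem length_states (i : Inst) (l : List (Fin i.n)) :
    (states i l).1.length ≤ i.gens.length + (i.numSubspaces + 2) * tableBound i.F i.n ∧
      (states i l).2.length ≤ i.numSubspaces + 1 := by
  induction l using List.reverseRecOn with
  | nil => simp [states]
  | append_singleton l k ih =>
    obtain ⟨h1, h2⟩ := cosetStep_length i.A i.B i.vecs i.rounds k (states i l)
    have e : states i (l ++ [k]) = cosetStep i.A i.B i.vecs i.rounds k (states i l) := by
      simp [states]
    rw [e]
    refine ⟨h1.trans (le_add_left (Nat.mul_le_mul_right _ (by omega))), h2.trans (Nat.le_succ _)⟩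

theorem invariant_states (i : Inst) (l post : List (Fin i.n)) (h : List.finRange i.n = l ++ post) :
    Invariant (generated i.gens) i.A i.B l.length (states i l) := by
  induction l using List.reverseRecOn generalizing post with
  | nil => exact Invariant.init i.gens
  | append_singleton l k ih =>
    have e : states i (l ++ [k]) = cosetStep i.A i.B i.vecs i.rounds k (states i l) := by
      simp [states]
    have hk : (k : ℕ) = l.length := by
      have h1 : l.length < (List.finRange i.n).length := by rw [h]; simp
      have h2 : (List.finRange i.n)[l.length] = k := by simp [h]
      rw [List.getElem_finRange] at h2
      rw [← h2]; rfl
    have hi := ih ([k] ++ post) (by simpa using h)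
    rw [← hk] at hi
    rw [e, List.length_append, List.length_singleton, ← hk]
    exact hi.step i.mem_vecs fun T hT => (length_le_of_good hT).trans_lt i.lt_rounds

/-- The result of the algorithm. -/
noncomputable def Inst.result (i : Inst) : CosetDescription i.F i.n :=
  describe (states i (List.finRange i.n))

theorem Inst.toSet_result (i : Inst) :
    i.result.toSet = transporter (generated i.gens) i.A i.B := by
  have h := invariant_states i (List.finRange i.n) [] (by simp)
  rw [List.length_finRange] at h
  exact h.describe

theorem CompIn.describe : CompIn (fun i (p : List i.G × List i.G) =>
    (describe p : CosetDescription i.F i.n)) fun _ p => p.1.length := by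
  have hh : Fast fun i (p : List i.G × List i.G) => p.2.headD 1 := Fast.headD Fast.snd Fast.glOne
  have h1 : CompIn (fun i (p : List i.G × List i.G) =>
      p.1.map fun s => p.2.headD 1 * s * (p.2.headD 1)⁻¹) fun _ p => p.1.length :=
    (CompIn.map (B := fun _ _ => 0)
      (f := fun i (p : (List i.G × List i.G) × i.G) => p.1.2.headD 1 * p.2 * (p.1.2.headD 1)⁻¹)
      Fast.fst (Fast.glMul (Fast.glMul (hh.comp Fast.fst) Fast.snd) (hh.comp Fast.fst).glInv)
      (by intros; rfl)).le fun i p => by simp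
  refine CompIn.congr_enc (CompIn.le (CompIn.ite (Fast.isEmpty Fast.snd) Fast.dataNil
    (CompIn.toData (CompIn.pair hh h1))) fun i p => by simp) fun i p => ?_
  unfold AltTransporter.describe
  cases p.2.isEmpty with
  | true => rfl
  | false => exact congrArg (Data.cons _) (encodeGLList_eq i _)

/-- A bound for the lengths of the lists in a state. -/
noncomputable def Inst.stateBound (i : Inst) : ℕ :=
  i.gens.length + (i.numSubspaces + 2) * tableBound i.F i.n + (i.numSubspaces + 1)

theorem Inst.stateBound_le (i : Inst) :
    i.stateBound + 1 ≤ i.size ^ 8 * (i.gens.length + i.numSubspaces + 1) := by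
  have h3 := i.tableBound_le
  have h5 := i.two_le_size
  have h6 := i.one_le_size_pow 6
  have h7 := Nat.mul_le_mul_left (i.numSubspaces + 2) h3
  have h8 : i.size ^ 6 * 4 ≤ i.size ^ 8 := by
    calc i.size ^ 6 * 4 ≤ i.size ^ 6 * (i.size * i.size) := by gcongr; nlinarith
      _ = i.size ^ 8 := by ring
  refine le_trans ?_ (Nat.mul_le_mul_right _ h8)
  unfold Inst.stateBound
  nlinarith [Nat.mul_le_mul_right i.gens.length h6, Nat.mul_le_mul_right i.numSubspaces h6]

theorem CompIn.states : CompIn (fun i (_ : Unit) => states i (List.finRange i.n))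
    fun i _ => i.n * (i.stateBound + 1) := by
  have hinit : Fast fun i (_ : Unit) => ((i.gens, [1]) : List i.G × List i.G) :=
    Fast.pair Fast.gens (Fast.cons Fast.glOne Fast.nil)
  have hstep : CompIn (fun i (p : Unit × (List i.G × List i.G) × Fin i.n) =>
      AltTransporter.cosetStep i.A i.B i.vecs i.rounds p.2.2 p.2.1)
      fun _ p => p.2.1.1.length + p.2.1.2.length :=
    CompIn.cosetStep.comp_fast (f := fun i (p : Unit × (List i.G × List i.G) × Fin i.n) =>
      (p.2.2, p.2.1)) (Fast.pair (Fast.snd.comp Fast.snd) (Fast.fst.comp Fast.snd))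
  have hrange : Fast fun i (_ : Unit) => List.finRange i.n := Fast.finRange Fast.dim 1 Inst.dim_le
  have h1 := CompIn.foldl (B := fun i _ => i.stateBound) hrange hinit hstep
    fun i _ pre _ _ _ => add_le_add (length_states i pre).1 (length_states i pre).2
  refine CompIn.of_eq (CompIn.le h1 fun i x => ?_) fun i x => ?_
  · rw [List.length_finRange]; simp
  · rfl

theorem CompIn.result : CompIn (fun i (_ : Unit) => i.result)
    fun i _ => i.gens.length + i.numSubspaces := by
  have h := CompIn.comp (f := fun i (_ : Unit) => AltTransporter.states i (List.finRange i.n))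
    CompIn.describe CompIn.states
  refine CompIn.mono h 9 fun i x => ?_
  have h1 := (length_states i (List.finRange i.n)).1
  have h2 := i.stateBound_le
  have h3 := i.n_le_size
  have h4 : (AltTransporter.states i (List.finRange i.n)).1.length ≤ i.stateBound + 1 :=
    h1.trans (by unfold Inst.stateBound; omega)
  calc _ ≤ i.n * (i.stateBound + 1) + (i.stateBound + 1) := Nat.add_le_add_left h4 _
    _ = (i.n + 1) * (i.stateBound + 1) := by ring
    _ ≤ i.size * (i.size ^ 8 * (i.gens.length + i.numSubspaces + 1)) := Nat.mul_le_mul h3 h2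
    _ = _ := by ring

/-- With M = q^(n+1) and Q = q^⌊n²/4⌋ one has s ≤ MQ, and 8M ≤ M⁴ leaves room for all additive
constants. This accounts for `c + 4` in the exponent. The summand 4 on the left is the time of the
two assignments that precede the main program. -/
theorem time_le (q n c g s : ℕ) (hq : 2 ≤ q) (hs : s ≤ q ^ (n + n ^ 2 / 4)) :
    (((q ^ (n + 1)) ^ c * (g + s + 1) + 4 : ℕ) : ℝ) ≤
      (q : ℝ) ^ ((n : ℝ) ^ 2 / 4 + ((c + 4 : ℕ) : ℝ) * ((n : ℝ) + 1)) +
        (g : ℝ) * (q : ℝ) ^ (((c + 4 : ℕ) : ℝ) * ((n : ℝ) + 1)) := by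
  have hq0 : (0 : ℝ) < q := by exact_mod_cast (by omega : 0 < q)
  have hq1 : (1 : ℝ) ≤ q := by exact_mod_cast (by omega : 1 ≤ q)
  have hMn : 2 ≤ q ^ (n + 1) := hq.trans (Nat.le_self_pow (by omega) _)
  set M := q ^ (n + 1) with hM
  have e1 : (q : ℝ) ^ (((c + 4 : ℕ) : ℝ) * ((n : ℝ) + 1)) = ((M ^ (c + 4) : ℕ) : ℝ) := by
    rw [mul_comm, hM, ← pow_mul]
    push_cast
    rw [← Real.rpow_natCast]
    push_cast
    rfl
  have e2 : (q : ℝ) ^ ((n : ℝ) ^ 2 / 4) ≥ ((q ^ (n ^ 2 / 4) : ℕ) : ℝ) := by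
    push_cast
    rw [← Real.rpow_natCast (q : ℝ) (n ^ 2 / 4), ge_iff_le]
    refine Real.rpow_le_rpow_of_exponent_le hq1 ?_
    have := @Nat.cast_div_le ℝ _ _ _ (n ^ 2) 4
    simpa using this
  rw [Real.rpow_add hq0, e1]
  have hnat : M ^ c * (g + s + 1) + 4 ≤ q ^ (n ^ 2 / 4) * M ^ (c + 4) + g * M ^ (c + 4) := by
    have h1 : q ^ (n + n ^ 2 / 4) ≤ M * q ^ (n ^ 2 / 4) := by
      rw [pow_add, hM]
      exact Nat.mul_le_mul_right _ (Nat.pow_le_pow_right (by omega) (by omega))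
    have h2 : 1 ≤ q ^ (n ^ 2 / 4) := Nat.one_le_pow _ _ (by omega)
    have h3 : 1 ≤ M ^ c := Nat.one_le_pow _ _ (by omega)
    set Q := q ^ (n ^ 2 / 4)
    have h4 : M ^ (c + 4) = M ^ c * M ^ 4 := pow_add _ _ _
    have h5 : 8 * M ≤ M ^ 4 := by
      calc 8 * M = 2 * 2 * 2 * M := by ring
        _ ≤ M * M * M * M := by gcongr
        _ = M ^ 4 := by ring
    have h6 : g + s + 1 + 4 ≤ (Q + g) * M ^ 4 := by nlinarith
    calc M ^ c * (g + s + 1) + 4 ≤ M ^ c * (g + s + 1 + 4) := by nlinarith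
      _ ≤ M ^ c * ((Q + g) * M ^ 4) := Nat.mul_le_mul_left _ h6
      _ = Q * M ^ (c + 4) + g * M ^ (c + 4) := by rw [h4]; ring
  have hM0 : (0 : ℝ) ≤ ((M ^ (c + 4) : ℕ) : ℝ) := Nat.cast_nonneg _
  calc ((M ^ c * (g + s + 1) + 4 : ℕ) : ℝ)
      ≤ ((q ^ (n ^ 2 / 4) * M ^ (c + 4) + g * M ^ (c + 4) : ℕ) : ℝ) := by exact_mod_cast hnat
    _ = ((q ^ (n ^ 2 / 4) : ℕ) : ℝ) * ((M ^ (c + 4) : ℕ) : ℝ) +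
        (g : ℝ) * ((M ^ (c + 4) : ℕ) : ℝ) := by push_cast; ring
    _ ≤ _ := by gcongr

end AltTransporter

theorem theorem7p3 :
    ∃ (P : WhileLang.Cmd) (c : ℕ),
      ∀ (F : Type) [Field F] [Fintype F] (e : F ≃ Fin (Fintype.card F)) (n : ℕ)
        (gens : List (Matrix.GeneralLinearGroup (Fin n) F))
        (A B : Matrix (Fin n) (Fin n) F),
        AltTransporter.IsAlternating A → AltTransporter.IsAlternating B →
        ∃ (out : AltTransporter.CosetDescription F n) (t : ℕ),
          WhileLang.Computes P (AltTransporter.encodeInput e gens A B) t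
            (AltTransporter.encodeOutput e out) ∧
          out.toSet = AltTransporter.transporter (AltTransporter.generated gens) A B ∧
          (t : ℝ) ≤
            (Fintype.card F : ℝ) ^ ((n : ℝ) ^ 2 / 4 + (c : ℝ) * ((n : ℝ) + 1)) +
              (gens.length : ℝ) * (Fintype.card F : ℝ) ^ ((c : ℝ) * ((n : ℝ) + 1)) := by
  obtain ⟨P, c, hP⟩ := AltTransporter.CompIn.result
  -- The input moves to variable `3`, where it serves as the read-only context, and variable `0` is
  -- reset to `nil`, the encoding of `()`.
  refine ⟨.seq (.assign 3 (.var 0)) (.seq (.assign 0 .nil) P), c + 4, ?_⟩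
  intro F _ _ e n gens A B _ _
  let i : AltTransporter.Inst := ⟨F, e, n, gens, A, B⟩
  obtain ⟨s, τ, hs, hr, h0, -, -⟩ := hP i ()
    (Function.update (Function.update (WhileLang.initStore i.ctx) 3 i.ctx) 0 .nil)
    (by simp; rfl) (by simp)
  refine ⟨i.result, _, ⟨τ, (WhileLang.Runs.assign_eq (v := i.ctx) rfl).seq
    ((WhileLang.Runs.assign_eq (v := .nil) rfl).seq hr), h0⟩, i.toSet_result, ?_⟩
  refine le_trans ?_ (AltTransporter.time_le (Fintype.card F) n c gens.length i.numSubspaces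
    i.two_le_q AltTransporter.card_submodule_le)
  have h1 : s ≤ (Fintype.card F ^ (n + 1)) ^ c * (gens.length + i.numSubspaces + 1) := hs
  simp only [WhileLang.Expr.cost]
  exact_mod_cast (by omega)
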